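/- Let $G$ be a finite simple graph of maximum degree at most $4$, let $H\subseteq G$ be a subgraph with a planar embedding $\mathcal E_H$ (rotations, i.e. clockwise cyclic orders of the edges at the vertices, together with the faces, hence also the relative positions of the connected components and the unbounded face). Let $\mathcal P$ be a set of port constraints: for each $H$-edge $e$ at a vertex $v$, with $e'$ the next $H$-edge clockwise at $v$ in $\mathcal E_H$, a number $\mathcal P(e,e')\in\mathbb N$ such that at each vertex $v$ with $\deg_H(v)\ge 1$ these numbers sum to $4-\deg_H(v)$. A planar embedding $\mathcal E_G$ of $G$ extends $\mathcal E_H$ if its restriction to $H$ is $\mathcal E_H$; it satisfies the port constraints if, for each $\mathcal P(e,e')=k$, at most $k$ edges of $E(G)\setminus E(H)$ (called $G$-edges) lie between $e$ and $e'$, clockwise, in the rotation of $\mathcal E_G$ at the common vertex. Let $(G',H',\mathcal E_{H'})$ be obtained from $(G,H,\mathcal E_H)$ by the following modification at each vertex $v$ with $1<\deg_H(v)<\deg_G(v)$, with all other data inherited. 1. If $\deg_H(v)=3$ and $\deg_G(v)=4$, let $vw$ be the $G$-edge at $v$, and let $e_1,e_2$ be the consecutive $H$-edges at $v$ with $\mathcal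 P(e_1,e_2)=1$. Subdivide $vw$ by a new vertex $w'$, add $w'$ and $vw'$ to $H'$, and insert $vw'$ between $e_1$ and $e_2$ in the rotation at $v$ in $\mathcal E_{H'}$. 2. If $\deg_H(v)=2$ and the $H$-edges $e_1,e_2$ at $v$ satisfy $\mathcal P(e_1,e_2)=2$ and $\mathcal P(e_2,e_1)=0$, replace the (one or two) $G$-edges $vw$ (and $vz$) at $v$ by a new vertex $w'$ and the edges $vw'$, $w'w$ (and $w'z$), add $w'$ and $vw'$ to $H'$, and insert $vw'$ between $e_1$ and $e_2$ in the rotation at $v$ in $\mathcal E_{H'}$. 3. If $\deg_H(v)=2$, $\deg_G(v)=4$ and the $H$-edges $e_1=vw_1$, $e_2=vw_2$ satisfy $\mathcal P(e_1,e_2)=\mathcal P(e_2,e_1)=1$, let $vw,vz$ be the $G$-edges at $v$. Subdivide $vw,vz,vw_1,vw_2$ by new vertices $w',z',w_1',w_2'$, respectively, and add the cycle $w'w_1'z'w_2'$ to $G'$. In $H'$ the edges $vw_1,vw_2$ are replaced by their subdivisions, in the same positions of the rotations; the edges of the cycle and the subdivided edges $vw,vz$ are not in $H'$. 4. If $\deg_H(v)=2$,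 $\deg_G(v)=3$ and $\mathcal P(e_1,e_2)=\mathcal P(e_2,e_1)=1$, nothing is changed at $v$. Then $\mathcal E_{H'}$ is a planar embedding of $H'$, and $G'$ has a planar embedding that extends $\mathcal E_{H'}$ if and only if $G$ has a planar embedding that extends $\mathcal E_H$ and satisfies the port constraints. -/

import Mathlib

universe u

/-- `IsAngle K v w`: the pair `(v, w)` names a corner (angle) of `K` at the vertex `v`: for an edge
`vw` it is the sector at `v` that follows `vw` in clockwise direction; an isolated vertex `v` has
the single corner `(v, v)`. -/
def IsAngle {V : Type u} {G : SimpleGraph V} (K : G.Subgraph) (v w : V) : Prop :=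
  K.Adj v w ∨ (v = w ∧ v ∈ K.verts ∧ ∀ x, ¬ K.Adj v x)

/-- Combinatorial data describing a drawing, in the plane, of a (possibly disconnected) graph `K`.
Values of `rot` off the edges and of `faceOf` off the corners are irrelevant. -/
structure EmbeddingData {V : Type u} {G : SimpleGraph V} (K : G.Subgraph) where
  /-- `rot v w` is the neighbour of `v` that follows `w` in the clockwise rotation at `v`. -/
  rot : V → V → V
  /-- The faces of the drawing. -/
  Face : Type u
  /-- The face in which the corner `(v, w)` lies. This records facial walks as well as the relative
  positions of the connected components. -/
  faceOf : V → V → Face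
  /-- The unbounded face. -/
  outer : Face

/-- The data describe a planar embedding: `rot v` permutes the neighbours of every vertex `v` in one
cycle, corners that follow each other on a facial walk lie in the same face, every face has a corner
on its boundary (unless there is no vertex at all), the resulting surface is connected, and it is a
sphere, that is, Euler's formula `|V| - |E| + |F| = 1 + c` for graphs with `c` components holds. -/
structure EmbeddingData.IsPlanar {V : Type u} {G : SimpleGraph V} {K : G.Subgraph}
    (E : EmbeddingData K) : Prop where
  rot_adj : ∀ v w, K.Adj v w → K.Adj v (E.rot v w)
  rot_cyclic : ∀ v w w', K.Adj v w → K.Adj v w' → ∃ k : ℕ, (E.rot v)^[k] w = w'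
  facial_walk : ∀ v w, K.Adj v w → E.faceOf v w = E.faceOf (E.rot v w) v
  face_boundary : K.verts.Nonempty → ∀ f, ∃ v w, IsAngle K v w ∧ E.faceOf v w = f
  connected : ∀ u ∈ K.verts, ∀ v ∈ K.verts,
    Relation.ReflTransGen
      (fun a b => ∃ x y, IsAngle K a x ∧ IsAngle K b y ∧ E.faceOf a x = E.faceOf b y) u v
  euler : Nat.card K.verts + Nat.card E.Face =
    1 + Nat.card K.coe.ConnectedComponent + Nat.card K.edgeSet

/-- The embedding `EG` of the whole graph `G` extends the embedding `EH` of its subgraph `H`: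
deleting from every rotation the edges outside `H` gives the rotations of `EH`, and every face of
`EG` lies in a face of `EH` (the map `π`): faces on the two sides of an edge outside `H` lie in the
same face of `EH`, a corner of `G` that is contained in a corner of `H` lies in the face of that
corner, and the unbounded face lies in the unbounded face. -/
def EmbeddingData.Extends {V : Type u} {G : SimpleGraph V} {H : G.Subgraph}
    (EG : EmbeddingData (⊤ : G.Subgraph)) (EH : EmbeddingData H) : Prop :=
  (∀ v w, H.Adj v w → ∃ k : ℕ, (EG.rot v)^[k + 1] w = EH.rot v w ∧
    ∀ j < k, ¬ H.Adj v ((EG.rot v)^[j + 1] w)) ∧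
  ∃ π : EG.Face → EH.Face,
    (∀ v w, G.Adj v w → ¬ H.Adj v (EG.rot v w) →
      π (EG.faceOf v w) = π (EG.faceOf v (EG.rot v w))) ∧
    (∀ v w, H.Adj v w → π (EG.faceOf v w) = EH.faceOf v w) ∧
    (∀ v ∈ H.verts, (∀ x, ¬ H.Adj v x) → ∀ w, IsAngle (⊤ : G.Subgraph) v w →
      π (EG.faceOf v w) = EH.faceOf v v) ∧
    π EG.outer = EH.outer

/-- The endpoints `u` of the edges `vu` outside `H` that lie, in the rotation of `EG` at `v`, between
the `H`-edge `vw` and the next `H`-edge in clockwise direction. -/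
def EmbeddingData.between {V : Type u} {G : SimpleGraph V}
    (EG : EmbeddingData (⊤ : G.Subgraph)) (H : G.Subgraph) (v w : V) : Set V :=
  {u | ∃ k : ℕ, (EG.rot v)^[k + 1] w = u ∧ ∀ j ≤ k, ¬ H.Adj v ((EG.rot v)^[j + 1] w)}

/-- A triple `(G, H, E_H)`. -/
structure TopInstance (V : Type u) where
  G : SimpleGraph V
  H : G.Subgraph
  emb : EmbeddingData H

/-- `G` has a planar embedding that extends the given embedding of `H`. -/
def TopInstance.HasExtension {V : Type u} (I : TopInstance V) : Prop :=
  ∃ E : EmbeddingData (⊤ : I.G.Subgraph), E.IsPlanar ∧ E.Extends I.emb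

/-- A quadruple `(G, H, E_H, P)`: a graph `G` of maximum degree at most four, a subgraph `H` with a
planar embedding, and port constraints `P`. For an `H`-edge `vw`, the number `P v w` is the number
of free ports of `v` met when moving clockwise from `vw` to the next `H`-edge; as `v` has four
ports, `deg_H v` of which are used, these numbers sum up to `4 - deg_H v`. -/
structure PortInstance (V : Type u) extends TopInstance V where
  planar : emb.IsPlanar
  P : V → V → ℕ
  degree_le : ∀ v, (G.neighborSet v).ncard ≤ 4
  ports : ∀ v, (H.neighborSet v).Nonempty →
    (∑ᶠ w ∈ H.neighborSet v, P v w) + (H.neighborSet v).ncard = 4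

namespace PortInstance

/-- `G` has a planar embedding that extends the given embedding of `H` and respects all the port
constraints. -/
def HasPortExtension {V : Type u} (I : PortInstance V) : Prop :=
  ∃ E : EmbeddingData (⊤ : I.G.Subgraph), E.IsPlanar ∧ E.Extends I.emb ∧
    ∀ v w, I.H.Adj v w → (E.between I.H v w).ncard ≤ I.P v w

/-- Vertices at which all `G`-edges are forced into one sector: either three `H`-edges and one
`G`-edge, or two `H`-edges, at least one `G`-edge and port constraints `2` and `0`. -/
def IsHub {V : Type u} (I : PortInstance V) (v : V) : Prop :=
  ((I.H.neighborSet v).ncard = 3 ∧ (I.G.neighborSet v).ncard = 4) ∨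
  ((I.H.neighborSet v).ncard = 2 ∧ 3 ≤ (I.G.neighborSet v).ncard ∧
    ∃ w, I.H.Adj v w ∧ I.P v w = 2)

/-- Vertices with two `H`-edges, two `G`-edges and port constraints `1` and `1`. -/
def IsWheel {V : Type u} (I : PortInstance V) (v : V) : Prop :=
  (I.H.neighborSet v).ncard = 2 ∧ (I.G.neighborSet v).ncard = 4 ∧
    ∀ w, I.H.Adj v w → I.P v w = 1

/-- The vertices of the modified graph: the old ones, one new vertex for every `v` with `IsHub v`,
and, for every `v` with `IsWheel v`, one subdivision vertex on each of the four edges at `v`. -/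
inductive Vert {V : Type u} (I : PortInstance V) : Type u
  | orig (v : V) : Vert I
  | hub (v : V) (h : I.IsHub v) : Vert I
  | rim (v w : V) (h : I.IsWheel v) (hw : I.G.Adj v w) : Vert I

open Classical in
/-- The vertex of the gadget of `v` at which the edge `vw` of `G` leaves the gadget. -/
noncomputable def port {V : Type u} (I : PortInstance V) (v w : V) : I.Vert :=
  if h : I.IsWheel v ∧ I.G.Adj v w then .rim v w h.1 h.2
  else if h : I.IsHub v ∧ ¬ I.H.Adj v w then .hub v h.1
  else .orig v

/-- The edges of the modified graph, each in one orientation. -/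
inductive EdgeG {V : Type u} (I : PortInstance V) : I.Vert → I.Vert → Prop
  | link (v w : V) (h : I.G.Adj v w) : EdgeG I (I.port v w) (I.port w v)
  | hub (v : V) (h : I.IsHub v) : EdgeG I (.orig v) (.hub v h)
  | spoke (v w : V) (h : I.IsWheel v) (hw : I.G.Adj v w) : EdgeG I (.orig v) (.rim v w h hw)
  | rim (v w x : V) (h : I.IsWheel v) (hw : I.G.Adj v w) (hx : I.G.Adj v x)
      (hHw : I.H.Adj v w) (hHx : ¬ I.H.Adj v x) : EdgeG I (.rim v w h hw) (.rim v x h hx)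

/-- The edges of the modified subgraph, each in one orientation. -/
inductive EdgeH {V : Type u} (I : PortInstance V) : I.Vert → I.Vert → Prop
  | link (v w : V) (h : I.H.Adj v w) : EdgeH I (I.port v w) (I.port w v)
  | hub (v : V) (h : I.IsHub v) : EdgeH I (.orig v) (.hub v h)
  | spoke (v w : V) (h : I.IsWheel v) (hw : I.G.Adj v w) (hHw : I.H.Adj v w) :
      EdgeH I (.orig v) (.rim v w h hw)

/-- The vertices of the modified subgraph. -/
def InH {V : Type u} (I : PortInstance V) : I.Vert → Prop
  | .orig v => v ∈ I.H.verts
  | .hub _ _ => True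
  | .rim v w _ _ => I.H.Adj v w

/-- The modified graph. -/
def graph {V : Type u} (I : PortInstance V) : SimpleGraph I.Vert :=
  SimpleGraph.fromRel I.EdgeG

theorem port_ne {V : Type u} (I : PortInstance V) {v w x y : V} (h : v ≠ w) :
    I.port v x ≠ I.port w y := by
  unfold port
  split_ifs <;> simp [h]

theorem EdgeH.toG {V : Type u} {I : PortInstance V} {a b : I.Vert} (h : I.EdgeH a b) :
    I.graph.Adj a b := by
  cases h with
  | link v w h => exact ⟨I.port_ne h.ne, Or.inl (.link v w h.adj_sub)⟩
  | hub v h => exact ⟨by simp, Or.inl (.hub v h)⟩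
  | spoke v w h hw hHw => exact ⟨by simp, Or.inl (.spoke v w h hw)⟩

theorem inH_port {V : Type u} (I : PortInstance V) {v w : V} (h : I.H.Adj v w) :
    I.InH (I.port v w) := by
  unfold port
  split_ifs with h1 h2
  · exact h
  · trivial
  · exact h.fst_mem

theorem IsHub.mem_verts {V : Type u} {I : PortInstance V} {v : V} (h : I.IsHub v) :
    v ∈ I.H.verts := by
  have hne : (I.H.neighborSet v).ncard ≠ 0 := by
    rcases h with h | h <;> omega
  obtain ⟨w, hw⟩ := Set.nonempty_of_ncard_ne_zero hne
  exact I.H.edge_vert hw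

theorem EdgeH.inH {V : Type u} {I : PortInstance V} {a b : I.Vert} (h : I.EdgeH a b) :
    I.InH a ∧ I.InH b := by
  cases h with
  | link v w h => exact ⟨I.inH_port h, I.inH_port h.symm⟩
  | hub v h => exact ⟨h.mem_verts, trivial⟩
  | spoke v w h hw hHw => exact ⟨hHw.fst_mem, hHw⟩

/-- The modified subgraph. -/
def subgraph {V : Type u} (I : PortInstance V) : I.graph.Subgraph where
  verts := {a | I.InH a}
  Adj a b := I.EdgeH a b ∨ I.EdgeH b a
  adj_sub h := h.elim (fun h => h.toG) (fun h => h.toG.symm)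
  edge_vert h := h.elim (fun h => h.inH.1) (fun h => h.inH.2)
  symm := ⟨fun _ _ h => h.symm⟩

open Classical in
/-- For `v` with `IsHub v`, the unique `H`-neighbour `w` such that the sector between `vw` and the
next `H`-edge has free ports. -/
noncomputable def slot {V : Type u} (I : PortInstance V) (v : V) : V :=
  if h : ∃ w, I.H.Adj v w ∧ 0 < I.P v w then h.choose else v

open Classical in
/-- The neighbour of `orig v`, in the modified subgraph, that lies on the `H`-edge `vw`. -/
noncomputable def toward {V : Type u} (I : PortInstance V) (v w : V) : I.Vert :=
  if I.IsWheel v then I.port v w else I.port w v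

open Classical in
/-- The converse of `toward`: the `H`-edge at `v` whose sector contains the corner of `orig v` that
follows the neighbour `a`. -/
noncomputable def source {V : Type u} (I : PortInstance V) (v : V) : I.Vert → V
  | .orig w => w
  | .hub _ _ => I.slot v
  | .rim x y _ _ => if x = v then y else x

open Classical in
/-- Rotations of the modified subgraph: those of `H`, with the new vertex `hub v` inserted into the
sector of `v` that has free ports. -/
noncomputable def rot {V : Type u} (I : PortInstance V) : I.Vert → I.Vert → I.Vert
  | .orig v, .hub _ _ => I.toward v (I.emb.rot v (I.slot v))
  | .orig v, a =>
      if h : I.IsHub v ∧ I.source v a = I.slot v then .hub v h.1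
      else I.toward v (I.emb.rot v (I.source v a))
  | .hub v _, _ => .orig v
  | .rim v w _ _, a => if a = .orig v then I.port w v else .orig v

open Classical in
/-- Faces of the modified subgraph: they correspond to those of `H`, as edges are only subdivided or
added as pendant edges. The corner after `v` at a subdivision vertex of the edge `vw` lies on the
same side of this edge as the corner after `v` at `w`. -/
noncomputable def faceOf {V : Type u} (I : PortInstance V) : I.Vert → I.Vert → I.emb.Face
  | .orig v, a => I.emb.faceOf v (I.source v a)
  | .hub v _, _ => I.emb.faceOf v (I.slot v)
  | .rim v w _ _, a => if a = .orig v then I.emb.faceOf w v else I.emb.faceOf v w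

/-- The modified instance `(G', H', E_{H'})`, all gadgets being inserted simultaneously. -/
noncomputable def reduced {V : Type u} (I : PortInstance V) : TopInstance I.Vert where
  G := I.graph
  H := I.subgraph
  emb :=
    { rot := I.rot
      Face := I.emb.Face
      faceOf := I.faceOf
      outer := I.emb.outer }

end PortInstance

/-!
The modification replaces some vertices `v` of the graph by gadgets. At a hub, where all free ports
lie in one sector, a pendant edge of the modified subgraph in that sector carries all other edges of
`v`; at a wheel, the rim alternates between the edges of `H` and the others. Contracting the gadgets
leads back to the given graph, and the proof compares rotations and faces along this contraction.

*Planarity.* Euler's formula is hard to follow through contractions, deletions and expansions, so it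
is replaced by a local condition. For a connected closed surface it holds if and only if every cycle
modulo two bounds a set of faces (`IsSurface.euler_iff`, by counting dimensions), and this in turn is
equivalent to the absence of monodromy: every labelling of the corners modulo two which jumps by the
same amount at both sides of every edge is the sum of a labelling of the faces and a labelling of the
vertices (`IsPlanar.isSimplyConnected`, `IsSurface.isPlanar`). Such labellings are pulled back and
pushed forward corner by corner.

*Contraction.* A `StarContraction` describes two graphs one of which arises from the other by
contracting stars and deleting the other edges inside the contracted sets. A corner of the larger
graph is contained in a unique corner of the smaller one (`Covers`). Hence contraction preserves
planarity (`contract_isPlanar`), and so does the converse operation if the labels do not obstruct it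
at the inserted edges (`IsExpansion.isPlanar`). With no edges inserted, the latter shows that the
embedding of the modified subgraph is planar (`reduced_isPlanar`).

*From the modified graph to the given one.* The embedding of the modified graph is contracted. All
edges at the centre of a hub belong to the modified subgraph, which forces the other edges of the
given vertex into the sector with the free ports. At a wheel, each rim edge forms a triangle with two
spokes. If the two spokes in `H` were consecutive at the centre, two of these triangles would cross
there, which planarity excludes (`IsPlanar.not_crossing`). So the edges of `H` alternate with the
others, as the constraints `1` and `1` demand. Everywhere else the constraints hold for reasons of
degree (`le_P`).

*From the given graph to the modified one.* The port constraints make the edges at every gadget occur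
in the order in which the gadget can be drawn. The rotations and faces of the larger graph are
written down explicitly (`expand`). The new faces are the triangles of the wheels, which can take any
label, so that the rim edges do not obstruct planarity (`IsSolution.expand_isPlanar`).
-/

/-! ### Rotations and surfaces -/

namespace EmbeddingData

variable {V : Type u} {G : SimpleGraph V} {K : G.Subgraph} {E : EmbeddingData K}

/-- The rotations of `E` are cyclic permutations of the neighbourhoods. -/
structure IsRotation (E : EmbeddingData K) : Prop where
  adj : ∀ {v w}, K.Adj v w → K.Adj v (E.rot v w)
  cyclic : ∀ {v w w'}, K.Adj v w → K.Adj v w' → ∃ k : ℕ, (E.rot v)^[k] w = w'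

namespace IsRotation

theorem iterate (h : E.IsRotation) {v w : V} (hw : K.Adj v w) (k : ℕ) :
    K.Adj v ((E.rot v)^[k] w) := by
  induction k with
  | zero => exact hw
  | succ k ih => rw [Function.iterate_succ_apply']; exact h.adj ih

theorem exists_rot_eq (h : E.IsRotation) {v w : V} (hw : K.Adj v w) :
    ∃ x, K.Adj v x ∧ E.rot v x = w := by
  obtain ⟨k, hk⟩ := h.cyclic (h.adj hw) hw
  exact ⟨_, h.iterate hw k, by
    rw [← Function.iterate_succ_apply' (E.rot v), Function.iterate_succ_apply, hk]⟩

theorem rot_injective [Finite V] (h : E.IsRotation) {v w w' : V} (hw : K.Adj v w)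
    (hw' : K.Adj v w') (he : E.rot v w = E.rot v w') : w = w' := by
  have hs : Function.Surjective
      (fun x : {x // K.Adj v x} => (⟨E.rot v x, h.adj x.2⟩ : {x // K.Adj v x})) := by
    rintro ⟨x, hx⟩
    obtain ⟨y, hy, rfl⟩ := h.exists_rot_eq hx
    exact ⟨⟨y, hy⟩, rfl⟩
  have hi := Finite.injective_iff_surjective.2 hs
  have := @hi ⟨w, hw⟩ ⟨w', hw'⟩ (Subtype.ext he)
  exact congrArg Subtype.val this

/-- A property that is inherited by the next neighbour holds at all neighbours once it holds at
one of them. -/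
theorem induction (h : E.IsRotation) {v w₀ : V} {P : V → Prop} (hw₀ : K.Adj v w₀) (h₀ : P w₀)
    (hs : ∀ w, K.Adj v w → P w → P (E.rot v w)) {w : V} (hw : K.Adj v w) : P w := by
  obtain ⟨k, rfl⟩ := h.cyclic hw₀ hw
  clear hw
  induction k with
  | zero => exact h₀
  | succ k ih => rw [Function.iterate_succ_apply']; exact hs _ (h.iterate hw₀ k) ih

/-- A property that is inherited by the next neighbour as long as this is not `y` reaches the
neighbour just before `y`. -/
theorem exists_before (h : E.IsRotation) {v w₀ y : V} {P : V → Prop} (hw₀ : K.Adj v w₀)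
    (h₀ : P w₀) (hy : K.Adj v y)
    (hs : ∀ w, K.Adj v w → P w → E.rot v w ≠ y → P (E.rot v w)) :
    ∃ w, K.Adj v w ∧ P w ∧ E.rot v w = y := by
  by_contra hc
  push Not at hc
  have hall : ∀ w, K.Adj v w → P w := fun w hw =>
    h.induction (P := P) hw₀ h₀ (fun w hw hP => hs w hw hP (hc w hw hP)) hw
  obtain ⟨x, hx, hxy⟩ := h.exists_rot_eq hy
  exact hc x hx (hall x hx) hxy

/-- Cyclicity is passed on to another map `r`, on a set `X`, if iterating `r` leads from the image
`f w` of every neighbour to the image of the next neighbour. -/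
theorem reach_of_map (h : E.IsRotation) {v : V} {X : Type*} (r : X → X) (f : V → X)
    (hf : ∀ w, K.Adj v w → ∃ k : ℕ, r^[k] (f w) = f (E.rot v w)) {w w' : V} (hw : K.Adj v w)
    (hw' : K.Adj v w') : ∃ k : ℕ, r^[k] (f w) = f w' := by
  refine h.induction (P := fun x => ∃ k : ℕ, r^[k] (f w) = f x) hw ⟨0, rfl⟩ ?_ hw'
  rintro x hx ⟨k, hk⟩
  obtain ⟨l, hl⟩ := hf x hx
  exact ⟨l + k, by rw [Function.iterate_add_apply, hk, hl]⟩

end IsRotation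

/-- The conditions of a planar embedding other than Euler's formula, which is only kept for the
graph without vertices: `E` describes a drawing on a closed connected surface. -/
structure IsSurface (E : EmbeddingData K) : Prop extends E.IsRotation where
  facial_walk : ∀ {v w}, K.Adj v w → E.faceOf v w = E.faceOf (E.rot v w) v
  face_boundary : K.verts.Nonempty → ∀ f, ∃ v w, IsAngle K v w ∧ E.faceOf v w = f
  connected : ∀ u ∈ K.verts, ∀ v ∈ K.verts,
    Relation.ReflTransGen
      (fun a b => ∃ x y, IsAngle K a x ∧ IsAngle K b y ∧ E.faceOf a x = E.faceOf b y) u v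
  subsingleton : ¬ K.verts.Nonempty → Subsingleton E.Face

theorem IsPlanar.isSurface [Finite V] (h : E.IsPlanar) : E.IsSurface where
  adj := h.rot_adj _ _
  cyclic := h.rot_cyclic _ _ _
  facial_walk := h.facial_walk _ _
  face_boundary := h.face_boundary
  connected := h.connected
  subsingleton hK := by
    have hV : IsEmpty K.verts := Set.isEmpty_coe_sort.2 (Set.not_nonempty_iff_eq_empty.1 hK)
    have hE : IsEmpty K.edgeSet := by
      refine ⟨fun ⟨e, he⟩ => ?_⟩
      induction e with
      | h v w => exact hV.elim ⟨v, K.edge_vert he⟩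
    have hC : IsEmpty K.coe.ConnectedComponent :=
      ⟨fun c => c.ind fun v => hV.elim v⟩
    have := h.euler
    simp only [Nat.card_of_isEmpty] at this
    exact (Nat.card_eq_one_iff_unique.1 (by omega)).1

theorem IsSurface.finite_face [Finite V] (h : E.IsSurface) : Finite E.Face := by
  by_cases hK : K.verts.Nonempty
  · refine Finite.of_surjective (fun x : V × V => E.faceOf x.1 x.2) fun f => ?_
    obtain ⟨v, w, -, hf⟩ := h.face_boundary hK f
    exact ⟨(v, w), hf⟩
  · have := h.subsingleton hK
    infer_instance

end EmbeddingData

namespace EmbeddingData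

variable {V : Type u} {G : SimpleGraph V} {K : G.Subgraph} {E : EmbeddingData K}

/-! ### Euler's formula and the first homology group modulo two -/

open Classical in
/-- The incidence matrix of `K` modulo two. -/
noncomputable def incidence (K : G.Subgraph) : Matrix K.verts K.edgeSet (ZMod 2) :=
  fun v e => if (v : V) ∈ (e : Sym2 V) then 1 else 0

theorem incidence_transpose_mulVec [Fintype V] [Fintype K.verts] (g : K.verts → ZMod 2) {v w : V}
    (h : K.Adj v w) :
    ((incidence K).transpose.mulVec g) ⟨s(v, w), h⟩ =
      g ⟨v, K.edge_vert h⟩ + g ⟨w, K.edge_vert h.symm⟩ := by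
  classical
  have hne : (⟨v, K.edge_vert h⟩ : K.verts) ≠ ⟨w, K.edge_vert h.symm⟩ := by
    simpa using h.ne
  rw [← Finset.sum_pair hne]
  simp only [Matrix.mulVec, dotProduct, Matrix.transpose_apply, incidence, ite_mul, one_mul,
    zero_mul]
  rw [← Finset.sum_filter]
  congr 1
  ext x
  simp [Subtype.ext_iff]

theorem incidence_mulVec [Fintype V] [Fintype K.edgeSet] (x : K.edgeSet → ZMod 2)
    (z : V → V → ZMod 2) (hz : ∀ v w (h : K.Adj v w), z v w = x ⟨s(v, w), h⟩)
    (hz' : ∀ v w, ¬ K.Adj v w → z v w = 0) (v : K.verts) :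
    ((incidence K).mulVec x) v = ∑ w, z v w := by
  classical
  simp only [Matrix.mulVec, dotProduct, incidence, ite_mul, one_mul, zero_mul]
  rw [← Finset.sum_filter]
  symm
  rw [← Finset.sum_filter_add_sum_filter_not _ (fun w => K.Adj v w)]
  rw [Finset.sum_eq_zero (s := Finset.filter (fun w => ¬ K.Adj v w) _)
    (fun w hw => hz' _ _ (Finset.mem_filter.1 hw).2), add_zero]
  refine Finset.sum_bij (fun w hw => ⟨s((v : V), w), (Finset.mem_filter.1 hw).2⟩) ?_ ?_ ?_ ?_
  · intro w hw
    simp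
  · intro w hw w' hw' he
    exact Sym2.congr_right.1 (congrArg Subtype.val he)
  · rintro ⟨e, he⟩ hv
    simp only [Finset.mem_filter, Finset.mem_univ, true_and] at hv
    obtain ⟨w, rfl⟩ := hv
    exact ⟨w, by simpa using he, rfl⟩
  · intro w hw
    exact hz _ _ _

/-- Functions that are constant along all edges are functions on the set of components. -/
theorem finrank_ker_incidence_transpose [Fintype V] [Fintype K.verts] [Fintype K.edgeSet] :
    Module.finrank (ZMod 2) (LinearMap.ker (incidence K).transpose.mulVecLin) =
      Nat.card K.coe.ConnectedComponent := by
  classical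
  have hmem : ∀ g : K.verts → ZMod 2, g ∈ LinearMap.ker (incidence K).transpose.mulVecLin ↔
      ∀ v w : K.verts, K.coe.Adj v w → g v = g w := by
    intro g
    rw [LinearMap.mem_ker, Matrix.mulVecLin_apply]
    constructor
    · intro h v w hvw
      have := congrFun h ⟨s((v : V), (w : V)), hvw⟩
      rw [incidence_transpose_mulVec g hvw] at this
      exact CharTwo.add_eq_zero.1 this
    · intro h
      funext ⟨e, he⟩
      induction e with
      | h v w =>
        rw [incidence_transpose_mulVec g he]
        exact CharTwo.add_eq_zero.2 (h ⟨v, K.edge_vert he⟩ ⟨w, K.edge_vert he.symm⟩ he)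
  let e : (K.coe.ConnectedComponent → ZMod 2) ≃ₗ[ZMod 2]
      LinearMap.ker (incidence K).transpose.mulVecLin :=
    { toFun := fun f => ⟨fun v => f (K.coe.connectedComponentMk v), (hmem _).2 fun v w h => by
        rw [SimpleGraph.ConnectedComponent.sound h.reachable]⟩
      map_add' := fun _ _ => rfl
      map_smul' := fun _ _ => rfl
      invFun := fun g => fun c => c.lift (fun v => g.1 v) (by
        intro v w p hp
        clear hp
        induction p with
        | nil => rfl
        | cons h p ih => exact ((hmem _).1 g.2 _ _ h).trans ih)
      left_inv := fun f => by
        funext c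
        induction c using SimpleGraph.ConnectedComponent.ind
        rfl
      right_inv := fun g => rfl }
  have : Fintype K.coe.ConnectedComponent := Fintype.ofFinite _
  rw [← e.finrank_eq, Module.finrank_fintype_fun_eq_card, Nat.card_eq_fintype_card]

/-- The dimension of the cycle space modulo two. -/
theorem finrank_ker_incidence [Fintype V] [Fintype K.verts] [Fintype K.edgeSet] :
    Module.finrank (ZMod 2) (LinearMap.ker (incidence K).mulVecLin) + Nat.card K.verts =
      Nat.card K.edgeSet + Nat.card K.coe.ConnectedComponent := by
  classical
  have h1 := LinearMap.finrank_range_add_finrank_ker (incidence K).mulVecLin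
  have h2 := LinearMap.finrank_range_add_finrank_ker (incidence K).transpose.mulVecLin
  have h3 := Matrix.rank_transpose (incidence K)
  rw [finrank_ker_incidence_transpose] at h2
  simp only [Matrix.rank] at h3
  rw [Module.finrank_fintype_fun_eq_card, ← Nat.card_eq_fintype_card] at h1 h2
  omega

theorem finrank_eq_one_of_const {X : Type*} [Nonempty X] (N : Submodule (ZMod 2) (X → ZMod 2))
    (hN : ∀ f, f ∈ N ↔ ∀ x y, f x = f y) : Module.finrank (ZMod 2) N = 1 := by
  obtain ⟨x₀⟩ := ‹Nonempty X›
  refine finrank_eq_one (⟨fun _ => 1, (hN _).2 fun _ _ => rfl⟩ : N) ?_ ?_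
  · intro h
    have := congrFun (congrArg Subtype.val h) x₀
    exact one_ne_zero this
  · rintro ⟨f, hf⟩
    refine ⟨f x₀, Subtype.ext (funext fun x => ?_)⟩
    simpa using (hN f).1 hf x₀ x

/-- The boundary, modulo two, of a set of faces. -/
def boundary (E : EmbeddingData K) : (E.Face → ZMod 2) →ₗ[ZMod 2] (K.edgeSet → ZMod 2) where
  toFun S e := Sym2.lift ⟨fun v w => S (E.faceOf v w) + S (E.faceOf w v),
    fun _ _ => add_comm _ _⟩ (e : Sym2 V)
  map_add' S T := by
    funext ⟨e, he⟩
    induction e with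
    | h v w => simp only [Sym2.lift_mk, Pi.add_apply]; ring
  map_smul' a S := by
    funext ⟨e, he⟩
    induction e with
    | h v w => simp only [Sym2.lift_mk, Pi.smul_apply, smul_eq_mul, RingHom.id_apply]; ring

theorem boundary_apply (S : E.Face → ZMod 2) {v w : V} (h : K.Adj v w) :
    E.boundary S ⟨s(v, w), h⟩ = S (E.faceOf v w) + S (E.faceOf w v) := rfl

/-- As the surface is connected, only trivial sets of faces have empty boundary. -/
theorem IsSurface.mem_ker_boundary (hE : E.IsSurface) (S : E.Face → ZMod 2) :
    S ∈ LinearMap.ker E.boundary ↔ ∀ f g, S f = S g := by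
  rw [LinearMap.mem_ker]
  constructor
  · intro h
    have h1 : ∀ v w, K.Adj v w → S (E.faceOf v w) = S (E.faceOf w v) := fun v w hvw =>
      CharTwo.add_eq_zero.1 (congrFun h ⟨s(v, w), hvw⟩)
    -- the value of `S` is the same at all corners of a vertex
    have h2 : ∀ v w w', IsAngle K v w → IsAngle K v w' →
        S (E.faceOf v w) = S (E.faceOf v w') := by
      rintro v w w' (hw | ⟨rfl, -, hi⟩) (hw' | ⟨rfl, -, hi'⟩)
      · refine hE.induction (P := fun x => S (E.faceOf v w) = S (E.faceOf v x)) hw rfl ?_ hw'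
        intro x hx ih
        rw [ih, h1 _ _ (hE.adj hx), hE.facial_walk hx]
      · exact absurd hw (hi' _)
      · exact absurd hw' (hi _)
      · rfl
    by_cases hK : K.verts.Nonempty
    · intro f g
      obtain ⟨v, w, hvw, rfl⟩ := hE.face_boundary hK f
      obtain ⟨v', w', hvw', rfl⟩ := hE.face_boundary hK g
      have hm : ∀ {v w}, IsAngle K v w → v ∈ K.verts := by
        rintro v w (h | h)
        · exact K.edge_vert h
        · exact h.2.1
      have hc := hE.connected v (hm hvw) v' (hm hvw')
      clear h
      induction hc generalizing w' with
      | refl => exact h2 _ _ _ hvw hvw'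
      | tail _ hbc ih =>
        obtain ⟨x, y, hx, hy, hxy⟩ := hbc
        rw [ih _ hx, hxy, h2 _ _ _ hy hvw']
    · have := hE.subsingleton hK
      exact fun f g => congrArg S (Subsingleton.elim _ _)
  · intro h
    funext ⟨e, he⟩
    induction e with
    | h v w =>
      rw [boundary_apply _ he, h _ (E.faceOf w v)]
      exact CharTwo.add_self_eq_zero _

/-- A sum over the neighbours of `v` does not change under a shift of the summands by the rotation
at `v`. -/
theorem IsRotation.sum_rot [Fintype V] (hE : E.IsRotation) {v : V} (f : V → ZMod 2)
    (hf : ∀ w, ¬ K.Adj v w → f w = 0) (g : V → ZMod 2) (hg : ∀ w, ¬ K.Adj v w → g w = 0)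
    (hfg : ∀ w, K.Adj v w → g w = f (E.rot v w)) : ∑ w, g w = ∑ w, f w := by
  classical
  rw [← Finset.sum_subset (Finset.subset_univ (Finset.univ.filter (K.Adj v)))
    (fun w _ hw => hf w (by simpa using hw)),
    ← Finset.sum_subset (Finset.subset_univ (Finset.univ.filter (K.Adj v)))
    (fun w _ hw => hg w (by simpa using hw))]
  refine Finset.sum_bij (fun w _ => E.rot v w) ?_ ?_ ?_ ?_
  · intro w hw
    simpa using hE.adj (by simpa using hw)
  · intro w hw w' hw' he
    exact hE.rot_injective (by simpa using hw) (by simpa using hw') he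
  · intro w hw
    obtain ⟨x, hx, he⟩ := hE.exists_rot_eq (v := v) (w := w) (by simpa using hw)
    exact ⟨x, by simpa using hx, he⟩
  · intro w hw
    exact hfg w (by simpa using hw)

/-- A cycle of `K` modulo two, given by its values on pairs of adjacent vertices. -/
structure IsCycle [Fintype V] (K : G.Subgraph) (z : V → V → ZMod 2) : Prop where
  symm : ∀ v w, z v w = z w v
  supp : ∀ v w, ¬ K.Adj v w → z v w = 0
  sum : ∀ v, ∑ w, z v w = 0

/-- Boundaries are cycles: around a vertex, the two faces of each edge are those of the corners
before and behind it, and every corner is counted twice. -/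
theorem IsSurface.range_boundary_le [Fintype V] [Fintype K.verts] [Fintype K.edgeSet]
    (hE : E.IsSurface) :
    LinearMap.range E.boundary ≤ LinearMap.ker (incidence K).mulVecLin := by
  classical
  rintro _ ⟨S, rfl⟩
  rw [LinearMap.mem_ker, Matrix.mulVecLin_apply]
  funext v
  rw [incidence_mulVec _ (fun v w => (if K.Adj v w then S (E.faceOf v w) else 0) +
    (if K.Adj v w then S (E.faceOf w v) else 0)) ?_ ?_ v, Finset.sum_add_distrib]
  · refine CharTwo.add_eq_zero.2 (hE.sum_rot (v := v) _ ?_ _ ?_ ?_)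
    · intro w hw
      simp [hw]
    · intro w hw
      simp [hw]
    · intro w hw
      simp [hw, hE.adj hw, hE.facial_walk hw]
  · intro v w h
    simp [h, boundary_apply]
  · intro v w h
    simp [h]

/-- Euler's formula says that every cycle modulo two is the boundary of a set of faces. -/
theorem IsSurface.euler_iff [Fintype V] (hE : E.IsSurface) :
    Nat.card K.verts + Nat.card E.Face =
      1 + Nat.card K.coe.ConnectedComponent + Nat.card K.edgeSet ↔
    ∀ z, IsCycle K z → ∃ S : E.Face → ZMod 2, ∀ v w, K.Adj v w →
      z v w = S (E.faceOf v w) + S (E.faceOf w v) := by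
  classical
  have : Fintype K.verts := Fintype.ofFinite _
  have : Fintype K.edgeSet := Fintype.ofFinite _
  have : Fintype E.Face := @Fintype.ofFinite _ hE.finite_face
  have : Nonempty E.Face := ⟨E.outer⟩
  have h1 := LinearMap.finrank_range_add_finrank_ker E.boundary
  rw [finrank_eq_one_of_const _ hE.mem_ker_boundary, Module.finrank_fintype_fun_eq_card,
    ← Nat.card_eq_fintype_card] at h1
  have h2 := finrank_ker_incidence (K := K)
  have h3 : Nat.card K.verts + Nat.card E.Face =
      1 + Nat.card K.coe.ConnectedComponent + Nat.card K.edgeSet ↔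
      LinearMap.range E.boundary = LinearMap.ker (incidence K).mulVecLin := by
    constructor
    · intro h
      exact Submodule.eq_of_le_of_finrank_eq hE.range_boundary_le (by omega)
    · intro h
      rw [h] at h1
      omega
  rw [h3]
  constructor
  · intro h z hz
    let x : K.edgeSet → ZMod 2 := fun e => Sym2.lift ⟨z, hz.symm⟩ (e : Sym2 V)
    have hx : x ∈ LinearMap.range E.boundary := by
      rw [h, LinearMap.mem_ker, Matrix.mulVecLin_apply]
      funext v
      rw [incidence_mulVec x z (fun _ _ _ => rfl) hz.supp]
      exact hz.sum _
    obtain ⟨S, hS⟩ := hx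
    exact ⟨S, fun v w hvw => (congrFun hS ⟨s(v, w), hvw⟩).symm⟩
  · intro h
    refine le_antisymm hE.range_boundary_le fun x hx => ?_
    rw [LinearMap.mem_ker, Matrix.mulVecLin_apply] at hx
    let z : V → V → ZMod 2 := fun v w => if h : K.Adj v w then x ⟨s(v, w), h⟩ else 0
    have hz1 : ∀ v w (h : K.Adj v w), z v w = x ⟨s(v, w), h⟩ := fun v w h => dif_pos h
    have hz0 : ∀ v w, ¬ K.Adj v w → z v w = 0 := fun v w h => dif_neg h
    obtain ⟨S, hS⟩ := h z ⟨fun v w => by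
        by_cases h : K.Adj v w
        · rw [hz1 _ _ h, hz1 _ _ h.symm]
          congr 2
          exact Sym2.eq_swap
        · rw [hz0 _ _ h, hz0 _ _ fun h' => h h'.symm], hz0, fun v => by
        by_cases hv : v ∈ K.verts
        · rw [← incidence_mulVec x z hz1 hz0 ⟨v, hv⟩, hx]
          rfl
        · exact Finset.sum_eq_zero fun w _ => hz0 _ _ fun h => hv (K.edge_vert h)⟩
    refine ⟨S, ?_⟩
    funext ⟨e, he⟩
    induction e with
    | h v w => rw [boundary_apply _ he, ← hz1 _ _ he, hS _ _ he]

/-- A function on a cyclically ordered neighbourhood with sum zero is a difference of consecutive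
values. -/
theorem IsRotation.exists_potential [Fintype V] (hE : E.IsRotation) (v : V) (z : V → ZMod 2)
    (hz : ∀ w, ¬ K.Adj v w → z w = 0) (hs : ∑ w, z w = 0) :
    ∃ p : V → ZMod 2, ∀ w, K.Adj v w → z (E.rot v w) = p w + p (E.rot v w) := by
  classical
  by_cases hne : ∃ w₀, K.Adj v w₀
  swap
  · exact ⟨0, fun w hw => absurd ⟨w, hw⟩ hne⟩
  obtain ⟨w₀, hw₀⟩ := hne
  let N := {w // K.Adj v w}
  have : Nonempty N := ⟨⟨w₀, hw₀⟩⟩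
  have hb : Function.Bijective (fun w : N => (⟨E.rot v w, hE.adj w.2⟩ : N)) := by
    constructor
    · rintro ⟨x, hx⟩ ⟨y, hy⟩ h
      exact Subtype.ext (hE.rot_injective hx hy (congrArg Subtype.val h))
    · rintro ⟨x, hx⟩
      obtain ⟨y, hy, rfl⟩ := hE.exists_rot_eq hx
      exact ⟨⟨y, hy⟩, rfl⟩
  let σ : N ≃ N := Equiv.ofBijective _ hb
  let L : (N → ZMod 2) →ₗ[ZMod 2] (N → ZMod 2) :=
    { toFun := fun p w => p w + p (σ w)
      map_add' := fun p q => by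
        funext w
        change p w + q w + (p (σ w) + q (σ w)) = p w + p (σ w) + (q w + q (σ w))
        ring
      map_smul' := fun a p => by
        funext w
        exact (mul_add a (p w) (p (σ w))).symm }
  let T : (N → ZMod 2) →ₗ[ZMod 2] ZMod 2 :=
    { toFun := fun p => ∑ w, p w
      map_add' := fun p q => Finset.sum_add_distrib
      map_smul' := fun a p => (Finset.mul_sum _ _ _).symm }
  -- as the rotation is cyclic, only constants lie in the kernel of `L`, so that the range of `L`
  -- has codimension one; it is therefore the kernel of the total `T`
  have hker : Module.finrank (ZMod 2) (LinearMap.ker L) = 1 := by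
    refine finrank_eq_one_of_const _ fun f => ?_
    rw [LinearMap.mem_ker]
    constructor
    · intro h
      have h' : ∀ w, f w = f (σ w) := fun w => CharTwo.add_eq_zero.1 (congrFun h w)
      rintro ⟨x, hx⟩ ⟨y, hy⟩
      refine hE.induction (P := fun y => ∀ hy : K.Adj v y, f ⟨x, hx⟩ = f ⟨y, hy⟩) hx
        (fun _ => rfl) ?_ hy hy
      intro w hw ih hw'
      rw [ih hw, h' ⟨w, hw⟩]
      rfl
    · intro h
      funext w
      exact CharTwo.add_eq_zero.2 (h _ _)
  have hle : LinearMap.range L ≤ LinearMap.ker T := by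
    rintro _ ⟨p, rfl⟩
    rw [LinearMap.mem_ker]
    change ∑ w, (p w + p (σ w)) = 0
    rw [Finset.sum_add_distrib, Equiv.sum_comp σ p]
    exact CharTwo.add_self_eq_zero _
  have hT : LinearMap.range T = ⊤ := by
    refine LinearMap.range_eq_top.2 fun a => ⟨Pi.single ⟨w₀, hw₀⟩ a, ?_⟩
    change ∑ w, (Pi.single (M := fun _ : N => ZMod 2) ⟨w₀, hw₀⟩ a) w = a
    simp
  have h1 := LinearMap.finrank_range_add_finrank_ker L
  have h2 := LinearMap.finrank_range_add_finrank_ker T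
  rw [hT, finrank_top, Module.finrank_self] at h2
  have heq := Submodule.eq_of_le_of_finrank_eq hle (by omega)
  have hzT : (fun w : N => z (σ w)) ∈ LinearMap.ker T := by
    rw [LinearMap.mem_ker]
    change ∑ w : N, z (σ w) = 0
    rw [Equiv.sum_comp σ (fun w : N => z w), ← hs]
    rw [← Finset.sum_subset (Finset.subset_univ (Finset.univ.filter (K.Adj v)))
      (fun w _ hw => hz w (by simpa using hw))]
    exact (Finset.sum_subtype _ (by simp) z).symm
  rw [← heq] at hzT
  obtain ⟨p, hp⟩ := hzT
  refine ⟨fun w => if h : K.Adj v w then p ⟨w, h⟩ else 0, fun w hw => ?_⟩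
  have := congrFun hp ⟨w, hw⟩
  simp only [hw, hE.adj hw, dif_pos]
  exact this.symm

/-- `E` has no monodromy: a labelling `p` of the corners modulo two that changes by the same amount
along both sides of every edge differs from a labelling of the faces by a labelling of the
vertices. -/
def IsSimplyConnected (E : EmbeddingData K) : Prop :=
  ∀ p d : V → V → ZMod 2, (∀ v w, d v w = d w v) →
    (∀ v w, K.Adj v w → p v w + p (E.rot v w) v = d v (E.rot v w)) →
    ∃ (c : V → ZMod 2) (S : E.Face → ZMod 2), ∀ v w, K.Adj v w →
      p v w = S (E.faceOf v w) + c v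

theorem IsPlanar.boundary_of_isCycle [Fintype V] (hE : E.IsPlanar) {z : V → V → ZMod 2}
    (hz : IsCycle K z) : ∃ S : E.Face → ZMod 2, ∀ v w, K.Adj v w →
      z v w = S (E.faceOf v w) + S (E.faceOf w v) :=
  hE.isSurface.euler_iff.1 hE.euler z hz

/-- A planar embedding has no monodromy: the jumps of `p` at the edges form a cycle, which bounds a
set of faces, and the difference of `p` and this set has no jumps at all. -/
theorem IsPlanar.isSimplyConnected [Finite V] (hE : E.IsPlanar) : E.IsSimplyConnected := by
  classical
  have := Fintype.ofFinite V
  have hE' := hE.isSurface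
  intro p d hd hp
  -- the jump of `p` across the edge `vu` is the same at both ends
  let z : V → V → ZMod 2 := fun v u => if K.Adj v u then d v u + p u v + p v u else 0
  have hz1 : ∀ v u, K.Adj v u → z v u = d v u + p u v + p v u := fun v u h => if_pos h
  have hz0 : ∀ v u, ¬ K.Adj v u → z v u = 0 := fun v u h => if_neg h
  have hjump : ∀ v w, K.Adj v w → z v (E.rot v w) = p v w + p v (E.rot v w) := by
    intro v w hw
    rw [hz1 _ _ (hE'.adj hw), ← hp v w hw, add_assoc (p v w), CharTwo.add_self_eq_zero, add_zero]
  obtain ⟨S, hS⟩ := hE.boundary_of_isCycle (z := z) ⟨fun v w => by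
      by_cases h : K.Adj v w
      · rw [hz1 _ _ h, hz1 _ _ h.symm, hd v w]
        ring
      · rw [hz0 _ _ h, hz0 _ _ fun h' => h h'.symm], hz0, fun v => by
      have h1 : ∑ w, (if K.Adj v w then z v (E.rot v w) else 0) = ∑ w, z v w :=
        hE'.sum_rot (v := v) (z v) (hz0 v) _ (fun w hw => if_neg hw) (fun w hw => if_pos hw)
      have h2 : ∑ w, (if K.Adj v w then p v (E.rot v w) else 0) =
          ∑ w, (if K.Adj v w then p v w else 0) :=
        hE'.sum_rot (v := v) _ (fun w hw => if_neg hw) _ (fun w hw => if_neg hw)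
          (fun w hw => by simp [hw, hE'.adj hw])
      rw [← h1]
      refine Eq.trans ?_ (CharTwo.add_eq_zero.2 h2.symm)
      rw [← Finset.sum_add_distrib]
      refine Finset.sum_congr rfl fun w _ => ?_
      split_ifs with h
      · exact hjump v w h
      · simp⟩
  let c : V → ZMod 2 := fun v => if h : ∃ w, K.Adj v w then
    p v h.choose + S (E.faceOf v h.choose) else 0
  refine ⟨c, S, fun v w hw => ?_⟩
  have hex : ∃ w, K.Adj v w := ⟨w, hw⟩
  have hc : c v = p v w + S (E.faceOf v w) := by
    simp only [c, dif_pos hex]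
    refine hE'.induction (P := fun w => p v hex.choose + S (E.faceOf v hex.choose) =
      p v w + S (E.faceOf v w)) hex.choose_spec rfl ?_ hw
    intro x hx ih
    rw [ih]
    have h1 := hjump v x hx
    rw [hS _ _ (hE'.adj hx), ← hE'.facial_walk hx] at h1
    generalize S (E.faceOf v (E.rot v x)) = a at *
    generalize S (E.faceOf v x) = b at *
    generalize p v x = e at *
    generalize p v (E.rot v x) = f at *
    clear * - h1
    revert a b e f
    decide
  rw [hc, add_comm, add_assoc, CharTwo.add_self_eq_zero, add_zero]

/-- Conversely, a surface without monodromy is a sphere: local potentials of a cycle `z` at the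
vertices satisfy the assumption in `IsSimplyConnected`, and the labelling `S` of the faces then has
boundary `z`. -/
theorem IsSurface.isPlanar [Finite V] (hE : E.IsSurface) (h : E.IsSimplyConnected) :
    E.IsPlanar where
  rot_adj _ _ := hE.adj
  rot_cyclic _ _ _ := hE.cyclic
  facial_walk _ _ := hE.facial_walk
  face_boundary := hE.face_boundary
  connected := hE.connected
  euler := by
    classical
    have := Fintype.ofFinite V
    refine hE.euler_iff.2 fun z hz => ?_
    choose p hp using fun v => hE.exists_potential v (z v) (hz.supp v) (hz.sum v)
    obtain ⟨c, S, hS⟩ := h p (fun v u => z v u + p u v + p v u)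
      (fun v w => by rw [hz.symm v w]; ring) (fun v w hw => by
        rw [hp v w hw]
        generalize p v w = a
        generalize p v (E.rot v w) = b
        generalize p (E.rot v w) v = e
        revert a b e
        decide)
    refine ⟨S, fun v w hw => ?_⟩
    obtain ⟨x, hx, rfl⟩ := hE.exists_rot_eq hw
    rw [hp v x hx, hS v x hx, hS v _ hw, ← hE.facial_walk hx]
    generalize S (E.faceOf v x) = a
    generalize S (E.faceOf v (E.rot v x)) = b
    generalize c v = e
    revert a b e
    decide

/-- In a planar embedding, two triangles that share only the vertex `v` do not cross at `v`. -/
theorem IsPlanar.not_crossing [Finite V] (hE : E.IsPlanar) {v a b c d : V} (hva : K.Adj v a)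
    (hvb : K.Adj v b) (hab : K.Adj a b) (hvc : K.Adj v c) (hvd : K.Adj v d) (hcd : K.Adj c d)
    (hac : a ≠ c) (had : a ≠ d) (hbc : b ≠ c) (hbd : b ≠ d)
    (h1 : E.rot v a = c) (h2 : E.rot v c = b) (h3 : E.rot v b = d) : False := by
  classical
  have := Fintype.ofFinite V
  have hE' := hE.isSurface
  -- the triangle `vab` is a cycle and bounds a set `S` of faces
  let z : V → V → ZMod 2 := fun x y =>
    if s(x, y) = s(v, a) ∨ s(x, y) = s(v, b) ∨ s(x, y) = s(a, b) then 1 else 0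
  have hz : IsCycle K z := by
    refine ⟨fun x y => ?_, fun x y h => ?_, fun x => ?_⟩
    · simp only [z]
      rw [Sym2.eq_swap (a := x)]
    · refine if_neg ?_
      rintro (h' | h' | h')
      all_goals
        rcases Sym2.eq_iff.1 h' with ⟨rfl, rfl⟩ | ⟨rfl, rfl⟩
        all_goals first | exact h ‹_› | exact h (SimpleGraph.Subgraph.Adj.symm ‹_›)
    · have hsum : ∀ p q : V, p ≠ q → (∀ y, z x y = if y = p ∨ y = q then 1 else 0) →
          ∑ y, z x y = 0 := by
        intro p q hpq hy
        rw [Finset.sum_congr rfl fun y _ => hy y, ← Finset.sum_filter]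
        have : Finset.univ.filter (fun y => y = p ∨ y = q) = {p, q} := by
          ext y
          simp
        rw [this, Finset.sum_pair hpq]
        decide
      have := hva.ne
      have := hvb.ne
      have := hab.ne
      by_cases hx : x = v
      · refine hsum a b hab.ne fun y => if_congr ?_ rfl rfl
        simp only [Sym2.eq_iff]
        grind
      by_cases hx : x = a
      · refine hsum v b hvb.ne fun y => if_congr ?_ rfl rfl
        simp only [Sym2.eq_iff]
        grind
      by_cases hx : x = b
      · refine hsum v a hva.ne fun y => if_congr ?_ rfl rfl
        simp only [Sym2.eq_iff]
        grind
      refine Finset.sum_eq_zero fun y _ => if_neg ?_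
      simp only [Sym2.eq_iff]
      grind
  obtain ⟨S, hS⟩ := hE.boundary_of_isCycle hz
  have hs : ∀ x y, K.Adj x y → S (E.faceOf x y) = S (E.faceOf y x) + z x y := by
    intro x y h
    rw [hS x y h, ← add_assoc, add_comm (S _) (S (E.faceOf x y)), add_assoc,
      CharTwo.add_self_eq_zero, add_zero]
  have hrot : ∀ x y, K.Adj x y →
      S (E.faceOf x (E.rot x y)) = S (E.faceOf x y) + z x (E.rot x y) := by
    intro x y h
    rw [hs _ _ (hE'.adj h), ← hE'.facial_walk h]
  -- `S` is constant along the triangle `vcd`, but the first triangle separates `c` and `d` at `v`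
  have hconst : ∀ x, (∀ y, z x y = 0) → ∀ y y', K.Adj x y → K.Adj x y' →
      S (E.faceOf x y) = S (E.faceOf x y') := by
    intro x hx y y' hy hy'
    refine hE'.induction (P := fun w => S (E.faceOf x y) = S (E.faceOf x w)) hy rfl ?_ hy'
    intro w hw ih
    rw [ih, hrot x w hw, hx, add_zero]
  have hzc : ∀ y, z c y = 0 := by
    intro y
    refine if_neg ?_
    have := hvc.ne
    simp only [Sym2.eq_iff]
    grind
  have hzd : ∀ y, z d y = 0 := by
    intro y
    refine if_neg ?_
    have := hvd.ne
    simp only [Sym2.eq_iff]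
    grind
  have e1 : S (E.faceOf v c) = S (E.faceOf d c) := by
    rw [hs v c hvc, hconst c hzc v d hvc.symm hcd, hs c d hcd, hzc, add_zero, hz.symm v c, hzc,
      add_zero]
  have e2 : S (E.faceOf v b) = S (E.faceOf v c) + 1 := by
    have := hrot v c hvc
    rw [h2] at this
    rw [this]
    congr 1
    exact if_pos (Or.inr (Or.inl rfl))
  have e3 : S (E.faceOf v b) = S (E.faceOf d v) := by
    rw [hE'.facial_walk hvb, h3]
  rw [hconst d hzd v c hvd.symm hcd.symm, ← e1, e2] at e3
  generalize S (E.faceOf v c) = t at e3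
  revert t
  decide

end EmbeddingData

/-! ### Contraction of stars -/

/-- `K` arises from `K'` by contracting, for every vertex `v` of `K`, the set of vertices with
`base a = v`, which is spanned by a star with centre `root v`. The edges of `K'` inside such a set
that do not belong to the star are deleted. The edge `vw` of `K` corresponds to the edge of `K'`
between `port v w` and `port w v`. -/
structure StarContraction {V V' : Type u} {G : SimpleGraph V} {G' : SimpleGraph V'}
    (K : G.Subgraph) (K' : G'.Subgraph) where
  base : V' → V
  root : V → V'
  port : V → V → V'
  base_root : ∀ v, base (root v) = v
  base_port : ∀ v w, base (port v w) = v
  base_mem : ∀ {a}, a ∈ K'.verts → base a ∈ K.verts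
  root_mem : ∀ {v}, v ∈ K.verts → root v ∈ K'.verts
  star : ∀ {a}, a ∈ K'.verts → a ≠ root (base a) → K'.Adj (root (base a)) a
  adj_port : ∀ {v w}, K.Adj v w → K'.Adj (port v w) (port w v)
  link : ∀ {a b}, K'.Adj a b → base a ≠ base b →
    K.Adj (base a) (base b) ∧ a = port (base a) (base b)
  isolated : ∀ {v}, (∀ x, ¬ K.Adj v x) → ∀ x, ¬ K'.Adj (root v) x

namespace StarContraction

open EmbeddingData

variable {V V' : Type u} {G : SimpleGraph V} {G' : SimpleGraph V'} {K : G.Subgraph}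
  {K' : G'.Subgraph} (D : StarContraction K K') {E' : EmbeddingData K'}

theorem link_right {a b : V'} (h : K'.Adj a b) (hb : D.base a ≠ D.base b) :
    b = D.port (D.base b) (D.base a) :=
  (D.link h.symm hb.symm).2

theorem base_port_ne {v w : V} (h : K.Adj v w) :
    D.base (D.port v w) ≠ D.base (D.port w v) := by
  rw [D.base_port, D.base_port]
  exact h.ne

/-- The pair `a`, `c` is an edge inside a contracted set which belongs to the star. -/
def IsTree (a c : V') : Prop :=
  D.base c = D.base a ∧ (a = D.root (D.base a) ∨ c = D.root (D.base c))

/-- The pair `a`, `c` lies inside a contracted set, but not on the star. -/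
def IsDeleted (a c : V') : Prop :=
  D.base c = D.base a ∧ ¬ (a = D.root (D.base a) ∨ c = D.root (D.base c))

variable {D}

theorem IsTree.symm {a c : V'} (h : D.IsTree a c) : D.IsTree c a :=
  ⟨h.1.symm, h.2.symm⟩

theorem isTree_or_isDeleted {a c : V'} (h : D.base c = D.base a) :
    D.IsTree a c ∨ D.IsDeleted a c := by
  by_cases h' : a = D.root (D.base a) ∨ c = D.root (D.base c)
  · exact Or.inl ⟨h, h'⟩
  · exact Or.inr ⟨h, h'⟩

theorem isTree_root {c : V'} {v : V} (h : D.base c = v) : D.IsTree (D.root v) c :=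
  ⟨h.trans (D.base_root v).symm, Or.inl (by rw [D.base_root])⟩

variable (D)

/-- `D.Covers E' a b w`: after the contraction, the corner `(a, b)` of `E'` is contained in the
corner `(D.base a, w)`. One gets from the edge to `w` to the corner `(a, b)` by turning clockwise
around the contracted star. -/
inductive Covers (E' : EmbeddingData K') : V' → V' → V → Prop
  | link {a b : V'} (h : K'.Adj a b) (hb : D.base a ≠ D.base b) : Covers E' a b (D.base b)
  | tree {a b : V'} {w : V} (h : Covers E' a b w) (ht : D.IsTree a (E'.rot a b)) :
      Covers E' (E'.rot a b) a w
  | skip {a b : V'} {w : V} (h : Covers E' a b w) (hd : D.IsDeleted a (E'.rot a b)) :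
      Covers E' a (E'.rot a b) w

/-- `D.Ends E' a b u`: turning clockwise around the contracted star from the corner `(a, b)`, the
first edge of `K` one meets is the one to `u`. -/
inductive Ends (E' : EmbeddingData K') : V' → V' → V → Prop
  | link {a b : V'} (hb : D.base a ≠ D.base (E'.rot a b)) : Ends E' a b (D.base (E'.rot a b))
  | tree {a b : V'} {u : V} (ht : D.IsTree a (E'.rot a b)) (h : Ends E' (E'.rot a b) a u) :
      Ends E' a b u
  | skip {a b : V'} {u : V} (hd : D.IsDeleted a (E'.rot a b)) (h : Ends E' a (E'.rot a b) u) :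
      Ends E' a b u

variable {D}

theorem IsTree.not_isDeleted {a c : V'} (h : D.IsTree a c) : ¬ D.IsDeleted a c :=
  fun h' => h'.2 h.2

theorem Covers.adj (hE : E'.IsRotation) {a b : V'} {w : V} (h : D.Covers E' a b w) :
    K'.Adj a b := by
  induction h with
  | link h hb => exact h
  | tree _ _ ih => exact (hE.adj ih).symm
  | skip _ _ ih => exact hE.adj ih

theorem Covers.adj_base {a b : V'} {w : V} (h : D.Covers E' a b w) :
    K.Adj (D.base a) w := by
  induction h with
  | link h hb => exact (D.link h hb).1
  | tree _ ht ih => rwa [ht.1]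
  | skip _ _ ih => exact ih

theorem covers_port {v w : V} (h : K.Adj v w) : D.Covers E' (D.port v w) (D.port w v) w := by
  have := Covers.link (D := D) (E' := E') (D.adj_port h) (D.base_port_ne h)
  rwa [D.base_port] at this

theorem Covers.inner {a b : V'} {w : V} (h : D.Covers E' a b w) (hab : D.base a = D.base b) :
    (∃ x, D.IsTree a b ∧ E'.rot b x = a ∧ D.Covers E' b x w) ∨
      (∃ x, D.IsDeleted a b ∧ E'.rot a x = b ∧ D.Covers E' a x w) := by
  cases h with
  | link _ hb => exact absurd hab hb
  | tree h ht => exact Or.inl ⟨_, ht.symm, rfl, h⟩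
  | skip h hd => exact Or.inr ⟨_, hd, rfl, h⟩

theorem Covers.link_eq {a b : V'} {w : V} (h : D.Covers E' a b w) (hb : D.base a ≠ D.base b) :
    w = D.base b := by
  cases h with
  | link => rfl
  | tree h ht => exact absurd ht.1 hb
  | skip h hd => exact absurd hd.1.symm hb

/-- A corner is contained in only one corner after the contraction. -/
theorem Covers.unique [Finite V'] (hE : E'.IsRotation) {a b : V'} {w w' : V}
    (h : D.Covers E' a b w) (h' : D.Covers E' a b w') : w = w' := by
  induction h with
  | link _ hb => exact (h'.link_eq hb).symm
  | @tree a b w hc ht ih =>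
    rcases h'.inner ht.1 with ⟨z, -, hz, hc'⟩ | ⟨z, hd, -⟩
    · rw [hE.rot_injective (hc'.adj hE) (hc.adj hE) hz] at hc'
      exact ih hc'
    · exact absurd hd ht.symm.not_isDeleted
  | @skip a b w hc hd ih =>
    rcases h'.inner hd.1.symm with ⟨z, ht, -⟩ | ⟨z, -, hz, hc'⟩
    · exact absurd hd ht.not_isDeleted
    · rw [hE.rot_injective (hc'.adj hE) (hc.adj hE) hz] at hc'
      exact ih hc'

theorem Ends.unique {a b : V'} {u u' : V} (h : D.Ends E' a b u) (h' : D.Ends E' a b u') :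
    u = u' := by
  induction h with
  | link hb =>
    cases h' with
    | link => rfl
    | tree ht => exact absurd ht.1.symm hb
    | skip hd => exact absurd hd.1.symm hb
  | tree ht _ ih =>
    cases h' with
    | link hb => exact absurd ht.1.symm hb
    | tree _ h => exact ih h
    | skip hd => exact absurd hd ht.not_isDeleted
  | skip hd _ ih =>
    cases h' with
    | link hb => exact absurd hd.1.symm hb
    | tree ht => exact absurd hd ht.not_isDeleted
    | skip _ h => exact ih h

/-- All corners that are contained in the same corner after the contraction lead to the same next
edge. -/
theorem Covers.ends {a b : V'} {w u : V} (h : D.Covers E' a b w) (h' : D.Ends E' a b u) :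
    D.Ends E' (D.port (D.base a) w) (D.port w (D.base a)) u := by
  induction h with
  | link h hb => rwa [← (D.link h hb).2, ← D.link_right h hb]
  | tree _ ht ih => rw [ht.1]; exact ih (.tree ht h')
  | skip _ hd ih => exact ih (.skip hd h')

/-- Turning clockwise around a contracted star, one gets to another edge of `K` at last: otherwise
the corners met would be permuted by the next step of the turn, but the first one is not the
result of such a step. -/
theorem exists_covers_link [Finite V'] (hE : E'.IsRotation) {v w : V} (hvw : K.Adj v w) :
    ∃ a b, D.Covers E' a b w ∧ D.base a = v ∧ D.base a ≠ D.base (E'.rot a b) := by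
  classical
  by_contra! hc
  let X := {x : V' × V' // D.Covers E' x.1 x.2 w ∧ D.base x.1 = v}
  have hT : ∀ x : X, ∃ y : X,
      (D.IsTree x.1.1 (E'.rot x.1.1 x.1.2) ∧ y.1 = (E'.rot x.1.1 x.1.2, x.1.1)) ∨
      (D.IsDeleted x.1.1 (E'.rot x.1.1 x.1.2) ∧ y.1 = (x.1.1, E'.rot x.1.1 x.1.2)) := by
    rintro ⟨⟨a, b⟩, hab, rfl⟩
    have hb := hc a b hab rfl
    rcases isTree_or_isDeleted hb.symm with ht | hd
    · exact ⟨⟨(_, _), hab.tree ht, hb.symm⟩, Or.inl ⟨ht, rfl⟩⟩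
    · exact ⟨⟨(a, E'.rot a b), hab.skip hd, rfl⟩, Or.inr ⟨hd, rfl⟩⟩
  choose T hT using hT
  have hinj : Function.Injective T := by
    rintro ⟨⟨a, b⟩, hab, ha⟩ ⟨⟨a', b'⟩, hab', ha'⟩ he
    have h1 := hT ⟨⟨a, b⟩, hab, ha⟩
    have h2 := hT ⟨⟨a', b'⟩, hab', ha'⟩
    rw [← he] at h2
    simp only at h1 h2
    rcases h1 with ⟨ht, h1⟩ | ⟨hd, h1⟩ <;> rcases h2 with ⟨ht', h2⟩ | ⟨hd', h2⟩ <;>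
      rw [h1] at h2 <;> obtain ⟨e1, e2⟩ := Prod.mk.inj h2
    · subst e2
      cases hE.rot_injective (hab.adj hE) (hab'.adj hE) e1
      rfl
    · rw [e1, e2] at ht
      exact absurd hd' ht.symm.not_isDeleted
    · rw [e2, e1] at hd
      exact absurd hd ht'.symm.not_isDeleted
    · subst e1
      cases hE.rot_injective (hab.adj hE) (hab'.adj hE) e2
      rfl
  obtain ⟨x, hx⟩ := Finite.injective_iff_surjective.1 hinj
    ⟨(D.port v w, D.port w v), covers_port hvw, D.base_port _ _⟩
  have h1 := hT x
  rw [hx] at h1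
  rcases h1 with ⟨ht, h1⟩ | ⟨hd, h1⟩ <;> obtain ⟨e1, e2⟩ := Prod.mk.inj h1
  · rw [← e1, ← e2] at ht
    exact D.base_port_ne hvw ht.1
  · rw [← e2, ← e1] at hd
    exact D.base_port_ne hvw hd.1.symm

/-- An edge inside a contracted set none of whose ends is the centre does not end the corner. -/
theorem Covers.step {a b : V'} {w : V} (h : D.Covers E' a b w) (ha : a ≠ D.root (D.base a))
    (hb : E'.rot a b ≠ D.root (D.base a)) (hr : D.base a = D.base (E'.rot a b)) :
    D.Covers E' a (E'.rot a b) w := by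
  refine h.skip ⟨hr.symm, ?_⟩
  rintro (h' | h')
  · exact ha h'
  · exact hb (h'.trans (by rw [hr]))

/-- Every corner is contained in a corner after the contraction, if every vertex that is contracted
into another one has an edge that is kept. -/
theorem exists_covers (hE : E'.IsRotation)
    (hleaf : ∀ a ∈ K'.verts, a ≠ D.root (D.base a) → ∃ b, K'.Adj a b ∧ D.base a ≠ D.base b)
    {a b : V'} (hab : K'.Adj a b) : ∃ w, D.Covers E' a b w := by
  -- turning around a leaf of the star from a kept edge, one arrives at the edge to the centre
  have h1 : ∀ a ∈ K'.verts, a ≠ D.root (D.base a) →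
      ∃ w, D.Covers E' (D.root (D.base a)) a w := by
    intro a ha har
    obtain ⟨b, hab, hb⟩ := hleaf a ha har
    obtain ⟨x, hx, ⟨w, hw⟩, hr⟩ := hE.exists_before (P := fun y => ∃ w, D.Covers E' a y w) hab
      ⟨_, .link hab hb⟩ (D.star ha har).symm (by
        rintro y hy ⟨w, hw⟩ hr
        by_cases hb : D.base a = D.base (E'.rot a y)
        · exact ⟨w, hw.step har hr hb⟩
        · exact ⟨_, .link (hE.adj hy) hb⟩)
    have := hw.tree (by rw [hr]; exact (isTree_root rfl).symm)
    rw [hr] at this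
    exact ⟨w, this⟩
  have h2 : ∀ v b, K'.Adj (D.root v) b → ∃ w, D.Covers E' (D.root v) b w := by
    intro v b hb
    by_cases hvb : D.base b = v
    · subst hvb
      exact h1 b (K'.edge_vert hb.symm) hb.adj_sub.ne'
    · exact ⟨_, .link hb (by rw [D.base_root]; exact fun h => hvb h.symm)⟩
  by_cases har : a = D.root (D.base a)
  · rw [har] at hab ⊢
    exact h2 _ _ hab
  · have hs := D.star (K'.edge_vert hab) har
    have h3 : ∃ w, D.Covers E' a (D.root (D.base a)) w := by
      obtain ⟨x, hx, hr⟩ := hE.exists_rot_eq hs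
      obtain ⟨w, hw⟩ := h2 _ _ hx
      have := hw.tree (by rw [hr]; exact isTree_root rfl)
      rw [hr] at this
      exact ⟨w, this⟩
    refine hE.induction (P := fun y => ∃ w, D.Covers E' a y w) hs.symm h3 ?_ hab
    rintro y hy ⟨w, hw⟩
    by_cases hr : E'.rot a y = D.root (D.base a)
    · rwa [hr]
    by_cases hb : D.base a = D.base (E'.rot a y)
    · exact ⟨w, hw.step har hr hb⟩
    · exact ⟨_, .link (hE.adj hy) hb⟩

end StarContraction

/-! ### Planarity of contractions -/

namespace StarContraction

open EmbeddingData

variable {V V' : Type u} {G : SimpleGraph V} {G' : SimpleGraph V'} {K : G.Subgraph}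
  {K' : G'.Subgraph} {D : StarContraction K K'} {E : EmbeddingData K} {E' : EmbeddingData K'}

theorem eq_root_of_isolated {a : V'} (ha : a ∈ K'.verts) (hi : ∀ x, ¬ K'.Adj a x) :
    a = D.root (D.base a) := by
  by_contra h
  exact hi _ (D.star ha h).symm

theorem isolated_base {a : V'} (ha : a ∈ K'.verts) (hi : ∀ x, ¬ K'.Adj a x) (x : V) :
    ¬ K.Adj (D.base a) x := by
  intro hx
  have har := eq_root_of_isolated (D := D) ha hi
  have hp := D.adj_port hx
  by_cases hb : D.port (D.base a) x = D.root (D.base (D.port (D.base a) x))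
  · rw [D.base_port, ← har] at hb
    exact hi _ (hb ▸ hp)
  · have := D.star (K'.edge_vert hp) hb
    rw [D.base_port, ← har] at this
    exact hi _ this

/-- The embedding `E` arises from `E'` by contracting the stars and deleting the other edges inside
the contracted sets; the face `f` of `E'` becomes a part of the face `q f` of `E`. -/
structure IsContraction (D : StarContraction K K') (E' : EmbeddingData K') (E : EmbeddingData K)
    (q : E'.Face → E.Face) : Prop where
  rot : ∀ {a b w}, D.Covers E' a b w → D.base a ≠ D.base (E'.rot a b) →
    E.rot (D.base a) w = D.base (E'.rot a b)
  face_port : ∀ {v w}, K.Adj v w → q (E'.faceOf (D.port v w) (D.port w v)) = E.faceOf v w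
  face_root : ∀ {v}, (∀ x, ¬ K.Adj v x) → q (E'.faceOf (D.root v) (D.root v)) = E.faceOf v v
  face_deleted : ∀ {a b}, K'.Adj a b → D.IsDeleted a (E'.rot a b) →
    q (E'.faceOf a b) = q (E'.faceOf a (E'.rot a b))

theorem IsContraction.face {q : E'.Face → E.Face} (h : D.IsContraction E' E q)
    (hE' : E'.IsSurface) {a b : V'} {w : V} (hc : D.Covers E' a b w) :
    q (E'.faceOf a b) = E.faceOf (D.base a) w := by
  induction hc with
  | link hab hb =>
    rw [← h.face_port (D.link hab hb).1, ← (D.link hab hb).2, ← D.link_right hab hb]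
  | tree hc ht ih => rw [← hE'.facial_walk (hc.adj hE'.1), ih, ht.1]
  | skip hc hd ih => rw [← h.face_deleted (hc.adj hE'.1) hd, ih]

theorem IsContraction.face_angle {q : E'.Face → E.Face} (h : D.IsContraction E' E q)
    (hE' : E'.IsSurface) (hcov : ∀ {a b}, K'.Adj a b → ∃ w, D.Covers E' a b w) {a b : V'}
    (hab : IsAngle K' a b) :
    ∃ w, IsAngle K (D.base a) w ∧ q (E'.faceOf a b) = E.faceOf (D.base a) w := by
  rcases hab with hab | ⟨rfl, ha, hi⟩
  · obtain ⟨w, hw⟩ := hcov hab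
    exact ⟨w, Or.inl hw.adj_base, h.face hE' hw⟩
  · have hiK := isolated_base (D := D) ha hi
    refine ⟨D.base a, Or.inr ⟨rfl, D.base_mem ha, hiK⟩, ?_⟩
    rw [← h.face_root hiK, ← eq_root_of_isolated ha hi]

/-- The faces on the two sides of a deleted edge. -/
def FaceRel (D : StarContraction K K') (E' : EmbeddingData K') (f g : E'.Face) : Prop :=
  ∃ a b, K'.Adj a b ∧ D.IsDeleted a (E'.rot a b) ∧ f = E'.faceOf a b ∧
    g = E'.faceOf a (E'.rot a b)

open Classical in
/-- The embedding that arises by contracting the stars; the faces on the two sides of a deleted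
edge are merged. The corner `(v, v)` of an isolated vertex is the only one with `v = w`. -/
noncomputable def contract (D : StarContraction K K') (E' : EmbeddingData K') :
    EmbeddingData K where
  rot v w := if h : ∃ u, D.Ends E' (D.port v w) (D.port w v) u then h.choose else w
  Face := Quot (D.FaceRel E')
  faceOf v w := Quot.mk _
    (if v = w then E'.faceOf (D.root v) (D.root v) else E'.faceOf (D.port v w) (D.port w v))
  outer := Quot.mk _ E'.outer

theorem contract_isContraction (D : StarContraction K K') (E' : EmbeddingData K') :
    D.IsContraction E' (D.contract E') (Quot.mk _) where
  rot {a b w} hc hb := by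
    have he := hc.ends (.link hb)
    have hex : ∃ u, D.Ends E' (D.port (D.base a) w) (D.port w (D.base a)) u := ⟨_, he⟩
    simp only [contract, dif_pos hex]
    exact hex.choose_spec.unique he
  face_port {v w} h := by simp only [contract, if_neg h.ne]
  face_root h := by simp only [contract, if_true]
  face_deleted hab hd := Quot.sound ⟨_, _, hab, hd, rfl, rfl⟩

theorem contract_adj [Finite V'] (hE' : E'.IsRotation) {v w : V} (h : K.Adj v w) :
    K.Adj v ((D.contract E').rot v w) := by
  obtain ⟨a, b, hab, rfl, hb⟩ := exists_covers_link (D := D) hE' h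
  rw [(contract_isContraction D E').rot hab hb]
  exact (D.link (hE'.adj (hab.adj hE')) hb).1

/-- Turning around a contracted star one meets all the edges of `K` that leave it. -/
theorem contract_isRotation [Finite V'] (hE' : E'.IsRotation)
    (hcov : ∀ {a b}, K'.Adj a b → ∃ w, D.Covers E' a b w) : (D.contract E').IsRotation := by
  have hD := contract_isContraction D E'
  refine ⟨contract_adj hE', ?_⟩
  let R : V → V → V → Prop := fun v w w' => ∃ k : ℕ, ((D.contract E').rot v)^[k] w = w'
  have hrefl : ∀ v w, R v w w := fun v w => ⟨0, rfl⟩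
  have htrans : ∀ {v x y z}, R v x y → R v y z → R v x z := by
    rintro v x y z ⟨k, rfl⟩ ⟨l, rfl⟩
    exact ⟨l + k, Function.iterate_add_apply _ _ _ _⟩
  -- one step of the turn at a vertex that is not the centre of its star
  have hstep : ∀ {a y w w'}, a ≠ D.root (D.base a) → D.Covers E' a y w → R (D.base a) w' w →
      E'.rot a y ≠ D.root (D.base a) →
      ∃ u, D.Covers E' a (E'.rot a y) u ∧ R (D.base a) w' u := by
    intro a y w w' har hc hR hr
    by_cases hb : D.base a = D.base (E'.rot a y)
    · exact ⟨w, hc.step har hr hb, hR⟩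
    · refine ⟨_, .link (hE'.adj (hc.adj hE')) hb, htrans hR ⟨1, ?_⟩⟩
      exact hD.rot hc hb
  -- all corners at the centre of a star
  have hroot : ∀ {v b b' w w'}, D.Covers E' (D.root v) b w → D.Covers E' (D.root v) b' w' →
      R v w w' := by
    intro v b b' w w' hc hc'
    obtain ⟨u, hu, hR⟩ := hE'.induction
      (P := fun y => ∃ u, D.Covers E' (D.root v) y u ∧ R v w u) (hc.adj hE') ⟨w, hc, hrefl _ _⟩
      (by
        rintro y hy ⟨u, hu, hR⟩
        by_cases hb : D.base (E'.rot (D.root v) y) = v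
        · generalize hz : E'.rot (D.root v) y = z at hb ⊢
          have hzr := (hE'.adj hy)
          rw [hz] at hzr
          have ht := hu.tree (by rw [hz]; exact isTree_root hb)
          rw [hz] at ht
          have hne : z ≠ D.root (D.base z) := by rw [hb]; exact hzr.adj_sub.ne'
          rw [← hb] at hR hzr ht
          obtain ⟨x, hx, ⟨u', hu', hR'⟩, hxr⟩ := hE'.exists_before
            (P := fun y => ∃ u', D.Covers E' z y u' ∧ R (D.base z) w u') hzr.symm
            ⟨u, ht, hR⟩ hzr.symm (fun y _ ⟨u', hu', hR'⟩ hr => hstep hne hu' hR' hr)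
          have ht' := hu'.tree (by rw [hxr]; exact (isTree_root rfl).symm)
          rw [hxr] at ht'
          rw [← hb]
          exact ⟨u', ht', hR'⟩
        · have hb' : D.base (D.root v) ≠ D.base (E'.rot (D.root v) y) := by
            rw [D.base_root]
            exact fun h => hb h.symm
          refine ⟨_, .link (hE'.adj hy) hb', htrans hR ⟨1, ?_⟩⟩
          have := hD.rot hu hb'
          rw [D.base_root] at this
          exact this) (hc'.adj hE')
    rwa [hc'.unique hE' hu]
  intro v w w' hw hw'
  -- every edge of `K` at `v` is reached from, and reaches, a corner at the centre
  have hfrom : ∀ {w}, K.Adj v w → ∃ b u, D.Covers E' (D.root v) b u ∧ R v w u := by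
    intro w hw
    have hc := covers_port (E' := E') (D := D) hw
    have hbp := D.base_port v w
    generalize D.port v w = a at hc hbp
    subst hbp
    by_cases har : a = D.root (D.base a)
    · exact ⟨_, _, har ▸ hc, hrefl _ _⟩
    · have hs := D.star (K'.edge_vert (hc.adj hE')) har
      obtain ⟨x, hx, ⟨u, hu, hR⟩, hxr⟩ := hE'.exists_before
        (P := fun y => ∃ u, D.Covers E' a y u ∧ R (D.base a) w u) (hc.adj hE')
        ⟨w, hc, hrefl _ _⟩ hs.symm (fun y _ ⟨u', hu', hR'⟩ hr => hstep har hu' hR' hr)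
      have ht := hu.tree (by rw [hxr]; exact (isTree_root rfl).symm)
      rw [hxr] at ht
      exact ⟨_, _, ht, hR⟩
  have hto : ∀ {w}, K.Adj v w → ∃ b u, D.Covers E' (D.root v) b u ∧ R v u w := by
    intro w hw
    have hc := covers_port (E' := E') (D := D) hw
    have hbp := D.base_port v w
    generalize D.port v w = a at hc hbp
    subst hbp
    by_cases har : a = D.root (D.base a)
    · exact ⟨_, _, har ▸ hc, hrefl _ _⟩
    · have hs := D.star (K'.edge_vert (hc.adj hE')) har
      obtain ⟨x, hx, hxr⟩ := hE'.exists_rot_eq hs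
      obtain ⟨u, hu⟩ := hcov hx
      have ht := hu.tree (by rw [hxr]; exact isTree_root rfl)
      rw [hxr] at ht
      obtain ⟨u', hu', hR⟩ := hE'.induction
        (P := fun y => ∃ u', D.Covers E' a y u' ∧ R (D.base a) u u') hs.symm
        ⟨u, ht, hrefl _ _⟩ (by
          rintro y hy ⟨u', hu', hR'⟩
          by_cases hr : E'.rot a y = D.root (D.base a)
          · rw [hr]
            exact ⟨u, ht, hrefl _ _⟩
          · exact hstep har hu' hR' hr) (hc.adj hE')
      rw [hc.unique hE' hu']
      exact ⟨_, _, hu, hR⟩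
  obtain ⟨b, u, hu, hR⟩ := hfrom hw
  obtain ⟨b', u', hu', hR'⟩ := hto hw'
  exact htrans hR (htrans (hroot hu hu') hR')

theorem contract_isSurface [Finite V'] (hE' : E'.IsSurface)
    (hcov : ∀ {a b}, K'.Adj a b → ∃ w, D.Covers E' a b w) : (D.contract E').IsSurface where
  toIsRotation := contract_isRotation hE'.1 hcov
  facial_walk {v w} hvw := by
    have hD := contract_isContraction D E'
    obtain ⟨a, b, hab, rfl, hb⟩ := exists_covers_link (D := D) hE'.1 hvw
    have hadj := hE'.adj (hab.adj hE'.1)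
    rw [← hD.face hE' hab, hD.rot hab hb, hE'.facial_walk (hab.adj hE'.1)]
    exact hD.face hE' (.link hadj.symm hb.symm)
  face_boundary hK f := by
    obtain ⟨v, hv⟩ := hK
    induction f using Quot.ind with
    | mk f =>
      obtain ⟨a, b, hab, rfl⟩ := hE'.face_boundary ⟨_, D.root_mem hv⟩ f
      obtain ⟨w, hw, he⟩ := (contract_isContraction D E').face_angle hE' hcov hab
      exact ⟨_, w, hw, he.symm⟩
  connected v hv w hw := by
    have h := hE'.connected _ (D.root_mem hv) _ (D.root_mem hw)
    have h' := Relation.ReflTransGen.lift (p := fun v w => ∃ x y, IsAngle K v x ∧ IsAngle K w y ∧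
      (D.contract E').faceOf v x = (D.contract E').faceOf w y) D.base (fun a b hab => by
        obtain ⟨x, y, hx, hy, he⟩ : ∃ x y, IsAngle K' a x ∧ IsAngle K' b y ∧
          E'.faceOf a x = E'.faceOf b y := hab
        obtain ⟨x', hx', ex⟩ := (contract_isContraction D E').face_angle hE' hcov hx
        obtain ⟨y', hy', ey⟩ := (contract_isContraction D E').face_angle hE' hcov hy
        exact ⟨x', y', hx', hy', by rw [← ex, ← ey, he]⟩) _ _ h
    rwa [Function.onFun, D.base_root, D.base_root] at h'
  subsingleton hK := by
    have := hE'.subsingleton fun ⟨a, ha⟩ => hK ⟨_, D.base_mem ha⟩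
    exact ⟨fun f g => by
      induction f using Quot.ind
      induction g using Quot.ind
      exact congrArg _ (Subsingleton.elim _ _)⟩

/-- Contracting stars of a planar embedding and deleting edges inside the contracted sets leads to a
planar embedding. -/
theorem contract_isPlanar [Finite V] [Finite V'] (hE' : E'.IsPlanar)
    (hcov : ∀ {a b}, K'.Adj a b → ∃ w, D.Covers E' a b w) : (D.contract E').IsPlanar := by
  classical
  have hs := hE'.isSurface
  have hD := contract_isContraction D E'
  refine (contract_isSurface hs hcov).isPlanar fun p d hd hp => ?_
  -- label the corners of `E'` like the corners that contain them
  let κ : V' → V' → V := fun a b => if h : K'.Adj a b then (hcov h).choose else D.base b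
  have hκ : ∀ {a b w}, D.Covers E' a b w → κ a b = w := by
    intro a b w h
    have hab := h.adj hs.1
    simp only [κ, dif_pos hab]
    exact (hcov hab).choose_spec.unique hs.1 h
  let p' : V' → V' → ZMod 2 := fun a b => p (D.base a) (κ a b)
  let d' : V' → V' → ZMod 2 := fun a b =>
    if D.base a = D.base b then (if D.IsTree a b then 0 else p' a b + p' b a)
    else d (D.base a) (D.base b)
  have htree : ∀ {a b}, K'.Adj a b → D.IsTree a (E'.rot a b) →
      p' a b = p' (E'.rot a b) a := by
    intro a b hab ht
    obtain ⟨w, hw⟩ := hcov hab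
    simp only [p', hκ hw, hκ (hw.tree ht), ht.1]
  have hdel : ∀ {a b}, K'.Adj a b → D.IsDeleted a (E'.rot a b) →
      p' a b = p' a (E'.rot a b) := by
    intro a b hab ht
    obtain ⟨w, hw⟩ := hcov hab
    simp only [p', hκ hw, hκ (hw.skip ht)]
  obtain ⟨c, S, hS⟩ := hE'.isSimplyConnected p' d' (by
    intro a b
    have h : D.IsTree a b ↔ D.IsTree b a := ⟨.symm, .symm⟩
    simp only [d', eq_comm (a := D.base a), h, add_comm (p' a b), hd (D.base a)]) (by
    intro a b hab
    obtain ⟨w, hw⟩ := hcov hab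
    by_cases hb : D.base a = D.base (E'.rot a b)
    · rcases isTree_or_isDeleted hb.symm with ht | ht
      · simp only [d', if_pos hb, if_pos ht, htree hab ht]
        exact CharTwo.add_self_eq_zero _
      · simp only [d', if_pos hb, if_neg fun h => IsTree.not_isDeleted h ht, hdel hab ht]
    · simp only [d', if_neg hb, p', hκ hw]
      rw [← hD.rot hw hb, ← hp _ _ hw.adj_base, hκ (.link (hs.adj hab).symm (Ne.symm hb)),
        hD.rot hw hb])
  -- `p'` does not change along an edge of a star, so neither does the vertex part `c`
  have hctree : ∀ {a}, a ∈ K'.verts → c a = c (D.root (D.base a)) := by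
    intro a ha
    by_cases har : a = D.root (D.base a)
    · rw [← har]
    · obtain ⟨x, hx, hr⟩ := hs.exists_rot_eq (D.star ha har)
      have h1 := htree hx (by rw [hr]; exact isTree_root rfl)
      rw [hr, hS _ _ hx, hS _ _ (D.star ha har).symm, hs.facial_walk hx, hr] at h1
      exact (add_left_cancel h1).symm
  refine ⟨fun v => c (D.root v), Quot.lift S ?_, ?_⟩
  · rintro _ _ ⟨a, b, hab, ht, rfl, rfl⟩
    have h1 := hdel hab ht
    rw [hS _ _ hab, hS _ _ (hs.adj hab)] at h1
    exact add_right_cancel h1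
  · intro v w hvw
    have h1 := hS _ _ (D.adj_port hvw)
    simp only [p', hκ (covers_port hvw), D.base_port] at h1
    rw [h1, hctree (K'.edge_vert (D.adj_port hvw)), D.base_port, ← hD.face_port hvw]

end StarContraction

/-! ### Planarity of expansions -/

namespace StarContraction

open EmbeddingData

variable {V V' : Type u} {G : SimpleGraph V} {G' : SimpleGraph V'} {K : G.Subgraph}
  {K' : G'.Subgraph} {D : StarContraction K K'} {E : EmbeddingData K} {E' : EmbeddingData K'}

/-- The embedding `E'` is obtained from `E` by expanding vertices into stars and inserting edges
inside the expanded sets; the face `f` of `E` becomes the face `i f`. -/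
structure IsExpansion (D : StarContraction K K') (E' : EmbeddingData K') (E : EmbeddingData K)
    (q : E'.Face → E.Face) (i : E.Face → E'.Face) : Prop extends D.IsContraction E' E q where
  isRotation : E'.IsRotation
  facial_walk : ∀ {a b}, K'.Adj a b → E'.faceOf a b = E'.faceOf (E'.rot a b) a
  covers : ∀ {a b}, K'.Adj a b → ∃ w, D.Covers E' a b w
  port_face : ∀ {v w}, K.Adj v w → E'.faceOf (D.port v w) (D.port w v) = i (E.faceOf v w)
  root_face : ∀ {v}, (∀ x, ¬ K.Adj v x) → E'.faceOf (D.root v) (D.root v) = i (E.faceOf v v)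
  new_face : ∀ f, (∃ g, f = i g) ∨ ∃ a b, K'.Adj a b ∧ E'.faceOf a b = f
  empty_face : ¬ K'.verts.Nonempty → ∀ f, ∃ g, f = i g

namespace IsExpansion

variable {q : E'.Face → E.Face} {i : E.Face → E'.Face}

/-- A corner of `E` gives a corner of `E'`. -/
theorem exists_angle (h : D.IsExpansion E' E q i) {v w : V} (hvw : IsAngle K v w) :
    ∃ a b, D.base a = v ∧ IsAngle K' a b ∧ E'.faceOf a b = i (E.faceOf v w) := by
  rcases hvw with hvw | ⟨rfl, hv, hi⟩
  · exact ⟨_, _, D.base_port v w, Or.inl (D.adj_port hvw), h.port_face hvw⟩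
  · exact ⟨_, _, D.base_root v, Or.inr ⟨rfl, D.root_mem hv, D.isolated hi⟩, h.root_face hi⟩

theorem isSurface (h : D.IsExpansion E' E q i) (hE : E.IsSurface) : E'.IsSurface where
  toIsRotation := h.isRotation
  facial_walk := h.facial_walk
  face_boundary hK f := by
    obtain ⟨a₀, ha₀⟩ := hK
    rcases h.new_face f with ⟨g, rfl⟩ | ⟨a, b, hab, rfl⟩
    · obtain ⟨v, w, hvw, rfl⟩ := hE.face_boundary ⟨_, D.base_mem ha₀⟩ g
      obtain ⟨a, b, -, hab, he⟩ := h.exists_angle hvw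
      exact ⟨a, b, hab, he⟩
    · exact ⟨a, b, Or.inl hab, rfl⟩
  connected a ha b hb := by
    let R : V' → V' → Prop := fun a b => ∃ x y, IsAngle K' a x ∧ IsAngle K' b y ∧
      E'.faceOf a x = E'.faceOf b y
    have hsymm : ∀ {a b}, R a b → R b a := fun ⟨x, y, hx, hy, he⟩ => ⟨y, x, hy, hx, he.symm⟩
    have hroot : ∀ a ∈ K'.verts, Relation.ReflTransGen R a (D.root (D.base a)) ∧
        Relation.ReflTransGen R (D.root (D.base a)) a := by
      intro a ha
      by_cases har : a = D.root (D.base a)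
      · rw [← har]
        exact ⟨.refl, .refl⟩
      · have hs := D.star ha har
        obtain ⟨x, hx, hr⟩ := h.isRotation.exists_rot_eq hs
        have : R (D.root (D.base a)) a :=
          ⟨x, _, Or.inl hx, Or.inl hs.symm, by rw [h.facial_walk hx, hr]⟩
        exact ⟨.single (hsymm this), .single this⟩
    have hm : ∀ {a x}, IsAngle K' a x → a ∈ K'.verts := by
      rintro a x (hx | hx)
      · exact K'.edge_vert hx
      · exact hx.2.1
    have hc := hE.connected _ (D.base_mem ha) _ (D.base_mem hb)
    refine (hroot a ha).1.trans (Relation.ReflTransGen.trans ?_ (hroot b hb).2)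
    generalize D.base a = v at hc
    generalize D.base b = w at hc
    induction hc with
    | refl => exact .refl
    | tail _ hbc ih =>
      obtain ⟨x, y, hx, hy, he⟩ := hbc
      obtain ⟨a₁, b₁, rfl, h₁, e₁⟩ := h.exists_angle hx
      obtain ⟨a₂, b₂, rfl, h₂, e₂⟩ := h.exists_angle hy
      refine ih.trans ((hroot a₁ (hm h₁)).2.trans (.trans (.single ?_) (hroot a₂ (hm h₂)).1))
      exact ⟨b₁, b₂, h₁, h₂, by rw [e₁, e₂, he]⟩
  subsingleton hK := by
    have := hE.subsingleton fun ⟨v, hv⟩ => hK ⟨_, D.root_mem hv⟩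
    refine ⟨fun f g => ?_⟩
    obtain ⟨f, rfl⟩ := h.empty_face hK f
    obtain ⟨g, rfl⟩ := h.empty_face hK g
    rw [Subsingleton.elim f g]

/-- An expansion of a planar embedding is planar if the new faces can be labelled such that any
given labelling of the corners, that does not change along the edges of the stars, does not jump at the
edges inside the expanded sets. -/
theorem isPlanar [Finite V] [Finite V'] (h : D.IsExpansion E' E q i) (hE : E.IsPlanar)
    (hfill : ∀ p : V' → V' → ZMod 2,
      (∀ a b, K'.Adj a b → D.IsTree a (E'.rot a b) → p a b = p (E'.rot a b) a) →
      (∃ d : V' → V' → ZMod 2, (∀ a b, d a b = d b a) ∧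
        ∀ a b, K'.Adj a b → p a b + p (E'.rot a b) a = d a (E'.rot a b)) →
      ∃ S : E'.Face → ZMod 2, ∀ a b, K'.Adj a b → D.IsDeleted a (E'.rot a b) →
        p a b + S (E'.faceOf a b) = p a (E'.rot a b) + S (E'.faceOf a (E'.rot a b))) :
    E'.IsPlanar := by
  classical
  have hs := hE.isSurface
  have hs' := h.isSurface hs
  refine hs'.isPlanar fun p d hd hp => ?_
  -- after a change of the labels at the vertices, `p` does not change along the edges of the stars
  let g : V' → ZMod 2 := fun a => if a = D.root (D.base a) then 0 else d (D.root (D.base a)) a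
  have hg0 : ∀ a, a = D.root (D.base a) → g a = 0 := fun a ha => if_pos ha
  have hg1 : ∀ a, a ≠ D.root (D.base a) → g a = d (D.root (D.base a)) a := fun a ha => if_neg ha
  let p₁ : V' → V' → ZMod 2 := fun a b => p a b + g a
  let d₁ : V' → V' → ZMod 2 := fun a b => d a b + g a + g b
  have hd₁ : ∀ a b, d₁ a b = d₁ b a := by
    intro a b
    simp only [d₁, hd a b]
    ring
  have hp₁ : ∀ a b, K'.Adj a b → p₁ a b + p₁ (E'.rot a b) a = d₁ a (E'.rot a b) := by
    intro a b hab
    simp only [p₁, d₁, ← hp a b hab]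
    ring
  have htree₀ : ∀ a c, K'.Adj a c → D.IsTree a c → a = D.root (D.base a) → d₁ a c = 0 := by
    intro a c hac ht ha
    have hc : c ≠ D.root (D.base c) := by
      rw [ht.1, ← ha]
      exact hac.adj_sub.ne'
    simp only [d₁, hg0 a ha, hg1 c hc, ht.1, ← ha, add_zero]
    exact CharTwo.add_self_eq_zero _
  have htree : ∀ a b, K'.Adj a b → D.IsTree a (E'.rot a b) → p₁ a b = p₁ (E'.rot a b) a := by
    intro a b hab ht
    refine CharTwo.add_eq_zero.1 ?_
    rw [hp₁ a b hab]
    rcases ht.2 with ha | ha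
    · exact htree₀ _ _ (hs'.adj hab) ht ha
    · rw [hd₁]
      exact htree₀ _ _ (hs'.adj hab).symm ht.symm ha
  obtain ⟨S₀, hS₀⟩ := hfill p₁ htree ⟨d₁, hd₁, hp₁⟩
  -- after the correction by `S₀`, the labels are constant on every corner of `E`
  let r : V' → V' → ZMod 2 := fun a b => p₁ a b + S₀ (E'.faceOf a b)
  have hr : ∀ {a b w}, D.Covers E' a b w →
      r a b = r (D.port (D.base a) w) (D.port w (D.base a)) := by
    intro a b w hc
    induction hc with
    | link hab hb => rw [← (D.link hab hb).2, ← D.link_right hab hb]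
    | tree hc ht ih =>
      rw [ht.1, ← ih]
      simp only [r, ← htree _ _ (hc.adj hs'.1) ht, ← hs'.facial_walk (hc.adj hs'.1)]
    | skip hc hd ih => rw [← ih]; exact (hS₀ _ _ (hc.adj hs'.1) hd).symm
  obtain ⟨c, S, hS⟩ := hE.isSimplyConnected (fun v w => r (D.port v w) (D.port w v))
    (fun v w => d₁ (D.port v w) (D.port w v)) (fun v w => hd₁ _ _) (by
      intro v w hvw
      obtain ⟨a, b, hab, rfl, hb⟩ := exists_covers_link (D := D) hs'.1 hvw
      have hadj := hab.adj hs'.1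
      have hl := hs'.adj hadj
      rw [← hr hab, h.rot hab hb, ← (D.link hl hb).2, ← D.link_right hl hb, ← hp₁ a b hadj]
      simp only [r, ← hs'.facial_walk hadj]
      generalize S₀ _ = t
      generalize p₁ a b = t'
      generalize p₁ _ _ = t''
      revert t t' t''
      decide)
  refine ⟨fun a => c (D.base a) + g a, fun f => S₀ f + S (q f), fun a b hab => ?_⟩
  obtain ⟨w, hw⟩ := h.covers hab
  have h1 := hr hw
  have h2 := hS _ _ hw.adj_base
  rw [← h1, ← h.face hs' hw] at h2
  change p a b + g a + S₀ (E'.faceOf a b) = _ at h2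
  change p a b = S₀ (E'.faceOf a b) + S (q (E'.faceOf a b)) + (c (D.base a) + g a)
  generalize S₀ (E'.faceOf a b) = t at h2 ⊢
  rw [show p a b = p a b + g a + t + (g a + t) from by
    generalize p a b = x
    generalize g a = y
    clear h2
    revert x y t
    decide, h2]
  ring

end IsExpansion

end StarContraction

/-! ### The modified graph -/

namespace PortInstance

open EmbeddingData

variable {V : Type u} {I : PortInstance V}

/-- The vertex of the given graph to whose gadget a vertex of the modified graph belongs. -/
def base : I.Vert → V
  | .orig v => v
  | .hub v _ => v
  | .rim v _ _ _ => v

@[simp] theorem base_orig (v : V) : base (I := I) (.orig v) = v := rfl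
@[simp] theorem base_hub (v : V) (h : I.IsHub v) : base (.hub v h) = v := rfl
@[simp] theorem base_rim (v w : V) (h : I.IsWheel v) (hw : I.G.Adj v w) :
    base (.rim v w h hw) = v := rfl

@[simp] theorem base_port (v w : V) : base (I.port v w) = v := by
  unfold port
  split_ifs <;> rfl

theorem IsWheel.not_isHub {v : V} (h : I.IsWheel v) : ¬ I.IsHub v := by
  obtain ⟨h1, -, h3⟩ := h
  rintro (h' | ⟨-, -, w, hw, hP⟩)
  · omega
  · have := h3 w hw
    omega

theorem port_wheel {v w : V} (h : I.IsWheel v) (hw : I.G.Adj v w) :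
    I.port v w = .rim v w h hw := by
  unfold port
  rw [dif_pos ⟨h, hw⟩]

theorem port_hub {v w : V} (h : I.IsHub v) (hw : ¬ I.H.Adj v w) : I.port v w = .hub v h := by
  unfold port
  rw [dif_neg fun h' => h'.1.not_isHub h, dif_pos ⟨h, hw⟩]

theorem port_orig {v w : V} (h : ¬ I.IsWheel v) (hw : I.IsHub v → I.H.Adj v w) :
    I.port v w = .orig v := by
  unfold port
  rw [dif_neg fun h' => h h'.1, dif_neg fun h' => h'.2 (hw h'.1)]

theorem eq_of_port_eq_orig {v w : V} (hw : I.G.Adj v w) (h : I.port v w = .orig v) :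
    ¬ I.IsWheel v ∧ (I.IsHub v → I.H.Adj v w) := by
  constructor
  · intro h'
    rw [port_wheel h' hw] at h
    cases h
  · intro h'
    by_contra h''
    rw [port_hub h' h''] at h
    cases h

theorem port_eq_hub {v w : V} {h : I.IsHub v} (he : I.port v w = .hub v h) : ¬ I.H.Adj v w := by
  intro h'
  rw [port_orig (fun h'' => h''.not_isHub h) fun _ => h'] at he
  cases he

theorem graph_adj_port {v w : V} (h : I.G.Adj v w) : I.graph.Adj (I.port v w) (I.port w v) :=
  ⟨I.port_ne h.ne, Or.inl (.link v w h)⟩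

theorem graph_adj_hub {v : V} (h : I.IsHub v) : I.graph.Adj (.orig v) (.hub v h) :=
  ⟨by simp, Or.inl (.hub v h)⟩

theorem graph_adj_spoke {v w : V} (h : I.IsWheel v) (hw : I.G.Adj v w) :
    I.graph.Adj (.orig v) (.rim v w h hw) :=
  ⟨by simp, Or.inl (.spoke v w h hw)⟩

theorem graph_adj_rim {v w x : V} (h : I.IsWheel v) (hw : I.G.Adj v w) (hx : I.G.Adj v x)
    (hwx : ¬ (I.H.Adj v w ↔ I.H.Adj v x)) : I.graph.Adj (.rim v w h hw) (.rim v x h hx) := by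
  refine ⟨fun he => ?_, ?_⟩
  · cases he
    exact hwx Iff.rfl
  · by_cases hHw : I.H.Adj v w
    · exact Or.inl (.rim v w x h hw hx hHw fun h' => hwx ⟨fun _ => h', fun _ => hHw⟩)
    · exact Or.inr (.rim v x w h hx hw (by tauto) hHw)

theorem subgraph_adj_port {v w : V} (h : I.H.Adj v w) :
    I.subgraph.Adj (I.port v w) (I.port w v) := Or.inl (.link v w h)

theorem subgraph_adj_hub {v : V} (h : I.IsHub v) : I.subgraph.Adj (.orig v) (.hub v h) :=
  Or.inl (.hub v h)

theorem subgraph_adj_spoke {v w : V} (h : I.IsWheel v) (hw : I.H.Adj v w) :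
    I.subgraph.Adj (.orig v) (.rim v w h hw.adj_sub) :=
  Or.inl (.spoke v w h hw.adj_sub hw)

theorem graph_link {a b : I.Vert} (hab : I.graph.Adj a b) (hb : base a ≠ base b) :
    I.G.Adj (base a) (base b) ∧ a = I.port (base a) (base b) := by
  rcases hab.2 with h | h <;> cases h with
  | link v w h =>
    rw [base_port, base_port]
    first | exact ⟨h, rfl⟩ | exact ⟨h.symm, rfl⟩
  | hub => exact absurd rfl hb
  | spoke => exact absurd rfl hb
  | rim => exact absurd rfl hb

theorem graph_inner {a b : I.Vert} (hab : I.graph.Adj a b) (hb : base a = base b) :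
    a = .orig (base a) ∨ b = .orig (base b) ∨
      ∃ v w x h hw hx, a = .rim v w h hw ∧ b = .rim v x h hx ∧ ¬ (I.H.Adj v w ↔ I.H.Adj v x) := by
  rcases hab.2 with h | h <;> cases h with
  | link v w h =>
    rw [base_port, base_port] at hb
    exact absurd hb (by first | exact h.ne | exact h.ne')
  | hub => simp
  | spoke => simp
  | rim v w x hv hw hx hHw hHx =>
    refine Or.inr (Or.inr ?_)
    first
    | exact ⟨v, w, x, hv, hw, hx, rfl, rfl, by tauto⟩
    | exact ⟨v, x, w, hv, hx, hw, rfl, rfl, by tauto⟩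

theorem subgraph_link {a b : I.Vert} (hab : I.subgraph.Adj a b) (hb : base a ≠ base b) :
    I.H.Adj (base a) (base b) ∧ a = I.port (base a) (base b) := by
  rcases hab with h | h <;> cases h with
  | link v w h =>
    rw [base_port, base_port]
    first | exact ⟨h, rfl⟩ | exact ⟨h.symm, rfl⟩
  | hub => exact absurd rfl hb
  | spoke => exact absurd rfl hb

theorem subgraph_inner {a b : I.Vert} (hab : I.subgraph.Adj a b) (hb : base a = base b) :
    a = .orig (base a) ∨ b = .orig (base b) := by
  rcases hab with h | h <;> cases h with
  | link v w h =>
    rw [base_port, base_port] at hb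
    exact absurd hb (by first | exact h.ne | exact h.adj_sub.ne')
  | hub => simp
  | spoke => simp

theorem graph_star {a : I.Vert} (h : a ≠ .orig (base a)) : I.graph.Adj (.orig (base a)) a := by
  cases a with
  | orig v => exact absurd rfl h
  | hub v hv => exact graph_adj_hub hv
  | rim v w hv hw => exact graph_adj_spoke hv hw

theorem subgraph_star {a : I.Vert} (ha : I.InH a) (h : a ≠ .orig (base a)) :
    I.subgraph.Adj (.orig (base a)) a := by
  cases a with
  | orig v => exact absurd rfl h
  | hub v hv => exact subgraph_adj_hub hv
  | rim v w hv hw => exact subgraph_adj_spoke hv ha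

theorem IsHub.exists_adj {v : V} (h : I.IsHub v) : ∃ w, I.H.Adj v w := by
  have hne : (I.H.neighborSet v).ncard ≠ 0 := by
    rcases h with h | h <;> omega
  exact Set.nonempty_of_ncard_ne_zero hne

/-- The given graph arises from the modified graph by contracting the gadgets; the rims of the
wheels are deleted. -/
noncomputable def graphContraction (I : PortInstance V) :
    StarContraction (⊤ : I.G.Subgraph) (⊤ : I.graph.Subgraph) where
  base := base
  root := .orig
  port := I.port
  base_root _ := rfl
  base_port := base_port
  base_mem _ := trivial
  root_mem _ := trivial
  star _ h := graph_star h
  adj_port h := graph_adj_port h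
  link h hb := graph_link h hb
  isolated {v} h x hx := by
    by_cases hb : v = base x
    · cases x with
      | orig w => cases hb; exact hx.ne rfl
      | hub w hw =>
        cases hb
        obtain ⟨y, hy⟩ := hw.exists_adj
        exact h y hy.adj_sub
      | rim w y hw hy => cases hb; exact h y hy
    · exact h _ (graph_link hx hb).1

/-- The subgraph of the given instance arises from the modified subgraph by contracting the
gadgets. -/
noncomputable def subgraphContraction (I : PortInstance V) : StarContraction I.H I.subgraph where
  base := base
  root := .orig
  port := I.port
  base_root _ := rfl
  base_port := base_port
  base_mem {a} h := by
    cases a with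
    | orig v => exact h
    | hub v hv => exact hv.mem_verts
    | rim v w hv hw => exact I.H.edge_vert h
  root_mem h := h
  star ha h := subgraph_star ha h
  adj_port h := subgraph_adj_port h
  link h hb := subgraph_link h hb
  isolated {v} h x hx := by
    by_cases hb : v = base x
    · have hm : I.InH x := I.subgraph.edge_vert hx.symm
      cases x with
      | orig w => cases hb; exact hx.adj_sub.ne rfl
      | hub w hw =>
        cases hb
        obtain ⟨y, hy⟩ := hw.exists_adj
        exact h y hy
      | rim w y hw hy => cases hb; exact h y hm
    · exact h _ (subgraph_link hx hb).1

instance [Finite V] : Finite I.Vert := by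
  classical
  let f : I.Vert → V ⊕ V ⊕ V × V := fun
    | .orig v => .inl v
    | .hub v _ => .inr (.inl v)
    | .rim v w _ _ => .inr (.inr (v, w))
  refine Finite.of_injective f ?_
  rintro (_ | _ | _) (_ | _ | _) h <;> simp_all [f]

/-! ### Port constraints and degrees -/

theorem sum_ports [Finite V] {v : V} {s : Finset V} (hs : ∀ w ∈ s, I.H.Adj v w)
    (hne : s.Nonempty) : ∑ w ∈ s, I.P v w + (I.H.neighborSet v).ncard ≤ 4 := by
  obtain ⟨w, hw⟩ := hne
  rw [← I.ports v ⟨w, hs w hw⟩, finsum_mem_eq_finite_toFinset_sum _ (Set.toFinite _)]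
  exact Nat.add_le_add_right (Finset.sum_le_sum_of_subset fun x hx => by simpa using hs x hx) _

theorem ncard_H_le [Finite V] (v : V) :
    (I.H.neighborSet v).ncard ≤ (I.G.neighborSet v).ncard :=
  Set.ncard_le_ncard (I.H.neighborSet_subset v)

theorem P_add_le [Finite V] {v w : V} (hw : I.H.Adj v w) :
    I.P v w + (I.H.neighborSet v).ncard ≤ 4 := by
  simpa using sum_ports (s := {w}) (by simpa using hw) (by simp)

theorem P_add_P_le [Finite V] {v w w' : V} (hw : I.H.Adj v w) (hw' : I.H.Adj v w') (h : w ≠ w') :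
    I.P v w + I.P v w' + (I.H.neighborSet v).ncard ≤ 4 := by
  classical
  simpa [Finset.sum_pair h] using sum_ports (s := {w, w'}) (v := v) (by simp [hw, hw']) (by simp)

theorem exists_P_pos [Finite V] {v w : V} (hw : I.H.Adj v w)
    (h : (I.H.neighborSet v).ncard < 4) : ∃ x, I.H.Adj v x ∧ 0 < I.P v x := by
  by_contra! hc
  have := I.ports v ⟨w, hw⟩
  rw [finsum_mem_congr (s := I.H.neighborSet v) rfl (g := fun _ => 0)
    (fun x hx => Nat.le_zero.1 (hc x hx))] at this
  simp only [finsum_mem_zero] at this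
  omega

theorem IsHub.lt [Finite V] {v : V} (h : I.IsHub v) :
    (I.H.neighborSet v).ncard < (I.G.neighborSet v).ncard := by
  rcases h with h | h <;> omega

theorem exists_not_adj [Finite V] {v : V}
    (h : (I.H.neighborSet v).ncard < (I.G.neighborSet v).ncard) :
    ∃ w, I.G.Adj v w ∧ ¬ I.H.Adj v w := by
  obtain ⟨w, hw, hw'⟩ := Set.exists_mem_notMem_of_ncard_lt_ncard h
  exact ⟨w, hw, hw'⟩

theorem IsHub.slot_spec [Finite V] {v : V} (h : I.IsHub v) :
    I.H.Adj v (I.slot v) ∧ 0 < I.P v (I.slot v) := by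
  obtain ⟨w, hw⟩ := h.exists_adj
  have hex := exists_P_pos hw (by have := h.lt; have := I.degree_le v; omega)
  unfold slot
  rw [dif_pos hex]
  exact hex.choose_spec

/-- At a hub, all free ports lie in one sector. -/
theorem IsHub.P_eq [Finite V] {v : V} (h : I.IsHub v) :
    I.P v (I.slot v) + (I.H.neighborSet v).ncard = 4 ∧
      ∀ w, I.H.Adj v w → w ≠ I.slot v → I.P v w = 0 := by
  obtain ⟨h1, h2⟩ := h.slot_spec
  have h3 := P_add_le h1
  rcases h with ⟨h, -⟩ | ⟨h, -, x, hx, hP⟩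
  · refine ⟨by omega, fun w hw hne => ?_⟩
    have := P_add_P_le hw h1 hne
    omega
  · have hxs : x = I.slot v := by
      by_contra hne
      have := P_add_P_le hx h1 hne
      omega
    subst hxs
    refine ⟨by omega, fun w hw hne => ?_⟩
    have := P_add_P_le hw h1 hne
    omega

/-- Wherever no gadget is inserted, the port constraints allow all edges outside `H` in any
sector. -/
theorem le_P [Finite V] {v w : V} (hw : I.H.Adj v w) (h1 : ¬ I.IsHub v) (h2 : ¬ I.IsWheel v) :
    (I.G.neighborSet v).ncard ≤ I.P v w + (I.H.neighborSet v).ncard := by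
  classical
  have hle := ncard_H_le (I := I) v
  have hle4 := I.degree_le v
  have hp := I.ports v ⟨w, hw⟩
  have hfin : (I.H.neighborSet v).Finite := Set.toFinite _
  rw [finsum_mem_eq_finite_toFinset_sum _ hfin, Set.ncard_eq_toFinset_card _ hfin] at hp
  rw [Set.ncard_eq_toFinset_card _ hfin] at hle ⊢
  have hmem : w ∈ hfin.toFinset := by simpa using hw
  have hpos : 0 < hfin.toFinset.card := Finset.card_pos.2 ⟨w, hmem⟩
  have hc3 : ¬ (hfin.toFinset.card = 3 ∧ (I.G.neighborSet v).ncard = 4) := by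
    intro h
    refine h1 (Or.inl ⟨?_, h.2⟩)
    rw [Set.ncard_eq_toFinset_card _ hfin]
    exact h.1
  by_cases hc1 : hfin.toFinset.card = 1
  · obtain ⟨x, hx⟩ := Finset.card_eq_one.1 hc1
    rw [hx, Finset.mem_singleton] at hmem
    subst hmem
    rw [hx, Finset.sum_singleton] at hp
    rw [hx]
    omega
  by_cases hc2 : hfin.toFinset.card = 2
  · have hP : 3 ≤ (I.G.neighborSet v).ncard → ∀ x, I.H.Adj v x → I.P v x ≠ 2 := by
      intro h3 x hx hP
      exact h1 (Or.inr ⟨by rw [Set.ncard_eq_toFinset_card _ hfin]; exact hc2, h3, x, hx, hP⟩)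
    obtain ⟨x, y, hxy, hs⟩ := Finset.card_eq_two.1 hc2
    have hall : ∀ z, I.H.Adj v z ↔ z = x ∨ z = y := by
      intro z
      have : z ∈ hfin.toFinset ↔ z ∈ ({x, y} : Finset V) := by rw [hs]
      simpa using this
    have hx : I.H.Adj v x := (hall x).2 (Or.inl rfl)
    have hy : I.H.Adj v y := (hall y).2 (Or.inr rfl)
    rw [hc2, hs, Finset.sum_pair hxy] at hp
    by_cases h3 : 3 ≤ (I.G.neighborSet v).ncard
    · have hPx := hP h3 x hx
      have hPy := hP h3 y hy
      have h4 : (I.G.neighborSet v).ncard ≠ 4 := by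
        intro h4
        refine h2 ⟨by rw [Set.ncard_eq_toFinset_card _ hfin]; exact hc2, h4, fun z hz => ?_⟩
        rcases (hall z).1 hz with rfl | rfl <;> omega
      rcases (hall w).1 hw with rfl | rfl <;> omega
    · omega
  · omega

end PortInstance

/-! ### The embedding of the modified subgraph -/

namespace PortInstance

open EmbeddingData StarContraction

variable {V : Type u} {I : PortInstance V}

theorem toward_wheel {v w : V} (h : I.IsWheel v) (hw : I.G.Adj v w) :
    I.toward v w = .rim v w h hw := by
  unfold toward
  rw [if_pos h, port_wheel h hw]

theorem toward_eq_port {v w : V} (h : ¬ I.IsWheel v) : I.toward v w = I.port w v :=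
  if_neg h

theorem toward_ne_hub {v w x : V} {h : I.IsHub x} (hw : I.H.Adj v w) : I.toward v w ≠ .hub x h := by
  intro he
  by_cases hv : I.IsWheel v
  · rw [toward_wheel hv hw.adj_sub] at he
    cases he
  · rw [toward_eq_port hv] at he
    have := congrArg base he
    simp only [base_port, base_hub] at this
    subst this
    exact port_eq_hub he hw.symm

theorem source_toward {v w : V} (hw : I.H.Adj v w) : I.source v (I.toward v w) = w := by
  by_cases hv : I.IsWheel v
  · rw [toward_wheel hv hw.adj_sub]
    exact if_pos rfl
  · rw [toward_eq_port hv]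
    by_cases hww : I.IsWheel w
    · rw [port_wheel hww hw.adj_sub.symm]
      exact if_neg hw.adj_sub.ne'
    · rw [port_orig hww fun _ => hw.symm]
      rfl

open Classical in
theorem rot_orig_toward {v w : V} (hw : I.H.Adj v w) (h : ¬ (I.IsHub v ∧ w = I.slot v)) :
    I.rot (.orig v) (I.toward v w) = I.toward v (I.emb.rot v w) := by
  have hs := source_toward hw
  have h' : ∀ x hx, I.toward v w ≠ .hub x hx := fun x hx => toward_ne_hub hw
  generalize I.toward v w = a at hs h'
  have : I.rot (.orig v) a = if h : I.IsHub v ∧ I.source v a = I.slot v then .hub v h.1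
      else I.toward v (I.emb.rot v (I.source v a)) := by
    cases a with
    | orig => rfl
    | hub x hx => exact absurd rfl (h' x hx)
    | rim => rfl
  rw [this, hs, dif_neg h]

open Classical in
theorem rot_orig_slot [Finite V] {v : V} (h : I.IsHub v) :
    I.rot (.orig v) (I.toward v (I.slot v)) = .hub v h := by
  have hw := h.slot_spec.1
  have hs := source_toward hw
  have h' : ∀ x hx, I.toward v (I.slot v) ≠ .hub x hx := fun x hx => toward_ne_hub hw
  generalize I.toward v (I.slot v) = a at hs h'
  have : I.rot (.orig v) a = if h : I.IsHub v ∧ I.source v a = I.slot v then .hub v h.1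
      else I.toward v (I.emb.rot v (I.source v a)) := by
    cases a with
    | orig => rfl
    | hub x hx => exact absurd rfl (h' x hx)
    | rim => rfl
  rw [this, dif_pos ⟨h, hs⟩]

theorem rot_orig_hub {v : V} (h : I.IsHub v) :
    I.rot (.orig v) (.hub v h) = I.toward v (I.emb.rot v (I.slot v)) := rfl

theorem rot_rim_orig {v w : V} (h : I.IsWheel v) (hw : I.G.Adj v w) :
    I.rot (.rim v w h hw) (.orig v) = I.port w v := if_pos rfl

theorem port_ne_orig {v w : V} (h : v ≠ w) : I.port w v ≠ .orig v := by
  intro he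
  have := congrArg base he
  simp only [base_port, base_orig] at this
  exact h this.symm

theorem rot_rim_port {v w : V} (h : I.IsWheel v) (hw : I.G.Adj v w) :
    I.rot (.rim v w h hw) (I.port w v) = .orig v := if_neg (port_ne_orig hw.ne)

theorem subgraph_adj_toward {v w : V} (hw : I.H.Adj v w) :
    I.subgraph.Adj (.orig v) (I.toward v w) := by
  by_cases hv : I.IsWheel v
  · rw [toward_wheel hv hw.adj_sub]
    exact subgraph_adj_spoke hv hw
  · rw [toward_eq_port hv, ← port_orig hv fun _ => hw]
    exact subgraph_adj_port hw

theorem subgraph_adj_orig {v : V} {b : I.Vert} (h : I.subgraph.Adj (.orig v) b) :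
    (∃ hv, b = .hub v hv) ∨ ∃ w, I.H.Adj v w ∧ b = I.toward v w := by
  by_cases hb : v = base b
  · have hm : I.InH b := I.subgraph.edge_vert h.symm
    cases b with
    | orig w => cases hb; exact absurd rfl h.adj_sub.ne
    | hub w hw => cases hb; exact Or.inl ⟨hw, rfl⟩
    | rim w x hw hx => cases hb; exact Or.inr ⟨x, hm, (toward_wheel hw hx).symm⟩
  · obtain ⟨h1, h2⟩ := subgraph_link h hb
    obtain ⟨-, h3⟩ := subgraph_link h.symm (Ne.symm hb)
    have hv : ¬ I.IsWheel v := (eq_of_port_eq_orig h1.adj_sub h2.symm).1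
    exact Or.inr ⟨base b, h1, by rw [toward_eq_port hv]; exact h3⟩

theorem subgraph_adj_hub_iff {v : V} {hv : I.IsHub v} {b : I.Vert}
    (h : I.subgraph.Adj (.hub v hv) b) : b = .orig v := by
  by_cases hb : v = base b
  · rcases subgraph_inner h hb with h' | h'
    · cases h'
    · rw [h', ← hb]
  · obtain ⟨h1, h2⟩ := subgraph_link h hb
    exact absurd h1 (port_eq_hub h2.symm)

theorem subgraph_adj_rim {v w : V} {hv : I.IsWheel v} {hw : I.G.Adj v w} {b : I.Vert}
    (h : I.subgraph.Adj (.rim v w hv hw) b) : I.H.Adj v w ∧ (b = .orig v ∨ b = I.port w v) := by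
  refine ⟨I.subgraph.edge_vert h, ?_⟩
  by_cases hb : v = base b
  · rcases subgraph_inner h hb with h' | h'
    · cases h'
    · exact Or.inl (by rw [h', ← hb])
  · obtain ⟨h1, h2⟩ := subgraph_link h hb
    obtain ⟨-, h3⟩ := subgraph_link h.symm (Ne.symm hb)
    simp only [base_rim] at h2 h3
    rw [port_wheel hv h1.adj_sub] at h2
    cases h2
    exact Or.inr h3

theorem subgraph_adj_rim_port {v w : V} (hv : I.IsWheel v) (hw : I.H.Adj v w) :
    I.subgraph.Adj (.rim v w hv hw.adj_sub) (I.port w v) := by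
  rw [← port_wheel hv hw.adj_sub]
  exact subgraph_adj_port hw

/-- The different kinds of corners of the modified subgraph. -/
inductive SubgraphCorner (I : PortInstance V) : I.Vert → I.Vert → Prop
  | orig_hub (v : V) (h : I.IsHub v) : SubgraphCorner I (.orig v) (.hub v h)
  | orig_slot (v : V) (h : I.IsHub v) : SubgraphCorner I (.orig v) (I.toward v (I.slot v))
  | orig_link (v w : V) (hw : I.H.Adj v w) (hv : ¬ I.IsWheel v)
      (hs : ¬ (I.IsHub v ∧ w = I.slot v)) : SubgraphCorner I (.orig v) (I.toward v w)
  | orig_rim (v w : V) (hv : I.IsWheel v) (hw : I.H.Adj v w) :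
      SubgraphCorner I (.orig v) (I.toward v w)
  | hub (v : V) (h : I.IsHub v) : SubgraphCorner I (.hub v h) (.orig v)
  | rim_orig (v w : V) (h : I.IsWheel v) (hw : I.H.Adj v w) :
      SubgraphCorner I (.rim v w h hw.adj_sub) (.orig v)
  | rim_port (v w : V) (h : I.IsWheel v) (hw : I.H.Adj v w) :
      SubgraphCorner I (.rim v w h hw.adj_sub) (I.port w v)

theorem subgraphCorner {a b : I.Vert} (h : I.subgraph.Adj a b) : I.SubgraphCorner a b := by
  cases a with
  | orig v =>
    rcases subgraph_adj_orig h with ⟨hv, rfl⟩ | ⟨w, hw, rfl⟩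
    · exact .orig_hub v hv
    · by_cases hv : I.IsWheel v
      · exact .orig_rim v w hv hw
      · by_cases hs : I.IsHub v ∧ w = I.slot v
        · obtain ⟨hs, rfl⟩ := hs
          exact .orig_slot v hs
        · exact .orig_link v w hw hv hs
  | hub v hv =>
    rw [subgraph_adj_hub_iff h]
    exact .hub v hv
  | rim v w hv hw =>
    obtain ⟨hw', rfl | rfl⟩ := subgraph_adj_rim h
    · exact .rim_orig v w hv hw'
    · exact .rim_port v w hv hw'

theorem IsWheel.not_isHub_and {v : V} (h : I.IsWheel v) {p : Prop} : ¬ (I.IsHub v ∧ p) :=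
  fun h' => h.not_isHub h'.1

theorem emb_isRotation [Finite V] (I : PortInstance V) : I.emb.IsRotation :=
  I.planar.isSurface.1

theorem IsHub.not_isWheel {v : V} (h : I.IsHub v) : ¬ I.IsWheel v := fun h' => h'.not_isHub h

theorem reduced_isRotation [Finite V] (I : PortInstance V) :
    IsRotation (K := I.subgraph) I.reduced.emb where
  adj {a b} hab := by
    change I.subgraph.Adj a (I.rot a b)
    cases subgraphCorner hab with
    | orig_hub v h =>
      rw [rot_orig_hub]
      exact subgraph_adj_toward (I.emb_isRotation.adj h.slot_spec.1)
    | orig_slot v h =>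
      rw [rot_orig_slot h]
      exact subgraph_adj_hub h
    | orig_link v w hw hv hs =>
      rw [rot_orig_toward hw hs]
      exact subgraph_adj_toward (I.emb_isRotation.adj hw)
    | orig_rim v w hv hw =>
      rw [rot_orig_toward hw hv.not_isHub_and]
      exact subgraph_adj_toward (I.emb_isRotation.adj hw)
    | hub v h => exact (subgraph_adj_hub h).symm
    | rim_orig v w h hw =>
      rw [rot_rim_orig]
      exact subgraph_adj_rim_port h hw
    | rim_port v w h hw =>
      rw [rot_rim_port]
      exact (subgraph_adj_spoke h hw).symm
  cyclic {a b b'} hb hb' := by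
    change ∃ k, (I.rot a)^[k] b = b'
    cases a with
    | orig v =>
      have h1 : ∃ w k, I.H.Adj v w ∧ (I.rot (.orig v))^[k] b = I.toward v w := by
        rcases subgraph_adj_orig hb with ⟨hv, rfl⟩ | ⟨w, hw, rfl⟩
        · exact ⟨_, 1, I.emb_isRotation.adj hv.slot_spec.1, rot_orig_hub hv⟩
        · exact ⟨w, 0, hw, rfl⟩
      have h2 : ∃ w k, I.H.Adj v w ∧ (I.rot (.orig v))^[k] (I.toward v w) = b' := by
        rcases subgraph_adj_orig hb' with ⟨hv, rfl⟩ | ⟨w, hw, rfl⟩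
        · exact ⟨_, 1, hv.slot_spec.1, rot_orig_slot hv⟩
        · exact ⟨w, 0, hw, rfl⟩
      obtain ⟨w, k, hw, hk⟩ := h1
      obtain ⟨w', k', hw', hk'⟩ := h2
      obtain ⟨l, hl⟩ := I.emb_isRotation.reach_of_map (I.rot (.orig v)) (I.toward v) (by
        intro x hx
        by_cases hs : I.IsHub v ∧ x = I.slot v
        · obtain ⟨hs, rfl⟩ := hs
          exact ⟨2, by rw [Function.iterate_succ_apply, rot_orig_slot hs]; rfl⟩
        · exact ⟨1, rot_orig_toward hx hs⟩) hw hw'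
      exact ⟨k' + (l + k), by
        rw [Function.iterate_add_apply, Function.iterate_add_apply, hk, hl, hk']⟩
    | hub v hv =>
      rw [subgraph_adj_hub_iff hb, subgraph_adj_hub_iff hb']
      exact ⟨0, rfl⟩
    | rim v w hv hw =>
      obtain ⟨-, rfl | rfl⟩ := subgraph_adj_rim hb <;> obtain ⟨-, rfl | rfl⟩ := subgraph_adj_rim hb'
      · exact ⟨0, rfl⟩
      · exact ⟨1, rot_rim_orig hv hw⟩
      · exact ⟨1, rot_rim_port hv hw⟩
      · exact ⟨0, rfl⟩

/-- The faces of the modified embedding, at the ends of the edges of `H`. -/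
theorem faceOf_port {v w : V} (hw : I.H.Adj v w) :
    I.faceOf (I.port v w) (I.port w v) = I.emb.faceOf v w := by
  by_cases hv : I.IsWheel v
  · rw [port_wheel hv hw.adj_sub]
    exact if_neg (port_ne_orig hw.adj_sub.ne)
  · rw [← toward_eq_port hv, port_orig hv fun _ => hw]
    change I.emb.faceOf v (I.source v (I.toward v w)) = _
    rw [source_toward hw]

theorem faceOf_orig_toward {v w : V} (hw : I.H.Adj v w) :
    I.faceOf (.orig v) (I.toward v w) = I.emb.faceOf v w := by
  change I.emb.faceOf v (I.source v (I.toward v w)) = _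
  rw [source_toward hw]

theorem faceOf_toward {v w : V} (hw : I.H.Adj v w) :
    I.faceOf (I.toward v w) (.orig v) = I.emb.faceOf w v := by
  by_cases hv : I.IsWheel v
  · rw [toward_wheel hv hw.adj_sub]
    exact if_pos rfl
  · rw [toward_eq_port hv, ← faceOf_port hw.symm, port_orig hv fun _ => hw]

theorem emb_facial_walk {v w : V} (hw : I.H.Adj v w) :
    I.emb.faceOf v w = I.emb.faceOf (I.emb.rot v w) v := I.planar.facial_walk _ _ hw

theorem reduced_facial_walk [Finite V] {a b : I.Vert} (hab : I.subgraph.Adj a b) :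
    I.faceOf a b = I.faceOf (I.rot a b) a := by
  cases subgraphCorner hab with
  | orig_hub v h =>
    have hs := h.slot_spec.1
    rw [rot_orig_hub, faceOf_toward (I.emb_isRotation.adj hs), ← emb_facial_walk hs]
    rfl
  | orig_slot v h =>
    rw [rot_orig_slot h, faceOf_orig_toward h.slot_spec.1]
    rfl
  | orig_link v w hw hv hs =>
    rw [rot_orig_toward hw hs, faceOf_orig_toward hw, faceOf_toward (I.emb_isRotation.adj hw),
      ← emb_facial_walk hw]
  | orig_rim v w hv hw =>
    rw [rot_orig_toward hw hv.not_isHub_and, faceOf_orig_toward hw,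
      faceOf_toward (I.emb_isRotation.adj hw), ← emb_facial_walk hw]
  | hub v h => rfl
  | rim_orig v w h hw =>
    rw [rot_rim_orig, ← port_wheel h hw.adj_sub, faceOf_port hw.symm, port_wheel h hw.adj_sub]
    exact if_pos rfl
  | rim_port v w h hw =>
    rw [rot_rim_port, ← toward_wheel h hw.adj_sub, faceOf_orig_toward hw,
      toward_wheel h hw.adj_sub]
    exact if_neg (port_ne_orig hw.adj_sub.ne)

theorem reduced_covers_toward {v w : V} (hw : I.H.Adj v w) :
    I.subgraphContraction.Covers (E' := I.reduced.emb) (.orig v) (I.toward v w) w := by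
  have hc := covers_port (D := I.subgraphContraction) (E' := I.reduced.emb) hw
  change I.subgraphContraction.Covers (E' := I.reduced.emb) (I.port v w) (I.port w v) w at hc
  by_cases hv : I.IsWheel v
  · rw [toward_wheel hv hw.adj_sub]
    rw [port_wheel hv hw.adj_sub] at hc
    have hr : I.reduced.emb.rot (.rim v w hv hw.adj_sub) (I.port w v) = .orig v :=
      rot_rim_port hv hw.adj_sub
    have := hc.tree (by rw [hr]; exact (isTree_root rfl).symm)
    rwa [hr] at this
  · rwa [toward_eq_port hv, ← port_orig hv fun _ => hw]

theorem reduced_covers_hub [Finite V] {v : V} (h : I.IsHub v) :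
    I.subgraphContraction.Covers (E' := I.reduced.emb) (.hub v h) (.orig v) (I.slot v) := by
  have hr : I.reduced.emb.rot (.orig v) (I.toward v (I.slot v)) = .hub v h := rot_orig_slot h
  have := (reduced_covers_toward h.slot_spec.1).tree (by rw [hr]; exact isTree_root rfl)
  rwa [hr] at this

theorem reduced_covers_orig_hub [Finite V] {v : V} (h : I.IsHub v) :
    I.subgraphContraction.Covers (E' := I.reduced.emb) (.orig v) (.hub v h) (I.slot v) :=
  (reduced_covers_hub h).tree (isTree_root (D := I.subgraphContraction) rfl).symm

theorem reduced_covers_rim [Finite V] {v w : V} (h : I.IsWheel v) (hw : I.H.Adj v w) :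
    I.subgraphContraction.Covers (E' := I.reduced.emb)
      (.rim v (I.emb.rot v w) h (I.emb_isRotation.adj hw).adj_sub) (.orig v) w := by
  have hr : I.reduced.emb.rot (.orig v) (I.toward v w) =
      .rim v (I.emb.rot v w) h (I.emb_isRotation.adj hw).adj_sub := by
    rw [← toward_wheel h]
    exact rot_orig_toward hw h.not_isHub_and
  have := (reduced_covers_toward hw).tree (by rw [hr]; exact isTree_root rfl)
  rwa [hr] at this

theorem reduced_exists_covers [Finite V] {a b : I.Vert} (hab : I.subgraph.Adj a b) :
    ∃ w, I.subgraphContraction.Covers (E' := I.reduced.emb) a b w := by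
  cases subgraphCorner hab with
  | orig_hub v h => exact ⟨_, reduced_covers_orig_hub h⟩
  | orig_slot v h => exact ⟨_, reduced_covers_toward h.slot_spec.1⟩
  | orig_link v w hw hv hs => exact ⟨_, reduced_covers_toward hw⟩
  | orig_rim v w hv hw => exact ⟨_, reduced_covers_toward hw⟩
  | hub v h => exact ⟨_, reduced_covers_hub h⟩
  | rim_orig v w h hw =>
    obtain ⟨x, hx, rfl⟩ := I.emb_isRotation.exists_rot_eq hw
    exact ⟨_, reduced_covers_rim h hx⟩
  | rim_port v w h hw => exact ⟨_, .link (subgraph_adj_rim_port h hw) (by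
      change v ≠ base _
      rw [base_port]
      exact hw.adj_sub.ne)⟩

theorem subgraph_not_isDeleted {a b : I.Vert} (h : I.subgraph.Adj a b) :
    ¬ I.subgraphContraction.IsDeleted a b :=
  fun hd => hd.2 (subgraph_inner h hd.1.symm)

theorem reduced_rot_base [Finite V] {a b : I.Vert} {w : V}
    (hc : I.subgraphContraction.Covers (E' := I.reduced.emb) a b w)
    (hb : base a ≠ base (I.rot a b)) : I.emb.rot (base a) w = base (I.rot a b) := by
  have hR := I.reduced_isRotation
  have hab := hc.adj hR
  cases subgraphCorner hab with
  | orig_hub v h =>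
    rw [hc.unique hR (reduced_covers_orig_hub h), rot_orig_hub, toward_eq_port h.not_isWheel,
      base_port]
    rfl
  | orig_slot v h =>
    rw [rot_orig_slot h] at hb
    exact absurd rfl hb
  | orig_link v w' hw hv hs =>
    rw [hc.unique hR (reduced_covers_toward hw), rot_orig_toward hw hs, toward_eq_port hv,
      base_port]
    rfl
  | orig_rim v w' hv hw =>
    rw [rot_orig_toward hw hv.not_isHub_and,
      toward_wheel hv (I.emb_isRotation.adj hw).adj_sub] at hb
    exact absurd rfl hb
  | hub v h => exact absurd rfl hb
  | rim_orig v w' h hw =>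
    obtain ⟨x, hx, rfl⟩ := I.emb_isRotation.exists_rot_eq hw
    rw [hc.unique hR (reduced_covers_rim h hx), rot_rim_orig, base_port]
    rfl
  | rim_port v w' h hw =>
    rw [rot_rim_port] at hb
    exact absurd rfl hb

theorem reduced_isExpansion [Finite V] (I : PortInstance V) :
    I.subgraphContraction.IsExpansion I.reduced.emb I.emb id id where
  rot := reduced_rot_base
  face_port h := faceOf_port h
  face_root _ := rfl
  face_deleted h hd := absurd hd (subgraph_not_isDeleted (I.reduced_isRotation.adj h))
  isRotation := I.reduced_isRotation
  facial_walk := reduced_facial_walk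
  covers := reduced_exists_covers
  port_face h := faceOf_port h
  root_face _ := rfl
  new_face f := Or.inl ⟨f, rfl⟩
  empty_face _ f := ⟨f, rfl⟩

/-- Subdividing edges and adding pendant edges preserves planarity. -/
theorem reduced_isPlanar [Finite V] (I : PortInstance V) :
    IsPlanar (K := I.subgraph) I.reduced.emb :=
  I.reduced_isExpansion.isPlanar I.planar fun _ _ _ => ⟨0, fun _ _ h hd =>
    absurd hd (subgraph_not_isDeleted (I.reduced_isRotation.adj h))⟩

end PortInstance

/-! ### From the modified graph to the given graph -/

namespace EmbeddingData

variable {V : Type u} {G : SimpleGraph V} {E : EmbeddingData (⊤ : G.Subgraph)}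

theorem IsRotation.exists_first_return (hE : E.IsRotation) (H : G.Subgraph) {v w : V}
    (hw : H.Adj v w) : ∃ k : ℕ, H.Adj v ((E.rot v)^[k + 1] w) ∧
      ∀ j < k, ¬ H.Adj v ((E.rot v)^[j + 1] w) := by
  classical
  have hex : ∃ k : ℕ, H.Adj v ((E.rot v)^[k + 1] w) := by
    have hw' : (⊤ : G.Subgraph).Adj v w := hw.adj_sub
    obtain ⟨k, hk⟩ := hE.cyclic (hE.adj hw') hw'
    exact ⟨k, by rwa [Function.iterate_succ_apply, hk]⟩
  exact ⟨Nat.find hex, Nat.find_spec hex, fun j hj => Nat.find_min hex hj⟩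

theorem IsRotation.between_subset (hE : E.IsRotation) (H : G.Subgraph) {v w : V}
    (hw : H.Adj v w) : E.between H v w ⊆ G.neighborSet v \ H.neighborSet v := by
  rintro u ⟨k, rfl, hk⟩
  have hw' : (⊤ : G.Subgraph).Adj v w := hw.adj_sub
  exact ⟨hE.iterate hw' (k + 1), hk k le_rfl⟩

theorem IsRotation.ncard_between_le [Finite V] (hE : E.IsRotation) (H : G.Subgraph) {v w : V}
    (hw : H.Adj v w) : (E.between H v w).ncard + (H.neighborSet v).ncard ≤
      (G.neighborSet v).ncard := by
  have h1 := Set.ncard_le_ncard (hE.between_subset H hw)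
  have h2 := Set.ncard_sdiff_add_ncard_of_subset (H.neighborSet_subset v)
  omega

/-- The rotation at a vertex of degree four is a cycle of length four. -/
theorem IsRotation.four [Finite V] (hE : E.IsRotation) {v w : V}
    (h4 : (G.neighborSet v).ncard = 4) (hw : G.Adj v w) :
    (w ≠ E.rot v w ∧ w ≠ E.rot v (E.rot v w) ∧ w ≠ E.rot v (E.rot v (E.rot v w)) ∧
      E.rot v w ≠ E.rot v (E.rot v w) ∧ E.rot v w ≠ E.rot v (E.rot v (E.rot v w)) ∧
      E.rot v (E.rot v w) ≠ E.rot v (E.rot v (E.rot v w))) ∧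
    E.rot v (E.rot v (E.rot v (E.rot v w))) = w ∧
    ∀ x, G.Adj v x → x = w ∨ x = E.rot v w ∨ x = E.rot v (E.rot v w) ∨
      x = E.rot v (E.rot v (E.rot v w)) := by
  have hw0 : (⊤ : G.Subgraph).Adj v w := hw
  have hw1 := hE.adj hw0
  have hw2 := hE.adj hw1
  have hw3 := hE.adj hw2
  have hw4 := hE.adj hw3
  -- only sets that contain the whole neighbourhood are closed under the rotation
  have key : ∀ s : Set V, s.ncard < 4 → w ∈ s → (∀ x ∈ s, E.rot v x ∈ s) → False := by
    intro s hs hws hr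
    have : G.neighborSet v ⊆ s := fun x hx =>
      hE.induction (P := fun x => x ∈ s) hw0 hws (fun x _ => hr x) hx
    have := Set.ncard_le_ncard this (Set.toFinite _)
    omega
  have hc3 : ∀ x y z : V, ({x, y, z} : Set V).ncard < 4 := by
    intro x y z
    have h1 := Set.ncard_insert_le x {y, z}
    have h2 := Set.ncard_insert_le y {z}
    rw [Set.ncard_singleton] at h2
    omega
  have inj : ∀ {x y}, (⊤ : G.Subgraph).Adj v x → (⊤ : G.Subgraph).Adj v y →
      E.rot v x = E.rot v y → x = y := fun hx hy h => hE.rot_injective hx hy h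
  generalize e1 : E.rot v w = w1 at *
  generalize e2 : E.rot v w1 = w2 at *
  generalize e3 : E.rot v w2 = w3 at *
  generalize e4 : E.rot v w3 = w4 at *
  have n1 : w ≠ w1 := by
    intro h
    refine key {w, w, w} (hc3 _ _ _) (by simp) ?_
    simp [e1, ← h]
  have n2 : w ≠ w2 := by
    intro h
    refine key {w, w, w1} (hc3 _ _ _) (by simp) ?_
    simp [e1, e2, ← h]
  have n3 : w ≠ w3 := by
    intro h
    refine key {w, w1, w2} (hc3 _ _ _) (by simp) ?_
    simp [e1, e2, e3, ← h]
  have n12 : w1 ≠ w2 := fun h => n1 (inj hw0 hw1 (by rw [e1, e2, h]))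
  have n13 : w1 ≠ w3 := fun h => n2 (inj hw0 hw2 (by rw [e1, e3, h]))
  have n23 : w2 ≠ w3 := fun h => n12 (inj hw1 hw2 (by rw [e2, e3, h]))
  have hs : ({w, w1, w2, w3} : Set V).ncard = 4 := by
    rw [Set.ncard_insert_of_notMem (by simp [n1, n2, n3]),
      Set.ncard_insert_of_notMem (by simp [n12, n13]), Set.ncard_pair n23]
  have hsub : ({w, w1, w2, w3} : Set V) ⊆ G.neighborSet v := by
    rintro x (rfl | rfl | rfl | rfl)
    exacts [hw0, hw1, hw2, hw3]
  have heq := Set.eq_of_subset_of_ncard_le hsub (by omega) (Set.toFinite _)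
  have hall : ∀ x, G.Adj v x → x = w ∨ x = w1 ∨ x = w2 ∨ x = w3 := by
    intro x hx
    have : x ∈ ({w, w1, w2, w3} : Set V) := heq ▸ hx
    simpa using this
  refine ⟨⟨n1, n2, n3, n12, n13, n23⟩, ?_, hall⟩
  rcases hall w4 hw4 with h | h | h | h
  · exact h
  · exact absurd (inj hw3 hw0 (by rw [e4, e1, h])) n3.symm
  · exact absurd (inj hw3 hw1 (by rw [e4, e2, h])) n13.symm
  · exact absurd (inj hw3 hw2 (by rw [e4, e3, h])) n23.symm

/-- At a vertex of degree four, two of whose edges belong to `H`: if no two edges of `H` are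
consecutive, those of `H` alternate with the others. -/
theorem IsRotation.alternate [Finite V] (hE : E.IsRotation) {H : G.Subgraph} {v w : V}
    (h4 : (G.neighborSet v).ncard = 4) (h2 : (H.neighborSet v).ncard = 2)
    (hn : ∀ w, H.Adj v w → ¬ H.Adj v (E.rot v w)) (hw : H.Adj v w) :
    H.Adj v (E.rot v (E.rot v w)) := by
  obtain ⟨⟨n1, n2, n3, n12, n13, n23⟩, e4, hall⟩ := hE.four h4 hw.adj_sub
  obtain ⟨x, hx, hxw⟩ : ∃ x, H.Adj v x ∧ x ≠ w :=
    Set.exists_mem_notMem_of_ncard_lt_ncard (s := {w}) (t := H.neighborSet v)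
      (by rw [Set.ncard_singleton]; omega)
  rcases hall x hx.adj_sub with rfl | rfl | rfl | rfl
  · exact absurd rfl hxw
  · exact absurd hx (hn w hw)
  · exact hx
  · have := hn _ hx
    rw [e4] at this
    exact absurd hw this

theorem eq_or_eq_of_ncard_two [Finite V] {s : Set V} (h : s.ncard = 2) {x y z : V} (hx : x ∈ s)
    (hy : y ∈ s) (hxy : x ≠ y) (hz : z ∈ s) : z = x ∨ z = y := by
  have hsub : ({x, y} : Set V) ⊆ s := by
    rintro t (rfl | rfl)
    exacts [hx, hy]
  have heq := Set.eq_of_subset_of_ncard_le hsub (by rw [h, Set.ncard_pair hxy]) (Set.toFinite _)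
  rw [← heq] at hz
  simpa using hz

end EmbeddingData

namespace PortInstance

open EmbeddingData StarContraction

variable {V : Type u} {I : PortInstance V}

theorem emb_rot_eq_of_two [Finite V] {v x y : V} (h2 : (I.H.neighborSet v).ncard = 2)
    (hx : I.H.Adj v x) (hy : I.H.Adj v y) (hxy : x ≠ y) : I.emb.rot v x = y := by
  have hR := I.emb_isRotation
  rcases eq_or_eq_of_ncard_two h2 hx hy hxy (hR.adj hx) with h | h
  · refine absurd ?_ hxy.symm
    exact hR.induction (P := fun z => z = x) hx rfl (fun z _ hz => by rw [hz, h]) hy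
  · exact h

/-- The corners of the modified graph are contained in corners of the given graph. -/
theorem graph_exists_covers [Finite V] {E : EmbeddingData (⊤ : I.graph.Subgraph)}
    (hE : E.IsRotation) {a b : I.Vert} (hab : (⊤ : I.graph.Subgraph).Adj a b) :
    ∃ w, I.graphContraction.Covers E a b w := by
  refine exists_covers hE (fun a _ ha => ?_) hab
  cases a with
  | orig v => exact absurd rfl ha
  | hub v hv =>
    obtain ⟨w, hw, hw'⟩ := exists_not_adj hv.lt
    refine ⟨I.port w v, ?_, ?_⟩
    · rw [← port_hub hv hw']
      exact graph_adj_port hw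
    · change v ≠ base _
      rw [base_port]
      exact hw.ne
  | rim v w hv hw =>
    refine ⟨I.port w v, ?_, ?_⟩
    · rw [← port_wheel hv hw]
      exact graph_adj_port hw
    · change v ≠ base _
      rw [base_port]
      exact hw.ne

theorem graph_adj_orig {v : V} {b : I.Vert} (h : I.graph.Adj (.orig v) b) :
    (∃ hv, b = .hub v hv) ∨ (∃ w hv hw, b = .rim v w hv hw) ∨
      (I.G.Adj v (base b) ∧ ¬ I.IsWheel v ∧ (I.IsHub v → I.H.Adj v (base b)) ∧
        b = I.port (base b) v) := by
  by_cases hb : v = base b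
  · cases b with
    | orig w => cases hb; exact absurd rfl h.ne
    | hub w hw => cases hb; exact Or.inl ⟨hw, rfl⟩
    | rim w x hw hx => cases hb; exact Or.inr (Or.inl ⟨x, hw, hx, rfl⟩)
  · obtain ⟨h1, h2⟩ := graph_link h hb
    obtain ⟨-, h3⟩ := graph_link h.symm (Ne.symm hb)
    have h4 := eq_of_port_eq_orig h1 h2.symm
    exact Or.inr (Or.inr ⟨h1, h4.1, h4.2, h3⟩)

theorem graph_adj_hub_cases {v : V} {hv : I.IsHub v} {b : I.Vert}
    (h : I.graph.Adj (.hub v hv) b) :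
    b = .orig v ∨ (I.G.Adj v (base b) ∧ ¬ I.H.Adj v (base b) ∧ b = I.port (base b) v) := by
  by_cases hb : v = base b
  · rcases graph_inner h hb with h' | h' | ⟨_, _, _, _, _, _, h', -⟩
    · cases h'
    · exact Or.inl (by rw [h', ← hb])
    · cases h'
  · obtain ⟨h1, h2⟩ := graph_link h hb
    obtain ⟨-, h3⟩ := graph_link h.symm (Ne.symm hb)
    exact Or.inr ⟨h1, port_eq_hub h2.symm, h3⟩

theorem graph_adj_rim_cases {v w : V} {hv : I.IsWheel v} {hw : I.G.Adj v w} {b : I.Vert}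
    (h : I.graph.Adj (.rim v w hv hw) b) :
    b = .orig v ∨ b = I.port w v ∨ ∃ x hx, b = .rim v x hv hx ∧
      ¬ (I.H.Adj v w ↔ I.H.Adj v x) := by
  by_cases hb : v = base b
  · rcases graph_inner h hb with h' | h' | ⟨_, _, x, _, _, hx, h', h'', h3⟩
    · cases h'
    · exact Or.inl (by rw [h', ← hb])
    · cases h'
      exact Or.inr (Or.inr ⟨x, hx, h'', h3⟩)
  · obtain ⟨h1, h2⟩ := graph_link h hb
    obtain ⟨-, h3⟩ := graph_link h.symm (Ne.symm hb)
    simp only [base_rim] at h2 h3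
    rw [port_wheel hv h1] at h2
    cases h2
    exact Or.inr (Or.inl h3)

section Contract

variable {E' : EmbeddingData (⊤ : I.graph.Subgraph)}

/-- Where no gadget has been inserted, the rotation does not change. -/
theorem rot_contract_of_orig {v w : V} (hE' : E'.IsRotation) (h1 : ¬ I.IsHub v)
    (h2 : ¬ I.IsWheel v) (hw : I.G.Adj v w) :
    E'.rot (.orig v) (I.port w v) = I.port ((I.graphContraction.contract E').rot v w) v := by
  have hp : I.port v w = .orig v := port_orig h2 fun h => absurd h h1
  have hc : I.graphContraction.Covers E' (.orig v) (I.port w v) w := by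
    rw [← hp]
    exact covers_port (D := I.graphContraction) hw
  have hadj := hE'.adj (hc.adj hE')
  rcases graph_adj_orig hadj with ⟨h, -⟩ | ⟨-, h, -⟩ | ⟨h3, -, -, h4⟩
  · exact absurd h h1
  · exact absurd h h2
  · have := (contract_isContraction I.graphContraction E').rot hc h3.ne
    rw [show (I.graphContraction.contract E').rot v w = _ from this]
    exact h4

theorem subgraph_adj_orig_port {v u : V} :
    I.subgraph.Adj (.orig v) (I.port u v) → v ≠ u → I.H.Adj v u := by
  intro h hvu
  have := (subgraph_link h (by rw [base_port]; exact hvu)).1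
  rwa [base_port] at this

theorem extends_rot_of_orig [Finite V] {v w : V} (hE' : E'.IsRotation)
    (hext : E'.Extends I.reduced.emb) (h1 : ¬ I.IsHub v) (h2 : ¬ I.IsWheel v) (hw : I.H.Adj v w) :
    ∃ k : ℕ, ((I.graphContraction.contract E').rot v)^[k + 1] w = I.emb.rot v w ∧
      ∀ j < k, ¬ I.H.Adj v (((I.graphContraction.contract E').rot v)^[j + 1] w) := by
  have hadj : ∀ j : ℕ, I.G.Adj v (((I.graphContraction.contract E').rot v)^[j] w) := by
    intro j
    induction j with
    | zero => exact hw.adj_sub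
    | succ j ih =>
      rw [Function.iterate_succ_apply']
      exact contract_adj (K := (⊤ : I.G.Subgraph)) hE' ih
  have hit : ∀ j : ℕ, (E'.rot (.orig v))^[j] (I.port w v) =
      I.port (((I.graphContraction.contract E').rot v)^[j] w) v := by
    intro j
    induction j with
    | zero => rfl
    | succ j ih =>
      rw [Function.iterate_succ_apply', ih, Function.iterate_succ_apply',
        rot_contract_of_orig hE' h1 h2 (hadj j)]
  have hsub := subgraph_adj_toward hw
  rw [toward_eq_port h2] at hsub
  obtain ⟨k, hk, hk'⟩ := hext.1 _ _ hsub
  refine ⟨k, ?_, fun j hj h => hk' j hj ?_⟩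
  · have hr : I.reduced.emb.rot (.orig v) (I.port w v) = I.port (I.emb.rot v w) v := by
      rw [← toward_eq_port h2, ← toward_eq_port h2]
      exact rot_orig_toward hw fun h => h1 h.1
    rw [hit, hr] at hk
    simpa using congrArg base hk
  · rw [hit]
    have := subgraph_adj_toward h
    rwa [toward_eq_port h2] at this

/-- All edges at a hub belong to the modified subgraph. -/
theorem IsHub.subgraph_adj {v : V} (hv : I.IsHub v) {b : I.Vert} (hb : I.graph.Adj (.orig v) b) :
    I.subgraph.Adj (.orig v) b := by
  rcases graph_adj_orig hb with ⟨h, rfl⟩ | ⟨_, h, -⟩ | ⟨h1, h2, h3, h4⟩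
  · exact subgraph_adj_hub h
  · exact absurd hv h.not_isHub
  · rw [h4, ← toward_eq_port h2]
    exact subgraph_adj_toward (h3 hv)

theorem IsHub.rot_eq {v : V} (hE' : E'.IsRotation) (hext : E'.Extends I.reduced.emb)
    (hv : I.IsHub v) {b : I.Vert} (h : I.graph.Adj (.orig v) b) :
    E'.rot (.orig v) b = I.rot (.orig v) b := by
  obtain ⟨k, hk, hk'⟩ := hext.1 _ _ (hv.subgraph_adj h)
  rcases Nat.eq_zero_or_pos k with rfl | hpos
  · exact hk
  · exact absurd (hv.subgraph_adj (hE'.adj (K := (⊤ : I.graph.Subgraph)) h)) (hk' 0 hpos)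

theorem rot_contract_of_hub [Finite V] {v w : V} (hE' : E'.IsRotation)
    (hext : E'.Extends I.reduced.emb) (hv : I.IsHub v) (hw : I.H.Adj v w) (hs : w ≠ I.slot v) :
    (I.graphContraction.contract E').rot v w = I.emb.rot v w := by
  have hp : I.port v w = .orig v := port_orig hv.not_isWheel fun _ => hw
  have hc : I.graphContraction.Covers E' (.orig v) (I.toward v w) w := by
    rw [← hp, toward_eq_port hv.not_isWheel]
    exact covers_port (D := I.graphContraction) (show (⊤ : I.G.Subgraph).Adj v w from hw.adj_sub)
  have hr : E'.rot (.orig v) (I.toward v w) = I.port (I.emb.rot v w) v := by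
    rw [hv.rot_eq hE' hext (hc.adj hE'), rot_orig_toward hw fun h => hs h.2,
      toward_eq_port hv.not_isWheel]
  have := (contract_isContraction I.graphContraction E').rot hc (by
    rw [hr]
    change v ≠ base _
    rw [base_port]
    exact (I.emb_isRotation.adj hw).adj_sub.ne)
  rw [hr] at this
  exact this.trans (base_port _ _)

theorem covers_hub_slot [Finite V] {v : V} (hE' : E'.IsRotation)
    (hext : E'.Extends I.reduced.emb) (hv : I.IsHub v) :
    I.graphContraction.Covers E' (.hub v hv) (.orig v) (I.slot v) := by
  have hw := hv.slot_spec.1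
  have hp : I.port v (I.slot v) = .orig v := port_orig hv.not_isWheel fun _ => hw
  have hc : I.graphContraction.Covers E' (.orig v) (I.toward v (I.slot v)) (I.slot v) := by
    rw [toward_eq_port hv.not_isWheel]
    have := covers_port (D := I.graphContraction) (E' := E')
      (show (⊤ : I.G.Subgraph).Adj v (I.slot v) from hw.adj_sub)
    change I.graphContraction.Covers E' (I.port v (I.slot v)) _ _ at this
    rwa [hp] at this
  have hr : E'.rot (.orig v) (I.toward v (I.slot v)) = .hub v hv := by
    rw [hv.rot_eq hE' hext (hc.adj hE'), rot_orig_slot hv]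
  have := hc.tree (by rw [hr]; exact isTree_root rfl)
  rwa [hr] at this

/-- Turning around the vertex `hub v`, one meets edges outside `H`, and then the edge of `H` that
follows the sector with the free ports. -/
theorem rot_contract_of_covers_hub [Finite V] {v w : V} {b : I.Vert} (hE' : E'.IsRotation)
    (hext : E'.Extends I.reduced.emb) (hv : I.IsHub v)
    (hc : I.graphContraction.Covers E' (.hub v hv) b w) :
    (I.graphContraction.contract E').rot v w = I.emb.rot v (I.slot v) ∨
      (¬ I.H.Adj v ((I.graphContraction.contract E').rot v w) ∧
        ∃ b, I.graphContraction.Covers E' (.hub v hv) b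
          ((I.graphContraction.contract E').rot v w)) := by
  have hadj := hE'.adj (hc.adj hE')
  rcases graph_adj_hub_cases hadj with h | ⟨h1, h2, -⟩
  · left
    have hc' := hc.tree (by rw [h]; exact (isTree_root (D := I.graphContraction) rfl).symm)
    rw [h] at hc'
    have hr : E'.rot (.orig v) (.hub v hv) = I.port (I.emb.rot v (I.slot v)) v := by
      rw [hv.rot_eq hE' hext (graph_adj_hub hv), rot_orig_hub, toward_eq_port hv.not_isWheel]
    have := (contract_isContraction I.graphContraction E').rot hc' (by
      rw [hr]
      change v ≠ base _
      rw [base_port]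
      exact (I.emb_isRotation.adj hv.slot_spec.1).adj_sub.ne)
    rw [hr] at this
    exact this.trans (base_port _ _)
  · right
    have := (contract_isContraction I.graphContraction E').rot hc h1.ne
    rw [show (I.graphContraction.contract E').rot v w = _ from this]
    exact ⟨h2, _, .link hadj h1.ne⟩

theorem extends_rot_of_hub [Finite V] {v w : V} (hE' : E'.IsRotation)
    (hext : E'.Extends I.reduced.emb) (hv : I.IsHub v) (hw : I.H.Adj v w) :
    ∃ k : ℕ, ((I.graphContraction.contract E').rot v)^[k + 1] w = I.emb.rot v w ∧
      ∀ j < k, ¬ I.H.Adj v (((I.graphContraction.contract E').rot v)^[j + 1] w) := by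
  by_cases hs : w = I.slot v
  · subst hs
    have hR := contract_isRotation (D := I.graphContraction) hE' (graph_exists_covers hE')
    obtain ⟨k, hk, hk'⟩ := hR.exists_first_return I.H hw
    refine ⟨k, ?_, hk'⟩
    have hcov : ∀ j ≤ k, ∃ b, I.graphContraction.Covers E' (.hub v hv) b
        (((I.graphContraction.contract E').rot v)^[j] (I.slot v)) := by
      intro j
      induction j with
      | zero => exact fun _ => ⟨_, covers_hub_slot hE' hext hv⟩
      | succ j ih =>
        intro hj
        obtain ⟨b, hb⟩ := ih (by omega)
        have hj' := hk' j (by omega)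
        rw [Function.iterate_succ_apply'] at hj' ⊢
        rcases rot_contract_of_covers_hub hE' hext hv hb with h | h
        · rw [h] at hj'
          exact absurd (I.emb_isRotation.adj hw) hj'
        · exact h.2
    obtain ⟨b, hb⟩ := hcov k le_rfl
    rw [Function.iterate_succ_apply'] at hk ⊢
    rcases rot_contract_of_covers_hub hE' hext hv hb with h | h
    · exact h
    · exact absurd hk h.1
  · exact ⟨0, rot_contract_of_hub hE' hext hv hw hs, by simp⟩

/-- The rotation at the centre of a wheel: between two consecutive spokes `w` and `u` one turns
around `rim v w` to the centre, and then around `rim v u` to the edge that leaves the wheel. -/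
theorem rot_contract_of_wheel [Finite V] {v w : V} (hE' : E'.IsRotation) (hv : I.IsWheel v)
    (hw : I.G.Adj v w) :
    E'.rot (.orig v) (I.port v w) = I.port v ((I.graphContraction.contract E').rot v w) := by
  have hc := covers_port (D := I.graphContraction) (E' := E')
    (show (⊤ : I.G.Subgraph).Adj v w from hw)
  change I.graphContraction.Covers E' (I.port v w) (I.port w v) w at hc
  rw [port_wheel hv hw] at hc ⊢
  have hspoke : ∀ {u} (hu : I.G.Adj v u), (⊤ : I.graph.Subgraph).Adj (.rim v u hv hu) (.orig v) :=
    fun hu => (graph_adj_spoke hv hu).symm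
  obtain ⟨x, -, hx, hr⟩ := hE'.exists_before
    (P := fun y => I.graphContraction.Covers E' (.rim v w hv hw) y w) (hc.adj hE') hc
    (hspoke hw) (by
      intro y hy hcy hr
      by_cases hb : v = base (E'.rot (.rim v w hv hw) y)
      · exact hcy.step (by rintro ⟨⟩) hr hb
      · rcases graph_adj_rim_cases (hE'.adj hy) with h | h | ⟨z, hz, h, -⟩
        · exact absurd h hr
        · rwa [h]
        · rw [h] at hb
          exact absurd rfl hb)
  have hc2 := hx.tree (by rw [hr]; exact (isTree_root (D := I.graphContraction) rfl).symm)
  rw [hr] at hc2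
  have hadj := hE'.adj (hc2.adj hE')
  rcases graph_adj_orig hadj with ⟨h, -⟩ | ⟨u, _, hu, hru⟩ | ⟨-, h, -⟩
  · exact absurd h hv.not_isHub
  · have hc3 := hc2.tree (by rw [hru]; exact isTree_root (D := I.graphContraction) rfl)
    rw [hru] at hc3
    have hup : (⊤ : I.graph.Subgraph).Adj (.rim v u hv hu) (I.port u v) := by
      rw [← port_wheel hv hu]
      exact graph_adj_port hu
    obtain ⟨x, -, hx, hr⟩ := hE'.exists_before
      (P := fun y => I.graphContraction.Covers E' (.rim v u hv hu) y w) (hc3.adj hE') hc3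
      hup (by
        intro y hy hcy hr
        rcases graph_adj_rim_cases (hE'.adj hy) with h | h | ⟨z, hz, h, -⟩
        · rwa [h]
        · exact absurd h hr
        · exact hcy.step (by rintro ⟨⟩) (by rw [h]; rintro ⟨⟩) (by rw [h]; rfl))
    have := (contract_isContraction I.graphContraction E').rot hx (by
      rw [hr]
      change v ≠ base _
      rw [base_port]
      exact hu.ne)
    rw [hr] at this
    have hrot : (I.graphContraction.contract E').rot v w = u := this.trans (base_port _ _)
    rw [hru, hrot, port_wheel hv hu]
  · exact absurd hv h

/-- By planarity, no two edges of `H` are consecutive at the centre of a wheel: otherwise the four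
spokes have the order `w`, `w1`, `w2`, `w3` with `w`, `w1` in `H`, and the triangles over the rim
edges `w w2` and `w1 w3` cross. -/
theorem wheel_not_consecutive [Finite V] {v w : V} (hE' : E'.IsPlanar) (hv : I.IsWheel v)
    (hw : I.H.Adj v w) : ¬ I.H.Adj v ((I.graphContraction.contract E').rot v w) := by
  intro hw1
  have hE'R := hE'.isSurface.1
  have hR := contract_isRotation (D := I.graphContraction) hE'R (graph_exists_covers hE'R)
  obtain ⟨⟨n1, n2, n3, n12, n13, n23⟩, -, -⟩ := hR.four hv.2.1 hw.adj_sub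
  have hG0 : (⊤ : I.G.Subgraph).Adj v w := hw.adj_sub
  have hG1 := hR.adj hG0
  have hG2 := hR.adj hG1
  have hG3 := hR.adj hG2
  have r0 := rot_contract_of_wheel hE'R hv hG0
  have r1 := rot_contract_of_wheel hE'R hv hG1
  have r2 := rot_contract_of_wheel hE'R hv hG2
  generalize (I.graphContraction.contract E').rot v w = w1 at *
  generalize (I.graphContraction.contract E').rot v w1 = w2 at *
  generalize (I.graphContraction.contract E').rot v w2 = w3 at *
  have hH2 : ¬ I.H.Adj v w2 := by
    intro h
    rcases eq_or_eq_of_ncard_two hv.1 hw hw1 n1 h with h | h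
    · exact n2 h.symm
    · exact n12 h.symm
  have hH3 : ¬ I.H.Adj v w3 := by
    intro h
    rcases eq_or_eq_of_ncard_two hv.1 hw hw1 n1 h with h | h
    · exact n3 h.symm
    · exact n13 h.symm
  rw [port_wheel hv hG0, port_wheel hv hG1] at r0
  rw [port_wheel hv hG1, port_wheel hv hG2] at r1
  rw [port_wheel hv hG2, port_wheel hv hG3] at r2
  exact hE'.not_crossing (K := (⊤ : I.graph.Subgraph)) (graph_adj_spoke hv hG0)
    (graph_adj_spoke hv hG2) (graph_adj_rim hv hG0 hG2 (by tauto)) (graph_adj_spoke hv hG1)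
    (graph_adj_spoke hv hG3) (graph_adj_rim hv hG1 hG3 (by tauto)) (by simpa using n1)
    (by simpa using n3) (by simpa using n12.symm) (by simpa using n23) r0 r1 r2

theorem wheel_rot_rot [Finite V] {v w : V} (hE' : E'.IsPlanar) (hv : I.IsWheel v)
    (hw : I.H.Adj v w) :
    I.H.Adj v ((I.graphContraction.contract E').rot v
      ((I.graphContraction.contract E').rot v w)) := by
  have hE'R := hE'.isSurface.1
  have hR := contract_isRotation (D := I.graphContraction) hE'R (graph_exists_covers hE'R)
  exact hR.alternate hv.2.1 hv.1 (fun w hw => wheel_not_consecutive hE' hv hw) hw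

theorem extends_rot_of_wheel [Finite V] {v w : V} (hE' : E'.IsPlanar) (hv : I.IsWheel v)
    (hw : I.H.Adj v w) :
    ∃ k : ℕ, ((I.graphContraction.contract E').rot v)^[k + 1] w = I.emb.rot v w ∧
      ∀ j < k, ¬ I.H.Adj v (((I.graphContraction.contract E').rot v)^[j + 1] w) := by
  have hE'R := hE'.isSurface.1
  have hR := contract_isRotation (D := I.graphContraction) hE'R (graph_exists_covers hE'R)
  refine ⟨1, (emb_rot_eq_of_two hv.1 hw (wheel_rot_rot hE' hv hw)
    (hR.four hv.2.1 hw.adj_sub).1.2.1).symm, fun j hj => ?_⟩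
  obtain rfl : j = 0 := by omega
  exact wheel_not_consecutive hE' hv hw

theorem contract_extends [Finite V] (hE' : E'.IsPlanar) (hext : E'.Extends I.reduced.emb) :
    (I.graphContraction.contract E').Extends I.emb := by
  have hs := hE'.isSurface
  have hD := contract_isContraction I.graphContraction E'
  refine ⟨fun v w hw => ?_, ?_⟩
  · by_cases h1 : I.IsHub v
    · exact extends_rot_of_hub hs.1 hext h1 hw
    by_cases h2 : I.IsWheel v
    · exact extends_rot_of_wheel hE' h2 hw
    · exact extends_rot_of_orig hs.1 hext h1 h2 hw
  obtain ⟨π, hπ1, hπ2, hπ3, hπ4⟩ := hext.2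
  refine ⟨Quot.lift π ?_, ?_, ?_, ?_, hπ4⟩
  · rintro _ _ ⟨a, b, hab, hd, rfl, rfl⟩
    exact hπ1 a b hab fun h => subgraph_not_isDeleted h hd
  · intro v w hw hH
    obtain ⟨a, b, hab, rfl, hb⟩ := exists_covers_link (K := (⊤ : I.G.Subgraph))
      (D := I.graphContraction) hs.1 hw
    have hadj := hs.adj (hab.adj hs.1)
    rw [hD.rot hab hb] at hH ⊢
    rw [← hD.face hs hab, ← hD.face hs (.link hadj hb)]
    exact hπ1 a b (hab.adj hs.1) fun h => hH (subgraph_link h hb).1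
  · intro v w hw
    rw [← hD.face_port (K := (⊤ : I.G.Subgraph)) hw.adj_sub]
    exact (hπ2 _ _ (subgraph_adj_port hw)).trans (faceOf_port hw)
  · intro v hv hi w hvw
    have h1 : ¬ I.IsHub v := by
      intro h
      obtain ⟨x, hx⟩ := h.exists_adj
      exact hi x hx
    have h2 : ¬ I.IsWheel v := by
      intro h
      obtain ⟨x, hx⟩ := Set.nonempty_of_ncard_ne_zero
        (show (I.H.neighborSet v).ncard ≠ 0 by rw [h.1]; decide)
      exact hi x hx
    have hi' := I.subgraphContraction.isolated hi
    rcases hvw with hw | ⟨rfl, -, hi⟩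
    · rw [← hD.face_port hw]
      have hp : I.port v w = .orig v := port_orig h2 fun h => absurd h h1
      change π (E'.faceOf (I.port v w) (I.port w v)) = _
      have hadj := graph_adj_port (I := I) hw
      rw [hp] at hadj ⊢
      exact hπ3 (.orig v) hv hi' _ (Or.inl hadj)
    · rw [← hD.face_root hi]
      exact hπ3 (.orig v) hv hi' (.orig v) (Or.inr ⟨rfl, trivial, I.graphContraction.isolated hi⟩)

theorem hasPortExtension_of_hasExtension [Finite V] (h : I.reduced.HasExtension) :
    I.HasPortExtension := by
  obtain ⟨E', hE', hext⟩ := h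
  have hE'R : IsRotation (K := (⊤ : I.graph.Subgraph)) E' := hE'.isSurface.1
  have hR := contract_isRotation (D := I.graphContraction) hE'R (graph_exists_covers hE'R)
  refine ⟨I.graphContraction.contract E', contract_isPlanar hE' (graph_exists_covers hE'R),
    contract_extends hE' hext, fun v w hw => ?_⟩
  have hle := hR.ncard_between_le I.H hw
  by_cases h1 : I.IsHub v
  · by_cases hs : w = I.slot v
    · subst hs
      have := h1.P_eq.1
      have := I.degree_le v
      omega
    · have : (I.graphContraction.contract E').between I.H v w = ∅ := by
        refine Set.eq_empty_of_forall_notMem ?_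
        rintro u ⟨k, -, hk⟩
        refine hk 0 (Nat.zero_le _) ?_
        rw [Nat.zero_add, Function.iterate_one, rot_contract_of_hub hE'R hext h1 hw hs]
        exact I.emb_isRotation.adj hw
      rw [this, Set.ncard_empty]
      exact Nat.zero_le _
  by_cases h2 : I.IsWheel v
  · rw [h2.2.2 w hw, ← Set.ncard_singleton ((I.graphContraction.contract E').rot v w)]
    refine Set.ncard_le_ncard ?_
    rintro u ⟨k, rfl, hk⟩
    rcases Nat.eq_zero_or_pos k with rfl | hpos
    · rfl
    · exact absurd (wheel_rot_rot hE' h2 hw) (hk 1 hpos)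
  · have := le_P hw h1 h2
    omega

end Contract

end PortInstance

/-! ### From the given graph to the modified graph -/

namespace PortInstance

open EmbeddingData StarContraction

variable {V : Type u} {I : PortInstance V}

/-- A planar embedding of the given graph that extends the given embedding of the subgraph and
respects the port constraints. -/
structure IsSolution (I : PortInstance V) (E : EmbeddingData (⊤ : I.G.Subgraph)) : Prop where
  planar : E.IsPlanar
  ext : E.Extends I.emb
  ports : ∀ v w, I.H.Adj v w → (E.between I.H v w).ncard ≤ I.P v w

variable {E : EmbeddingData (⊤ : I.G.Subgraph)}

namespace IsSolution

theorem isRotation [Finite V] (h : I.IsSolution E) : E.IsRotation := h.planar.isSurface.1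

theorem rot_adj [Finite V] (h : I.IsSolution E) {v w : V} (hw : I.G.Adj v w) :
    I.G.Adj v (E.rot v w) :=
  h.isRotation.adj (K := (⊤ : I.G.Subgraph)) hw

theorem hub_adj_rot [Finite V] (h : I.IsSolution E) {v w : V} (hv : I.IsHub v)
    (hw : I.H.Adj v w) (hs : w ≠ I.slot v) : I.H.Adj v (E.rot v w) := by
  by_contra hn
  have h1 := h.ports v w hw
  rw [hv.P_eq.2 w hw hs] at h1
  have h2 := (Set.ncard_eq_zero (Set.toFinite _)).1 (Nat.le_zero.1 h1)
  have h3 : E.rot v w ∈ E.between I.H v w := by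
    refine ⟨0, rfl, fun j hj => ?_⟩
    obtain rfl : j = 0 := by omega
    exact hn
  rw [h2] at h3
  exact h3

theorem hub_rot [Finite V] (h : I.IsSolution E) {v w : V} (hv : I.IsHub v)
    (hw : I.H.Adj v w) (hs : w ≠ I.slot v) : E.rot v w = I.emb.rot v w := by
  obtain ⟨k, hk, hk'⟩ := h.ext.1 v w hw
  rcases Nat.eq_zero_or_pos k with rfl | hpos
  · exact hk
  · exact absurd (h.hub_adj_rot hv hw hs) (hk' 0 hpos)

theorem hub_rot_slot [Finite V] (h : I.IsSolution E) {v : V} (hv : I.IsHub v) :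
    ¬ I.H.Adj v (E.rot v (I.slot v)) := by
  intro hs
  obtain ⟨u, hu, hu'⟩ := exists_not_adj hv.lt
  refine hu' (h.isRotation.induction (P := fun x => I.H.Adj v x)
    (show (⊤ : I.G.Subgraph).Adj v (I.slot v) from hv.slot_spec.1.adj_sub) hv.slot_spec.1
    (fun w _ hw => ?_) hu)
  by_cases hws : w = I.slot v
  · rwa [hws]
  · exact h.hub_adj_rot hv hw hws

theorem hub_rot_last [Finite V] (h : I.IsSolution E) {v w : V} (hv : I.IsHub v)
    (hw : I.G.Adj v w) (hw' : ¬ I.H.Adj v w) (hr : I.H.Adj v (E.rot v w)) :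
    E.rot v w = I.emb.rot v (I.slot v) := by
  obtain ⟨x, hx, hxr⟩ := I.emb_isRotation.exists_rot_eq hr
  by_cases hxs : x = I.slot v
  · rw [← hxr, hxs]
  · rw [← h.hub_rot hv hx hxs] at hxr
    have := h.isRotation.rot_injective (K := (⊤ : I.G.Subgraph)) hx.adj_sub hw hxr
    exact absurd (this ▸ hx) hw'

theorem wheel_not_consecutive [Finite V] (h : I.IsSolution E) {v w : V} (hv : I.IsWheel v)
    (hw : I.H.Adj v w) : ¬ I.H.Adj v (E.rot v w) := by
  intro hw1
  obtain ⟨⟨n1, n2, n3, n12, n13, n23⟩, -, -⟩ := h.isRotation.four hv.2.1 hw.adj_sub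
  have hp := h.ports v _ hw1
  rw [hv.2.2 _ hw1] at hp
  have hH2 : ¬ I.H.Adj v (E.rot v (E.rot v w)) := by
    intro h
    rcases eq_or_eq_of_ncard_two hv.1 hw hw1 n1 h with h | h
    · exact n2 h.symm
    · exact n12 h.symm
  have hH3 : ¬ I.H.Adj v (E.rot v (E.rot v (E.rot v w))) := by
    intro h
    rcases eq_or_eq_of_ncard_two hv.1 hw hw1 n1 h with h | h
    · exact n3 h.symm
    · exact n13 h.symm
  have hsub : ({E.rot v (E.rot v w), E.rot v (E.rot v (E.rot v w))} : Set V) ⊆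
      E.between I.H v (E.rot v w) := by
    rintro x (rfl | rfl)
    · refine ⟨0, rfl, fun j hj => ?_⟩
      obtain rfl : j = 0 := by omega
      exact hH2
    · refine ⟨1, rfl, fun j hj => ?_⟩
      obtain rfl | rfl : j = 0 ∨ j = 1 := by omega
      · exact hH2
      · exact hH3
  have := Set.ncard_le_ncard hsub (Set.toFinite _)
  rw [Set.ncard_pair n23] at this
  omega

theorem wheel_rot_rot [Finite V] (h : I.IsSolution E) {v w : V} (hv : I.IsWheel v)
    (hw : I.H.Adj v w) : I.H.Adj v (E.rot v (E.rot v w)) :=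
  h.isRotation.alternate hv.2.1 hv.1 (fun _ hw => h.wheel_not_consecutive hv hw) hw

theorem wheel_four [Finite V] (h : I.IsSolution E) {v w : V} (hv : I.IsWheel v)
    (hw : I.G.Adj v w) : E.rot v (E.rot v (E.rot v (E.rot v w))) = w :=
  (h.isRotation.four hv.2.1 hw).2.1

theorem wheel_alternate [Finite V] (h : I.IsSolution E) {v w : V} (hv : I.IsWheel v)
    (hw : I.G.Adj v w) : ¬ (I.H.Adj v w ↔ I.H.Adj v (E.rot v w)) := by
  by_cases hH : I.H.Adj v w
  · have := h.wheel_not_consecutive hv hH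
    tauto
  · have : I.H.Adj v (E.rot v w) := by
      obtain ⟨x, hx⟩ := Set.nonempty_of_ncard_ne_zero
        (show (I.H.neighborSet v).ncard ≠ 0 by rw [hv.1]; decide)
      have hx : I.H.Adj v x := hx
      have hx2 := h.wheel_rot_rot hv hx
      rcases (h.isRotation.four hv.2.1 hx.adj_sub).2.2 w hw with rfl | rfl | rfl | rfl
      · exact absurd hx hH
      · exact hx2
      · exact absurd hx2 hH
      · rwa [h.wheel_four hv hx.adj_sub]
    tauto

theorem facial_walk (h : I.IsSolution E) {v w : V} (hw : I.G.Adj v w) :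
    E.faceOf v w = E.faceOf (E.rot v w) v :=
  h.planar.facial_walk v w hw

end IsSolution

open Classical in
/-- The neighbour of `v` to which the edge from `orig v` to a given vertex leads. -/
noncomputable def dest (v : V) : I.Vert → V
  | .orig w => w
  | .hub w _ => w
  | .rim x y _ _ => if x = v then y else x

theorem dest_port {v w : V} (h : I.G.Adj v w) : dest v (I.port w v) = w := by
  by_cases hw : I.IsWheel w
  · rw [port_wheel hw h.symm]
    exact if_neg h.ne'
  by_cases hw' : I.IsHub w ∧ ¬ I.H.Adj w v
  · rw [port_hub hw'.1 hw'.2]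
    rfl
  · rw [port_orig hw fun h => by tauto]
    rfl

theorem dest_rim {v w : V} (h : I.IsWheel v) (hw : I.G.Adj v w) : dest v (.rim v w h hw) = w :=
  if_pos rfl

open Classical in
/-- The edge of the given graph after which the corner of `hub v` behind `a` follows. -/
noncomputable def hubSource (v : V) (a : I.Vert) : V :=
  if a = .orig v then I.slot v else base a

theorem hubSource_orig (v : V) : hubSource (I := I) v (.orig v) = I.slot v := if_pos rfl

theorem hubSource_port {v w : V} (h : v ≠ w) : hubSource v (I.port w v) = w := by
  rw [hubSource, if_neg (port_ne_orig h), base_port]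

open Classical in
/-- The rotations of the modified graph: the edges to the vertex `hub v` or to the vertices
`rim v w` replace the edges of `v` that they carry, and the rim of a wheel runs around it.
The clockwise order at a vertex of the rim is: centre, previous vertex of the rim, edge that leaves
the wheel, next vertex of the rim. As the degree is four, the previous edge is the third one that
follows. -/
noncomputable def expandRot (E : EmbeddingData (⊤ : I.G.Subgraph)) : I.Vert → I.Vert → I.Vert
  | .orig v, a => if I.IsHub v then I.rot (.orig v) a else I.toward v (E.rot v (dest v a))
  | .hub v _, a =>
      if I.H.Adj v (E.rot v (hubSource v a)) then .orig v
      else I.port (E.rot v (hubSource v a)) v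
  | .rim v w _ _, a =>
      if a = .orig v then I.port v (E.rot v (E.rot v (E.rot v w)))
      else if a = I.port v (E.rot v (E.rot v (E.rot v w))) then I.port w v
      else if a = I.port w v then I.port v (E.rot v w)
      else .orig v

/-- The faces of the modified graph: those of the given graph and, in every wheel, a triangle
behind every spoke. -/
abbrev ExpandFace (E : EmbeddingData (⊤ : I.G.Subgraph)) : Type u :=
  E.Face ⊕ {x : V × V // I.IsWheel x.1 ∧ I.G.Adj x.1 x.2}

open Classical in
/-- The triangle in the wheel of `v` that follows the spoke belonging to the edge `vw`; the value is
irrelevant unless there is such a spoke. -/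
noncomputable def triangle (E : EmbeddingData (⊤ : I.G.Subgraph)) (v w : V) : ExpandFace E :=
  if h : I.IsWheel v ∧ I.G.Adj v w then .inr ⟨(v, w), h⟩ else .inl E.outer

open Classical in
/-- The faces at the corners of the modified graph. -/
noncomputable def expandFaceOf (E : EmbeddingData (⊤ : I.G.Subgraph)) :
    I.Vert → I.Vert → ExpandFace E
  | .orig v, .hub w _ =>
      if w = v then .inl (E.faceOf (I.emb.rot v (I.slot v)) v) else .inl (E.faceOf v w)
  | .orig v, a => if I.IsWheel v then triangle E v (dest v a) else .inl (E.faceOf v (dest v a))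
  | .hub v _, a => .inl (E.faceOf v (hubSource v a))
  | .rim v w _ _, a =>
      if a = .orig v then triangle E v (E.rot v (E.rot v (E.rot v w)))
      else if a = I.port v (E.rot v (E.rot v (E.rot v w))) then
        .inl (E.faceOf v (E.rot v (E.rot v (E.rot v w))))
      else if a = I.port w v then .inl (E.faceOf v w)
      else triangle E v w

/-- The embedding of the modified graph. -/
noncomputable def expand (E : EmbeddingData (⊤ : I.G.Subgraph)) :
    EmbeddingData (⊤ : I.graph.Subgraph) where
  rot := expandRot E
  Face := ExpandFace E
  faceOf := expandFaceOf E
  outer := .inl E.outer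

/-- The different kinds of corners of the modified graph. -/
inductive GraphCorner (E : EmbeddingData (⊤ : I.G.Subgraph)) : I.Vert → I.Vert → Prop
  | orig_hub (v : V) (h : I.IsHub v) : GraphCorner E (.orig v) (.hub v h)
  | orig_slot (v : V) (h : I.IsHub v) : GraphCorner E (.orig v) (I.port (I.slot v) v)
  | orig_side (v w : V) (h : I.IsHub v) (hw : I.H.Adj v w) (hs : w ≠ I.slot v) :
      GraphCorner E (.orig v) (I.port w v)
  | orig_link (v w : V) (h1 : ¬ I.IsHub v) (h2 : ¬ I.IsWheel v) (hw : I.G.Adj v w) :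
      GraphCorner E (.orig v) (I.port w v)
  | orig_rim (v w : V) (h : I.IsWheel v) (hw : I.G.Adj v w) :
      GraphCorner E (.orig v) (.rim v w h hw)
  | hub_orig (v : V) (h : I.IsHub v) : GraphCorner E (.hub v h) (.orig v)
  | hub_port (v w : V) (h : I.IsHub v) (hw : I.G.Adj v w) (hw' : ¬ I.H.Adj v w) :
      GraphCorner E (.hub v h) (I.port w v)
  | rim_orig (v w : V) (h : I.IsWheel v) (hw : I.G.Adj v w) (hr : I.G.Adj v (E.rot v w)) :
      GraphCorner E (.rim v (E.rot v w) h hr) (.orig v)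
  | rim_pred (v w : V) (h : I.IsWheel v) (hw : I.G.Adj v w) (hr : I.G.Adj v (E.rot v w)) :
      GraphCorner E (.rim v (E.rot v w) h hr) (.rim v w h hw)
  | rim_port (v w : V) (h : I.IsWheel v) (hw : I.G.Adj v w) (hr : I.G.Adj v (E.rot v w)) :
      GraphCorner E (.rim v w h hw) (I.port w v)
  | rim_succ (v w : V) (h : I.IsWheel v) (hw : I.G.Adj v w) (hr : I.G.Adj v (E.rot v w)) :
      GraphCorner E (.rim v w h hw) (.rim v (E.rot v w) h hr)

theorem IsSolution.corner [Finite V] (hE : I.IsSolution E) {a b : I.Vert}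
    (hab : I.graph.Adj a b) : GraphCorner E a b := by
  cases a with
  | orig v =>
    rcases graph_adj_orig hab with ⟨h, rfl⟩ | ⟨w, h, hw, rfl⟩ | ⟨h1, h2, h3, h4⟩
    · exact .orig_hub v h
    · exact .orig_rim v w h hw
    · rw [h4]
      by_cases hv : I.IsHub v
      · by_cases hs : base b = I.slot v
        · rw [hs]
          exact .orig_slot v hv
        · exact .orig_side v _ hv (h3 hv) hs
      · exact .orig_link v _ hv h2 h1
  | hub v h =>
    rcases graph_adj_hub_cases hab with rfl | ⟨h1, h2, h3⟩
    · exact .hub_orig v h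
    · rw [h3]
      exact .hub_port v _ h h1 h2
  | rim v w h hw =>
    have h4 := hE.wheel_four h hw
    have h1 := hE.rot_adj hw
    have h2 := hE.rot_adj h1
    have h3 := hE.rot_adj h2
    rcases graph_adj_rim_cases hab with rfl | rfl | ⟨x, hx, rfl, hHx⟩
    · have := GraphCorner.rim_orig (E := E) v _ h h3 (by rwa [h4])
      simpa only [h4] using this
    · exact .rim_port v w h hw h1
    · rcases (hE.isRotation.four h.2.1 hw).2.2 x hx with rfl | rfl | rfl | rfl
      · exact absurd Iff.rfl hHx
      · exact .rim_succ v w h hw h1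
      · have e1 := hE.wheel_alternate h hw
        have e2 := hE.wheel_alternate h h1
        exact absurd (by tauto) hHx
      · have := GraphCorner.rim_pred (E := E) v _ h h3 (by rwa [h4])
        simpa only [h4] using this

/-! #### Values of the rotations and faces -/

theorem expandRot_hub {v : V} (h : I.IsHub v) (a : I.Vert) :
    expandRot E (.orig v) a = I.rot (.orig v) a := if_pos h

theorem expandRot_orig_hub {v : V} (h : I.IsHub v) :
    expandRot E (.orig v) (.hub v h) = I.port (I.emb.rot v (I.slot v)) v := by
  rw [expandRot_hub h, rot_orig_hub, toward_eq_port h.not_isWheel]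

theorem expandRot_orig_slot [Finite V] {v : V} (h : I.IsHub v) :
    expandRot E (.orig v) (I.port (I.slot v) v) = .hub v h := by
  rw [expandRot_hub h, ← toward_eq_port h.not_isWheel, rot_orig_slot h]

theorem IsSolution.expandRot_orig_side [Finite V] (hE : I.IsSolution E) {v w : V} (h : I.IsHub v)
    (hw : I.H.Adj v w) (hs : w ≠ I.slot v) :
    expandRot E (.orig v) (I.port w v) = I.port (E.rot v w) v := by
  rw [expandRot_hub h, ← toward_eq_port h.not_isWheel, ← toward_eq_port h.not_isWheel,
    rot_orig_toward hw fun h => hs h.2, hE.hub_rot h hw hs]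

theorem expandRot_orig_link {v w : V} (h1 : ¬ I.IsHub v) (h2 : ¬ I.IsWheel v)
    (hw : I.G.Adj v w) : expandRot E (.orig v) (I.port w v) = I.port (E.rot v w) v := by
  rw [← toward_eq_port (w := E.rot v w) h2]
  refine (if_neg h1).trans ?_
  rw [dest_port hw]

theorem expandRot_orig_rim {v w : V} (h : I.IsWheel v) (hw : I.G.Adj v w)
    (hr : I.G.Adj v (E.rot v w)) :
    expandRot E (.orig v) (.rim v w h hw) = .rim v (E.rot v w) h hr := by
  refine (if_neg h.not_isHub).trans ?_
  rw [dest_rim, toward_wheel h hr]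

theorem IsSolution.expandRot_hub_orig [Finite V] (hE : I.IsSolution E) {v : V} (h : I.IsHub v) :
    expandRot E (.hub v h) (.orig v) = I.port (E.rot v (I.slot v)) v := by
  refine (if_neg ?_).trans ?_ <;> rw [hubSource_orig]
  exact hE.hub_rot_slot h

theorem expandRot_hub_port_of_adj {v w : V} (h : I.IsHub v) (hw : I.G.Adj v w)
    (hr : I.H.Adj v (E.rot v w)) : expandRot E (.hub v h) (I.port w v) = .orig v := by
  refine if_pos ?_
  rwa [hubSource_port hw.ne]

theorem expandRot_hub_port {v w : V} (h : I.IsHub v) (hw : I.G.Adj v w)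
    (hr : ¬ I.H.Adj v (E.rot v w)) :
    expandRot E (.hub v h) (I.port w v) = I.port (E.rot v w) v := by
  refine (if_neg ?_).trans ?_
  · rwa [hubSource_port hw.ne]
  · rw [hubSource_port hw.ne]

theorem IsSolution.expandRot_rim_orig [Finite V] (hE : I.IsSolution E) {v w : V}
    (h : I.IsWheel v) (hw : I.G.Adj v w) (hr : I.G.Adj v (E.rot v w)) :
    expandRot E (.rim v (E.rot v w) h hr) (.orig v) = .rim v w h hw := by
  simp only [expandRot, if_true, hE.wheel_four h hw, port_wheel h hw]

theorem IsSolution.expandRot_rim_pred [Finite V] (hE : I.IsSolution E) {v w : V}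
    (h : I.IsWheel v) (hw : I.G.Adj v w) (hr : I.G.Adj v (E.rot v w)) :
    expandRot E (.rim v (E.rot v w) h hr) (.rim v w h hw) = I.port (E.rot v w) v := by
  simp [expandRot, hE.wheel_four h hw, port_wheel h hw]

theorem rim_ne_port {v w x y : V} (h : I.IsWheel v) (hw : I.G.Adj v w) (hx : v ≠ x) :
    Vert.rim v w h hw ≠ I.port x y := by
  rw [← port_wheel h hw]
  exact I.port_ne hx

theorem expandRot_rim_port {v w : V} (h : I.IsWheel v) (hw : I.G.Adj v w)
    (hr : I.G.Adj v (E.rot v w)) :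
    expandRot E (.rim v w h hw) (I.port w v) = .rim v (E.rot v w) h hr := by
  simp only [expandRot, if_neg (port_ne_orig hw.ne), if_neg (I.port_ne hw.ne'), if_true,
    port_wheel h hr]

theorem IsSolution.expandRot_rim_succ [Finite V] (hE : I.IsSolution E) {v w : V}
    (h : I.IsWheel v) (hw : I.G.Adj v w) (hr : I.G.Adj v (E.rot v w)) :
    expandRot E (.rim v w h hw) (.rim v (E.rot v w) h hr) = .orig v := by
  have h3 := hE.rot_adj (hE.rot_adj hr)
  have n13 := (hE.isRotation.four h.2.1 hw).1.2.2.2.2.1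
  simp [expandRot, port_wheel h h3, n13, rim_ne_port h hr hw.ne]

theorem triangle_eq {v w : V} (h : I.IsWheel v) (hw : I.G.Adj v w) :
    triangle E v w = .inr ⟨(v, w), h, hw⟩ := dif_pos ⟨h, hw⟩

theorem expandFaceOf_orig_hub {v : V} (h : I.IsHub v) :
    expandFaceOf E (.orig v) (.hub v h) = .inl (E.faceOf (I.emb.rot v (I.slot v)) v) :=
  if_pos rfl

theorem expandFaceOf_orig_port {v w : V} (h : ¬ I.IsWheel v) (hw : I.G.Adj v w) :
    expandFaceOf E (.orig v) (I.port w v) = .inl (E.faceOf v w) := by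
  have hd := dest_port hw
  have hb := base_port (I := I) w v
  generalize I.port w v = a at hd hb
  cases a with
  | orig x =>
    rw [← hd]
    exact if_neg h
  | hub x hx =>
    cases hb
    exact if_neg hw.ne'
  | rim x y hx hy =>
    rw [← hd]
    exact if_neg h

theorem expandFaceOf_orig_rim {v w : V} (h : I.IsWheel v) (hw : I.G.Adj v w) :
    expandFaceOf E (.orig v) (.rim v w h hw) = triangle E v w := by
  refine (if_pos h).trans ?_
  rw [dest_rim]

theorem expandFaceOf_hub_orig {v : V} (h : I.IsHub v) :
    expandFaceOf E (.hub v h) (.orig v) = .inl (E.faceOf v (I.slot v)) := by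
  simp only [expandFaceOf, hubSource_orig]

theorem expandFaceOf_hub_port {v w : V} (h : I.IsHub v) (hw : I.G.Adj v w) :
    expandFaceOf E (.hub v h) (I.port w v) = .inl (E.faceOf v w) := by
  simp only [expandFaceOf, hubSource_port hw.ne]

theorem IsSolution.expandFaceOf_rim_orig [Finite V] (hE : I.IsSolution E) {v w : V}
    (h : I.IsWheel v) (hw : I.G.Adj v w) (hr : I.G.Adj v (E.rot v w)) :
    expandFaceOf E (.rim v (E.rot v w) h hr) (.orig v) = triangle E v w := by
  simp only [expandFaceOf, if_true, hE.wheel_four h hw]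

theorem IsSolution.expandFaceOf_rim_pred [Finite V] (hE : I.IsSolution E) {v w : V}
    (h : I.IsWheel v) (hw : I.G.Adj v w) (hr : I.G.Adj v (E.rot v w)) :
    expandFaceOf E (.rim v (E.rot v w) h hr) (.rim v w h hw) = .inl (E.faceOf v w) := by
  simp [expandFaceOf, hE.wheel_four h hw, port_wheel h hw]

theorem expandFaceOf_rim_port {v w : V} (h : I.IsWheel v) (hw : I.G.Adj v w) :
    expandFaceOf E (.rim v w h hw) (I.port w v) = .inl (E.faceOf v w) := by
  simp only [expandFaceOf, if_neg (port_ne_orig hw.ne), if_neg (I.port_ne hw.ne'), if_true]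

theorem IsSolution.expandFaceOf_rim_succ [Finite V] (hE : I.IsSolution E) {v w : V}
    (h : I.IsWheel v) (hw : I.G.Adj v w) (hr : I.G.Adj v (E.rot v w)) :
    expandFaceOf E (.rim v w h hw) (.rim v (E.rot v w) h hr) = triangle E v w := by
  have h3 := hE.rot_adj (hE.rot_adj hr)
  have n13 := (hE.isRotation.four h.2.1 hw).1.2.2.2.2.1
  simp [expandFaceOf, port_wheel h h3, n13, rim_ne_port h hr hw.ne]

/-- The faces of the modified graph at the ends of the edges of the given graph. -/
theorem expandFaceOf_port {v w : V} (hw : I.G.Adj v w) :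
    expandFaceOf E (I.port v w) (I.port w v) = .inl (E.faceOf v w) := by
  by_cases hv : I.IsWheel v
  · rw [port_wheel hv hw, expandFaceOf_rim_port]
  by_cases hv' : I.IsHub v ∧ ¬ I.H.Adj v w
  · rw [port_hub hv'.1 hv'.2, expandFaceOf_hub_port _ hw]
  · rw [port_orig hv fun h => by tauto, expandFaceOf_orig_port hv hw]

end PortInstance

/-! ### Planarity of the embedding of the modified graph -/

namespace PortInstance

open EmbeddingData StarContraction

variable {V : Type u} {I : PortInstance V} {E : EmbeddingData (⊤ : I.G.Subgraph)}

/-- Collapsing all edges of `H` at a hub to one, the edges at `hub v` are met in the order of the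
rotation at `v`. -/
theorem IsSolution.cyclic_hub [Finite V] (hE : I.IsSolution E) {v : V} (h : I.IsHub v)
    {b b' : I.Vert} (hb : I.graph.Adj (.hub v h) b) (hb' : I.graph.Adj (.hub v h) b') :
    ∃ k : ℕ, (expandRot E (.hub v h))^[k] b = b' := by
  classical
  let f : V → I.Vert := fun w => if I.H.Adj v w then .orig v else I.port w v
  have hf1 : ∀ {w}, I.H.Adj v w → f w = .orig v := fun h => if_pos h
  have hf2 : ∀ {w}, ¬ I.H.Adj v w → f w = I.port w v := fun h => if_neg h
  have hsurj : ∀ {b}, I.graph.Adj (.hub v h) b → ∃ w, I.G.Adj v w ∧ f w = b := by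
    intro b hb
    rcases graph_adj_hub_cases hb with rfl | ⟨h1, h2, h3⟩
    · exact ⟨_, h.slot_spec.1.adj_sub, hf1 h.slot_spec.1⟩
    · exact ⟨_, h1, (hf2 h2).trans h3.symm⟩
  obtain ⟨w, hw, rfl⟩ := hsurj hb
  obtain ⟨w', hw', rfl⟩ := hsurj hb'
  refine hE.isRotation.reach_of_map (K := (⊤ : I.G.Subgraph)) (expandRot E (.hub v h)) f ?_ hw hw'
  intro x hx
  have hx : I.G.Adj v x := hx
  by_cases hHx : I.H.Adj v x
  · rw [hf1 hHx]
    by_cases hs : x = I.slot v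
    · subst hs
      rw [hf2 (hE.hub_rot_slot h)]
      exact ⟨1, hE.expandRot_hub_orig h⟩
    · rw [hf1 (hE.hub_adj_rot h hHx hs)]
      exact ⟨0, rfl⟩
  · rw [hf2 hHx]
    by_cases hr : I.H.Adj v (E.rot v x)
    · rw [hf1 hr]
      exact ⟨1, expandRot_hub_port_of_adj h hx hr⟩
    · rw [hf2 hr]
      exact ⟨1, expandRot_hub_port h hx hr⟩

theorem IsSolution.cyclic_orig [Finite V] (hE : I.IsSolution E) {v : V} {b b' : I.Vert}
    (hb : I.graph.Adj (.orig v) b) (hb' : I.graph.Adj (.orig v) b') :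
    ∃ k : ℕ, (expandRot E (.orig v))^[k] b = b' := by
  by_cases h : I.IsHub v
  · rw [show expandRot E (.orig v) = I.rot (.orig v) from funext (expandRot_hub h)]
    exact I.reduced_isRotation.cyclic (h.subgraph_adj hb) (h.subgraph_adj hb')
  have hsurj : ∀ {b}, I.graph.Adj (.orig v) b → ∃ w, I.G.Adj v w ∧ I.toward v w = b := by
    intro b hb
    rcases graph_adj_orig hb with ⟨h', -⟩ | ⟨w, hv, hw, rfl⟩ | ⟨h1, h2, -, h4⟩
    · exact absurd h' h
    · exact ⟨w, hw, toward_wheel hv hw⟩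
    · exact ⟨_, h1, (toward_eq_port h2).trans h4.symm⟩
  obtain ⟨w, hw, rfl⟩ := hsurj hb
  obtain ⟨w', hw', rfl⟩ := hsurj hb'
  refine hE.isRotation.reach_of_map (K := (⊤ : I.G.Subgraph)) (expandRot E (.orig v))
    (I.toward v) ?_ hw hw'
  intro x hx
  have hx : I.G.Adj v x := hx
  refine ⟨1, ?_⟩
  by_cases hv : I.IsWheel v
  · rw [toward_wheel hv hx, toward_wheel hv (hE.rot_adj hx)]
    exact expandRot_orig_rim hv hx (hE.rot_adj hx)
  · rw [toward_eq_port hv, toward_eq_port hv]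
    exact expandRot_orig_link h hv hx

theorem IsSolution.cyclic_rim [Finite V] (hE : I.IsSolution E) {v w : V} (h : I.IsWheel v)
    (hw : I.G.Adj v w) (hr : I.G.Adj v (E.rot v w)) {b b' : I.Vert}
    (hb : I.graph.Adj (.rim v (E.rot v w) h hr) b)
    (hb' : I.graph.Adj (.rim v (E.rot v w) h hr) b') :
    ∃ k : ℕ, (expandRot E (.rim v (E.rot v w) h hr))^[k] b = b' := by
  have hr' := hE.rot_adj hr
  have e1 := hE.expandRot_rim_orig h hw hr
  have e2 := hE.expandRot_rim_pred h hw hr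
  have e3 := expandRot_rim_port h hr hr'
  have e4 := hE.expandRot_rim_succ h hr hr'
  have hsurj : ∀ {b}, I.graph.Adj (.rim v (E.rot v w) h hr) b → b = .orig v ∨
      b = .rim v w h hw ∨ b = I.port (E.rot v w) v ∨ b = .rim v (E.rot v (E.rot v w)) h hr' := by
    intro b hb
    rcases graph_adj_rim_cases hb with rfl | rfl | ⟨x, hx, rfl, hHx⟩
    · exact Or.inl rfl
    · exact Or.inr (Or.inr (Or.inl rfl))
    · rcases (hE.isRotation.four h.2.1 hw).2.2 x hx with rfl | rfl | rfl | rfl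
      · exact Or.inr (Or.inl rfl)
      · exact absurd Iff.rfl hHx
      · exact Or.inr (Or.inr (Or.inr rfl))
      · have a1 := hE.wheel_alternate h hr
        have a2 := hE.wheel_alternate h hr'
        exact absurd (by tauto) hHx
  have hto : ∃ k : ℕ, (expandRot E (.rim v (E.rot v w) h hr))^[k] b = .orig v := by
    rcases hsurj hb with rfl | rfl | rfl | rfl
    · exact ⟨0, rfl⟩
    · exact ⟨3, by simp [e2, e3, e4]⟩
    · exact ⟨2, by simp [e3, e4]⟩
    · exact ⟨1, by simp [e4]⟩
  have hfrom : ∃ k : ℕ, (expandRot E (.rim v (E.rot v w) h hr))^[k] (.orig v) = b' := by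
    rcases hsurj hb' with rfl | rfl | rfl | rfl
    · exact ⟨0, rfl⟩
    · exact ⟨1, by simp [e1]⟩
    · exact ⟨2, by simp [e1, e2]⟩
    · exact ⟨3, by simp [e1, e2, e3]⟩
  obtain ⟨k, hk⟩ := hto
  obtain ⟨l, hl⟩ := hfrom
  exact ⟨l + k, by rw [Function.iterate_add_apply, hk, hl]⟩

theorem IsSolution.graph_adj_rim_succ [Finite V] (hE : I.IsSolution E) {v w : V}
    (h : I.IsWheel v) (hw : I.G.Adj v w) (hr : I.G.Adj v (E.rot v w)) :
    I.graph.Adj (.rim v w h hw) (.rim v (E.rot v w) h hr) :=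
  graph_adj_rim h hw hr (hE.wheel_alternate h hw)

theorem graph_adj_rim_port {v w : V} (h : I.IsWheel v) (hw : I.G.Adj v w) :
    I.graph.Adj (.rim v w h hw) (I.port w v) := by
  rw [← port_wheel h hw]
  exact graph_adj_port hw

theorem graph_adj_hub_port {v w : V} (h : I.IsHub v) (hw : I.G.Adj v w) (hw' : ¬ I.H.Adj v w) :
    I.graph.Adj (.hub v h) (I.port w v) := by
  rw [← port_hub h hw']
  exact graph_adj_port hw

theorem graph_adj_orig_port {v w : V} (hv : ¬ I.IsWheel v) (hw : I.G.Adj v w)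
    (h : I.IsHub v → I.H.Adj v w) : I.graph.Adj (.orig v) (I.port w v) := by
  rw [← port_orig hv h]
  exact graph_adj_port hw

theorem IsSolution.expand_isRotation [Finite V] (hE : I.IsSolution E) :
    (expand E).IsRotation where
  adj {a b} hab := by
    change I.graph.Adj a (expandRot E a b)
    cases hE.corner hab with
    | orig_hub v h =>
      rw [expandRot_orig_hub]
      have := I.emb_isRotation.adj h.slot_spec.1
      exact graph_adj_orig_port h.not_isWheel this.adj_sub fun _ => this
    | orig_slot v h =>
      rw [expandRot_orig_slot h]
      exact graph_adj_hub h
    | orig_side v w h hw hs =>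
      rw [hE.expandRot_orig_side h hw hs]
      exact graph_adj_orig_port h.not_isWheel (hE.rot_adj hw.adj_sub)
        fun _ => hE.hub_adj_rot h hw hs
    | orig_link v w h1 h2 hw =>
      rw [expandRot_orig_link h1 h2 hw]
      exact graph_adj_orig_port h2 (hE.rot_adj hw) fun h => absurd h h1
    | orig_rim v w h hw =>
      rw [expandRot_orig_rim h hw (hE.rot_adj hw)]
      exact graph_adj_spoke h _
    | hub_orig v h =>
      rw [hE.expandRot_hub_orig]
      exact graph_adj_hub_port h (hE.rot_adj h.slot_spec.1.adj_sub) (hE.hub_rot_slot h)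
    | hub_port v w h hw hw' =>
      by_cases hr : I.H.Adj v (E.rot v w)
      · rw [expandRot_hub_port_of_adj h hw hr]
        exact (graph_adj_hub h).symm
      · rw [expandRot_hub_port h hw hr]
        exact graph_adj_hub_port h (hE.rot_adj hw) hr
    | rim_orig v w h hw hr =>
      rw [hE.expandRot_rim_orig h hw hr]
      exact (hE.graph_adj_rim_succ h hw hr).symm
    | rim_pred v w h hw hr =>
      rw [hE.expandRot_rim_pred h hw hr]
      exact graph_adj_rim_port h hr
    | rim_port v w h hw hr =>
      rw [expandRot_rim_port h hw hr]
      exact hE.graph_adj_rim_succ h hw hr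
    | rim_succ v w h hw hr =>
      rw [hE.expandRot_rim_succ h hw hr]
      exact (graph_adj_spoke h hw).symm
  cyclic {a b b'} hb hb' := by
    cases a with
    | orig v => exact hE.cyclic_orig hb hb'
    | hub v h => exact hE.cyclic_hub h hb hb'
    | rim v w h hw =>
      obtain ⟨x, hx, rfl⟩ := hE.isRotation.exists_rot_eq (K := (⊤ : I.G.Subgraph)) hw
      exact hE.cyclic_rim h hx hw hb hb'

/-- The face behind the edge `vw` is also the one at the other end of the next edge. -/
theorem IsSolution.faceOf_next [Finite V] (hE : I.IsSolution E) {v w : V} (hw : I.G.Adj v w) :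
    (.inl (E.faceOf v w) : ExpandFace E) =
      expandFaceOf E (I.port (E.rot v w) v) (I.port v (E.rot v w)) := by
  rw [expandFaceOf_port (hE.rot_adj hw).symm, hE.facial_walk hw]

theorem IsSolution.expand_facial_walk [Finite V] (hE : I.IsSolution E) {a b : I.Vert}
    (hab : I.graph.Adj a b) : expandFaceOf E a b = expandFaceOf E (expandRot E a b) a := by
  cases hE.corner hab with
  | orig_hub v h =>
    have := I.emb_isRotation.adj h.slot_spec.1
    rw [expandRot_orig_hub, expandFaceOf_orig_hub, ← expandFaceOf_port this.adj_sub.symm,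
      port_orig h.not_isWheel fun _ => this]
  | orig_slot v h =>
    rw [expandRot_orig_slot h, expandFaceOf_orig_port h.not_isWheel h.slot_spec.1.adj_sub,
      expandFaceOf_hub_orig]
  | orig_side v w h hw hs =>
    rw [hE.expandRot_orig_side h hw hs, expandFaceOf_orig_port h.not_isWheel hw.adj_sub,
      hE.faceOf_next hw.adj_sub, port_orig h.not_isWheel fun _ => hE.hub_adj_rot h hw hs]
  | orig_link v w h1 h2 hw =>
    rw [expandRot_orig_link h1 h2 hw, expandFaceOf_orig_port h2 hw, hE.faceOf_next hw,
      port_orig h2 fun h => absurd h h1]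
  | orig_rim v w h hw =>
    rw [expandRot_orig_rim h hw (hE.rot_adj hw), expandFaceOf_orig_rim,
      hE.expandFaceOf_rim_orig h hw]
  | hub_orig v h =>
    rw [hE.expandRot_hub_orig, expandFaceOf_hub_orig, hE.faceOf_next h.slot_spec.1.adj_sub,
      port_hub h (hE.hub_rot_slot h)]
  | hub_port v w h hw hw' =>
    by_cases hr : I.H.Adj v (E.rot v w)
    · rw [expandRot_hub_port_of_adj h hw hr, expandFaceOf_hub_port h hw, expandFaceOf_orig_hub,
        ← hE.hub_rot_last h hw hw' hr, hE.facial_walk hw]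
    · rw [expandRot_hub_port h hw hr, expandFaceOf_hub_port h hw, hE.faceOf_next hw,
        port_hub h hr]
  | rim_orig v w h hw hr =>
    rw [hE.expandRot_rim_orig h hw hr, hE.expandFaceOf_rim_orig h hw, hE.expandFaceOf_rim_succ h hw]
  | rim_pred v w h hw hr =>
    rw [hE.expandRot_rim_pred h hw hr, hE.expandFaceOf_rim_pred h hw, hE.faceOf_next hw,
      port_wheel h hr]
  | rim_port v w h hw hr =>
    rw [expandRot_rim_port h hw hr, expandFaceOf_rim_port, hE.expandFaceOf_rim_pred h hw]
  | rim_succ v w h hw hr =>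
    rw [hE.expandRot_rim_succ h hw hr, hE.expandFaceOf_rim_succ h hw, expandFaceOf_orig_rim]

/-- The face of the given graph in which a face of the modified graph lies. -/
def collapse (E : EmbeddingData (⊤ : I.G.Subgraph)) : ExpandFace E → E.Face :=
  Sum.elim id fun x => E.faceOf x.1.1 x.1.2

theorem collapse_inl (f : E.Face) : collapse E (.inl f) = f := rfl

theorem collapse_triangle {v w : V} (h : I.IsWheel v) (hw : I.G.Adj v w) :
    collapse E (triangle E v w) = E.faceOf v w := by
  rw [triangle_eq h hw]
  rfl

/-- The edges that are deleted from the modified graph are those of the rims. -/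
theorem IsSolution.deleted_cases [Finite V] (hE : I.IsSolution E) {a b : I.Vert}
    (hab : I.graph.Adj a b) (hd : I.graphContraction.IsDeleted a (expandRot E a b)) :
    ∃ v w, ∃ (h : I.IsWheel v) (hw : I.G.Adj v w) (hr : I.G.Adj v (E.rot v w)),
      (a = .rim v (E.rot v w) h hr ∧ b = .orig v) ∨ (a = .rim v w h hw ∧ b = I.port w v) := by
  have horig : ∀ {v c}, ¬ I.graphContraction.IsDeleted (.orig v) c := fun h => h.2 (Or.inl rfl)
  have hto : ∀ {a v}, ¬ I.graphContraction.IsDeleted a (.orig v) := fun h => h.2 (Or.inr rfl)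
  have hport : ∀ {a v w}, base a ≠ w → ¬ I.graphContraction.IsDeleted a (I.port w v) := by
    intro a v w hne h
    exact hne (h.1.symm.trans (base_port _ _))
  cases hE.corner hab with
  | orig_hub v h => exact absurd hd horig
  | orig_slot v h => exact absurd hd horig
  | orig_side v w h hw hs => exact absurd hd horig
  | orig_link v w h1 h2 hw => exact absurd hd horig
  | orig_rim v w h hw => exact absurd hd horig
  | hub_orig v h =>
    rw [hE.expandRot_hub_orig] at hd
    exact absurd hd (hport (hE.rot_adj h.slot_spec.1.adj_sub).ne)
  | hub_port v w h hw hw' =>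
    by_cases hr : I.H.Adj v (E.rot v w)
    · rw [expandRot_hub_port_of_adj h hw hr] at hd
      exact absurd hd hto
    · rw [expandRot_hub_port h hw hr] at hd
      exact absurd hd (hport (hE.rot_adj hw).ne)
  | rim_orig v w h hw hr => exact ⟨v, w, h, hw, hr, Or.inl ⟨rfl, rfl⟩⟩
  | rim_pred v w h hw hr =>
    rw [hE.expandRot_rim_pred h hw hr] at hd
    exact absurd hd (hport hr.ne)
  | rim_port v w h hw hr => exact ⟨v, w, h, hw, hr, Or.inr ⟨rfl, rfl⟩⟩
  | rim_succ v w h hw hr =>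
    rw [hE.expandRot_rim_succ h hw hr] at hd
    exact absurd hd hto

theorem IsSolution.expand_rot_base [Finite V] (hE : I.IsSolution E) {a b : I.Vert} {w : V}
    (hc : I.graphContraction.Covers (expand E) a b w) (hb : base a ≠ base (expandRot E a b)) :
    E.rot (base a) w = base (expandRot E a b) := by
  have hR := hE.expand_isRotation
  have hab := hc.adj hR
  have hlink : ∀ {a v w u}, I.graphContraction.Covers (expand E) a (I.port w v) u → base a = v →
      v ≠ w → u = w := by
    intro a v w u hc ha hne
    refine (hc.link_eq ?_).trans (base_port _ _)
    change base a ≠ base _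
    rw [base_port, ha]
    exact hne
  -- turning clockwise around a wheel from the edge `vw`, one passes the rim edge, the spokes to `w`
  -- and to the next vertex, and the rim edge again
  have hsucc : ∀ {v w} (h : I.IsWheel v) (hw : I.G.Adj v w) (hr : I.G.Adj v (E.rot v w)),
      I.graphContraction.Covers (expand E) (.rim v (E.rot v w) h hr) (.rim v w h hw) w := by
    intro v w h hw hr
    have c1 : I.graphContraction.Covers (expand E) (.rim v w h hw) (I.port w v) w := by
      have := covers_port (D := I.graphContraction) (E' := expand E)
        (show (⊤ : I.G.Subgraph).Adj v w from hw)
      rw [← port_wheel h hw]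
      exact this
    have r1 : (expand E).rot (.rim v w h hw) (I.port w v) = _ := expandRot_rim_port h hw hr
    have c2 := c1.step (by rintro ⟨⟩) (by rw [r1]; rintro ⟨⟩) (by rw [r1]; rfl)
    rw [r1] at c2
    have r2 : (expand E).rot (.rim v w h hw) (.rim v _ h hr) = _ := hE.expandRot_rim_succ h hw hr
    have c3 := c2.tree (by rw [r2]; exact (isTree_root (D := I.graphContraction) rfl).symm)
    rw [r2] at c3
    have r3 : (expand E).rot (.orig v) (.rim v w h hw) = _ := expandRot_orig_rim h hw hr
    have c4 := c3.tree (by rw [r3]; exact isTree_root (D := I.graphContraction) rfl)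
    rw [r3] at c4
    have r4 : (expand E).rot (.rim v _ h hr) (.orig v) = _ := hE.expandRot_rim_orig h hw hr
    have c5 := c4.step (by rintro ⟨⟩) (by rw [r4]; rintro ⟨⟩) (by rw [r4]; rfl)
    rwa [r4] at c5
  cases hE.corner hab with
  | orig_hub v h =>
    rw [expandRot_orig_hub, base_port]
    obtain ⟨x, hx, hxr⟩ := hR.exists_rot_eq (K := (⊤ : I.graph.Subgraph)) (graph_adj_hub h).symm
    obtain ⟨u, hu⟩ := graph_exists_covers hR hx
    have hu' := hu.tree (by rw [hxr]; exact (isTree_root (D := I.graphContraction) rfl).symm)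
    rw [hxr] at hu'
    rw [hc.unique hR hu']
    have hxr : expandRot E (.hub v h) x = .orig v := hxr
    rcases graph_adj_hub_cases hx with rfl | ⟨h1, h2, h3⟩
    · rw [hE.expandRot_hub_orig] at hxr
      exact absurd hxr (port_ne_orig (hE.rot_adj h.slot_spec.1.adj_sub).ne)
    · rw [h3] at hxr hu
      rw [hlink hu rfl h1.ne]
      have hr : I.H.Adj v (E.rot v (base x)) := by
        by_contra hr
        rw [expandRot_hub_port h h1 hr] at hxr
        exact port_ne_orig (hE.rot_adj h1).ne hxr
      exact hE.hub_rot_last h h1 h2 hr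
  | orig_slot v h =>
    rw [expandRot_orig_slot h] at hb
    exact absurd rfl hb
  | orig_side v w' h hw hs =>
    rw [hE.expandRot_orig_side h hw hs, base_port, hlink hc rfl hw.adj_sub.ne]
    rfl
  | orig_link v w' h1 h2 hw =>
    rw [expandRot_orig_link h1 h2 hw, base_port, hlink hc rfl hw.ne]
    rfl
  | orig_rim v w' h hw =>
    rw [expandRot_orig_rim h hw (hE.rot_adj hw)] at hb
    exact absurd rfl hb
  | hub_orig v h =>
    have hw := h.slot_spec.1
    have hc1 := covers_port (D := I.graphContraction) (E' := expand E)
      (show (⊤ : I.G.Subgraph).Adj v (I.slot v) from hw.adj_sub)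
    change I.graphContraction.Covers (expand E) (I.port v (I.slot v)) (I.port (I.slot v) v) _ at hc1
    rw [port_orig h.not_isWheel fun _ => hw] at hc1
    have r1 : (expand E).rot (.orig v) (I.port (I.slot v) v) = _ := expandRot_orig_slot h
    have hc2 := hc1.tree
      (by rw [r1]; exact isTree_root (D := I.graphContraction) rfl)
    rw [r1] at hc2
    rw [hE.expandRot_hub_orig, base_port, hc.unique hR hc2]
    rfl
  | hub_port v w' h hw hw' =>
    by_cases hr : I.H.Adj v (E.rot v w')
    · rw [expandRot_hub_port_of_adj h hw hr] at hb
      exact absurd rfl hb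
    · rw [expandRot_hub_port h hw hr, base_port, hlink hc rfl hw.ne]
      rfl
  | rim_orig v w' h hw hr =>
    rw [hE.expandRot_rim_orig h hw hr] at hb
    exact absurd rfl hb
  | rim_pred v w' h hw hr =>
    rw [hE.expandRot_rim_pred h hw hr, base_port, hc.unique hR (hsucc h hw hr)]
    rfl
  | rim_port v w' h hw hr =>
    rw [expandRot_rim_port h hw hr] at hb
    exact absurd rfl hb
  | rim_succ v w' h hw hr =>
    rw [hE.expandRot_rim_succ h hw hr] at hb
    exact absurd rfl hb

theorem not_isWheel_of_isolated {v : V} (hi : ∀ x, ¬ I.H.Adj v x) : ¬ I.IsWheel v := by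
  intro h
  obtain ⟨x, hx⟩ := Set.nonempty_of_ncard_ne_zero
    (show (I.H.neighborSet v).ncard ≠ 0 by rw [h.1]; decide)
  exact hi x hx

theorem expandFaceOf_orig_self {v : V} (h : ¬ I.IsWheel v) :
    expandFaceOf E (.orig v) (.orig v) = .inl (E.faceOf v v) := if_neg h

theorem IsSolution.expand_isExpansion [Finite V] (hE : I.IsSolution E) :
    I.graphContraction.IsExpansion (expand E) E (collapse E) .inl where
  rot := hE.expand_rot_base
  face_port h := by
    change collapse E (expandFaceOf E (I.port _ _) (I.port _ _)) = _
    rw [expandFaceOf_port h, collapse_inl]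
  face_root h := by
    change collapse E (expandFaceOf E (.orig _) (.orig _)) = _
    rw [expandFaceOf_orig_self (not_isWheel_of_isolated fun x hx => h x hx.adj_sub), collapse_inl]
  face_deleted {a b} hab hd := by
    change collapse E (expandFaceOf E a b) = collapse E (expandFaceOf E a (expandRot E a b))
    have hab : I.graph.Adj a b := hab
    obtain ⟨v, w, h, hw, hr, ⟨rfl, rfl⟩ | ⟨rfl, rfl⟩⟩ := hE.deleted_cases hab hd
    · rw [hE.expandRot_rim_orig h hw, hE.expandFaceOf_rim_orig h hw, hE.expandFaceOf_rim_pred h hw,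
        collapse_triangle h hw, collapse_inl]
    · rw [expandRot_rim_port h hw hr, expandFaceOf_rim_port, hE.expandFaceOf_rim_succ h hw,
        collapse_triangle h hw, collapse_inl]
  isRotation := hE.expand_isRotation
  facial_walk := hE.expand_facial_walk
  covers := graph_exists_covers hE.expand_isRotation
  port_face h := expandFaceOf_port h
  root_face h := expandFaceOf_orig_self (not_isWheel_of_isolated fun x hx => h x hx.adj_sub)
  new_face f := by
    rcases f with f | ⟨⟨v, w⟩, h, hw⟩
    · exact Or.inl ⟨f, rfl⟩
    · refine Or.inr ⟨.orig v, .rim v w h hw, graph_adj_spoke h hw, ?_⟩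
      exact (expandFaceOf_orig_rim h hw).trans (triangle_eq h hw)
  empty_face hK f := by
    rcases f with f | ⟨⟨v, w⟩, h, hw⟩
    · exact ⟨f, rfl⟩
    · exact absurd ⟨.orig v, trivial⟩ hK

/-- Only the rim edges of the wheels are deleted when the gadgets are contracted. The triangle
inside such an edge is labelled by the jump of `p` there: this jump is the same at both ends of the rim
edge, as `p` does not change along the spokes. -/
theorem IsSolution.expand_isPlanar [Finite V] (hE : I.IsSolution E) : (expand E).IsPlanar := by
  refine hE.expand_isExpansion.isPlanar hE.planar fun p ht hd => ?_
  obtain ⟨d, hd, hp⟩ := hd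
  -- the labels at the two rim vertices of a triangle are the same, as both are joined to the centre
  have tri : ∀ {v w} (h : I.IsWheel v) (hw : I.G.Adj v w) (hr : I.G.Adj v (E.rot v w)),
      p (.rim v (E.rot v w) h hr) (.orig v) = p (.rim v w h hw) (.rim v _ h hr) := by
    intro v w h hw hr
    have h1 := ht (.orig v) (.rim v w h hw) (graph_adj_spoke h hw)
      (isTree_root (D := I.graphContraction)
        ((congrArg base (expandRot_orig_rim h hw hr)).trans rfl))
    have r1 : (expand E).rot (.orig v) (.rim v w h hw) = _ := expandRot_orig_rim h hw hr
    have r2 : (expand E).rot (.rim v w h hw) (.rim v _ h hr) = _ := hE.expandRot_rim_succ h hw hr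
    have h2 := ht (.rim v w h hw) (.rim v _ h hr) (hE.graph_adj_rim_succ h hw hr) (by
      rw [r2]
      exact (isTree_root (D := I.graphContraction) rfl).symm)
    rw [r1] at h1
    rw [r2] at h2
    rw [h2, h1]
  -- on the outer side of a rim edge, the labels at its two ends coincide
  have key : ∀ {v w} (h : I.IsWheel v) (hw : I.G.Adj v w) (hr : I.G.Adj v (E.rot v w)),
      p (.rim v w h hw) (I.port w v) = p (.rim v (E.rot v w) h hr) (.rim v w h hw) := by
    intro v w h hw hr
    have h1 := hp _ _ (graph_adj_rim_port h hw)
    have h2 := hp _ _ (graph_adj_spoke h hr).symm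
    rw [show (expand E).rot (.rim v w h hw) (I.port w v) = _ from expandRot_rim_port h hw hr] at h1
    rw [show (expand E).rot (.rim v _ h hr) (.orig v) = _ from hE.expandRot_rim_orig h hw hr,
      tri h hw hr, CharTwo.add_self_eq_zero, hd, ← h1] at h2
    exact CharTwo.add_eq_zero.1 h2.symm
  let S : ExpandFace E → ZMod 2 := Sum.elim (fun _ => 0) fun x =>
    p (.rim x.1.1 x.1.2 x.2.1 x.2.2) (I.port x.1.2 x.1.1) +
      p (.rim x.1.1 x.1.2 x.2.1 x.2.2) (.rim x.1.1 _ x.2.1 (hE.rot_adj x.2.2))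
  have hS : ∀ {v w} (h : I.IsWheel v) (hw : I.G.Adj v w), S (triangle E v w) =
      p (.rim v w h hw) (I.port w v) +
        p (.rim v w h hw) (.rim v _ h (hE.rot_adj hw)) := by
    intro v w h hw
    rw [triangle_eq h hw]
    rfl
  refine ⟨S, fun a b hab hdel => ?_⟩
  have hab : I.graph.Adj a b := hab
  change p a b + S (expandFaceOf E a b) =
    p a (expandRot E a b) + S (expandFaceOf E a (expandRot E a b))
  obtain ⟨v, w, h, hw, hr, ⟨rfl, rfl⟩ | ⟨rfl, rfl⟩⟩ := hE.deleted_cases hab hdel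
  · rw [hE.expandRot_rim_orig h hw, hE.expandFaceOf_rim_orig h hw, hE.expandFaceOf_rim_pred h hw,
      hS h hw, tri h hw hr, key h hw hr, add_comm (p (.rim v (E.rot v w) h hr) _), ← add_assoc,
      CharTwo.add_self_eq_zero, zero_add]
    exact (add_zero _).symm
  · have h0 : S (.inl (E.faceOf v w)) = 0 := rfl
    rw [expandRot_rim_port h hw hr, expandFaceOf_rim_port, hE.expandFaceOf_rim_succ h hw, hS h hw,
      h0, add_zero, add_comm (p (.rim v w h hw) (I.port w v)), ← add_assoc,
      CharTwo.add_self_eq_zero, zero_add]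

end PortInstance

/-! ### The embedding of the modified graph is an extension -/

namespace PortInstance

open EmbeddingData StarContraction

variable {V : Type u} {I : PortInstance V} {E : EmbeddingData (⊤ : I.G.Subgraph)}

theorem not_subgraph_adj_rim {v w x : V} {h : I.IsWheel v} {hw : I.G.Adj v w} {hx : I.G.Adj v x} :
    ¬ I.subgraph.Adj (.rim v w h hw) (.rim v x h hx) := by
  intro hs
  rcases (subgraph_adj_rim hs).2 with h' | h'
  · cases h'
  · exact rim_ne_port h hx hw.ne h'

theorem IsSolution.expand_extends_rot [Finite V] (hE : I.IsSolution E) {a b : I.Vert}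
    (hab : I.subgraph.Adj a b) :
    ∃ k : ℕ, (expandRot E a)^[k + 1] b = I.rot a b ∧
      ∀ j < k, ¬ I.subgraph.Adj a ((expandRot E a)^[j + 1] b) := by
  have hadj : ∀ {v x}, I.G.Adj v x → ∀ j : ℕ, I.G.Adj v ((E.rot v)^[j] x) := fun hx j =>
    hE.isRotation.iterate (K := (⊤ : I.G.Subgraph)) hx j
  cases subgraphCorner hab with
  | orig_hub v h => exact ⟨0, expandRot_hub h _, by simp⟩
  | orig_slot v h => exact ⟨0, expandRot_hub h _, by simp⟩
  | orig_link v w hw hv hs =>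
    by_cases h : I.IsHub v
    · exact ⟨0, expandRot_hub h _, by simp⟩
    have hit : ∀ j : ℕ, (expandRot E (.orig v))^[j] (I.toward v w) =
        I.toward v ((E.rot v)^[j] w) := by
      intro j
      induction j with
      | zero => rfl
      | succ j ih =>
        rw [Function.iterate_succ_apply', ih, Function.iterate_succ_apply', toward_eq_port hv,
          toward_eq_port hv, expandRot_orig_link h hv (hadj hw.adj_sub j)]
    obtain ⟨k, hk, hk'⟩ := hE.ext.1 v w hw
    refine ⟨k, ?_, fun j hj hs => hk' j hj ?_⟩
    · rw [hit, hk, rot_orig_toward hw fun h' => h h'.1]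
    · rw [hit, toward_eq_port hv] at hs
      exact subgraph_adj_orig_port hs (hadj hw.adj_sub _).ne
  | orig_rim v w hv hw =>
    have hr := hE.rot_adj hw.adj_sub
    have hr2 := hE.wheel_rot_rot hv hw
    refine ⟨1, ?_, fun j hj => ?_⟩
    · rw [rot_orig_toward hw hv.not_isHub_and, toward_wheel hv hw.adj_sub,
        emb_rot_eq_of_two hv.1 hw hr2 (hE.isRotation.four hv.2.1 hw.adj_sub).1.2.1,
        toward_wheel hv hr2.adj_sub]
      rw [Function.iterate_succ_apply, Function.iterate_one]
      rw [expandRot_orig_rim hv hw.adj_sub hr, expandRot_orig_rim hv hr]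
    · obtain rfl : j = 0 := by omega
      rw [Nat.zero_add, Function.iterate_one]
      rw [toward_wheel hv hw.adj_sub, expandRot_orig_rim hv hw.adj_sub hr]
      intro hs
      exact hE.wheel_not_consecutive hv hw (I.subgraph.edge_vert hs.symm)
  | hub v h =>
    obtain ⟨k, hk, hk'⟩ := hE.expand_isRotation.exists_first_return I.subgraph hab
    exact ⟨k, subgraph_adj_hub_iff hk, hk'⟩
  | rim_orig v w h hw =>
    obtain ⟨x, hx, rfl⟩ := hE.isRotation.exists_rot_eq (K := (⊤ : I.G.Subgraph)) hw.adj_sub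
    refine ⟨1, ?_, fun j hj => ?_⟩
    · rw [Function.iterate_succ_apply, Function.iterate_one]
      rw [hE.expandRot_rim_orig h hx, hE.expandRot_rim_pred h hx, rot_rim_orig]
    · obtain rfl : j = 0 := by omega
      rw [Nat.zero_add, Function.iterate_one]
      rw [hE.expandRot_rim_orig h hx]
      exact not_subgraph_adj_rim
  | rim_port v w h hw =>
    have hr := hE.rot_adj hw.adj_sub
    refine ⟨1, ?_, fun j hj => ?_⟩
    · rw [Function.iterate_succ_apply, Function.iterate_one]
      rw [expandRot_rim_port h _ hr, hE.expandRot_rim_succ h, rot_rim_port]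
    · obtain rfl : j = 0 := by omega
      rw [Nat.zero_add, Function.iterate_one]
      rw [expandRot_rim_port h _ hr]
      exact not_subgraph_adj_rim

/-- The faces on both sides of an edge outside the modified subgraph. -/
theorem IsSolution.expand_extends_side [Finite V] (hE : I.IsSolution E)
    {π : E.Face → I.emb.Face} (hπ : ∀ v w, I.G.Adj v w → ¬ I.H.Adj v (E.rot v w) →
      π (E.faceOf v w) = π (E.faceOf v (E.rot v w))) {a b : I.Vert} (hab : I.graph.Adj a b)
    (hn : ¬ I.subgraph.Adj a (expandRot E a b)) :
    π (collapse E (expandFaceOf E a b)) =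
      π (collapse E (expandFaceOf E a (expandRot E a b))) := by
  have hR := hE.expand_isRotation
  have hnext := hR.adj (K := (⊤ : I.graph.Subgraph)) hab
  cases hE.corner hab with
  | orig_hub v h => exact absurd (h.subgraph_adj hnext) hn
  | orig_slot v h => exact absurd (h.subgraph_adj hnext) hn
  | orig_side v w h hw hs => exact absurd (h.subgraph_adj hnext) hn
  | orig_link v w h1 h2 hw =>
    have hr := hE.rot_adj hw
    rw [expandRot_orig_link h1 h2 hw] at hn ⊢
    rw [expandFaceOf_orig_port h2 hw, expandFaceOf_orig_port h2 hr]
    refine hπ v w hw fun h => hn ?_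
    rw [← toward_eq_port h2]
    exact subgraph_adj_toward h
  | orig_rim v w h hw =>
    have hr := hE.rot_adj hw
    rw [expandRot_orig_rim h hw hr] at hn ⊢
    rw [expandFaceOf_orig_rim, expandFaceOf_orig_rim, collapse_triangle h hw,
      collapse_triangle h hr]
    exact hπ v w hw fun h' => hn (subgraph_adj_spoke h h')
  | hub_orig v h =>
    have hs := h.slot_spec.1.adj_sub
    rw [hE.expandRot_hub_orig, expandFaceOf_hub_orig, expandFaceOf_hub_port h (hE.rot_adj hs)]
    exact hπ v _ hs (hE.hub_rot_slot h)
  | hub_port v w h hw hw' =>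
    by_cases hr : I.H.Adj v (E.rot v w)
    · rw [expandRot_hub_port_of_adj h hw hr] at hn
      exact absurd (subgraph_adj_hub h).symm hn
    · rw [expandRot_hub_port h hw hr, expandFaceOf_hub_port h hw,
        expandFaceOf_hub_port h (hE.rot_adj hw)]
      exact hπ v _ hw hr
  | rim_orig v w h hw hr =>
    rw [hE.expandRot_rim_orig h hw, hE.expandFaceOf_rim_orig h hw, hE.expandFaceOf_rim_pred h hw,
      collapse_triangle h hw, collapse_inl]
  | rim_pred v w h hw hr =>
    rw [hE.expandRot_rim_pred h hw] at hn ⊢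
    rw [hE.expandFaceOf_rim_pred h hw, expandFaceOf_rim_port]
    exact hπ v w hw fun h' => hn (subgraph_adj_rim_port h h')
  | rim_port v w h hw hr =>
    rw [expandRot_rim_port h hw hr, expandFaceOf_rim_port, hE.expandFaceOf_rim_succ h hw,
      collapse_triangle h hw, collapse_inl]
  | rim_succ v w h hw hr =>
    rw [hE.expandRot_rim_succ h hw] at hn ⊢
    rw [hE.expandFaceOf_rim_succ h hw, collapse_triangle h hw]
    obtain ⟨x, hx, rfl⟩ := hE.isRotation.exists_rot_eq (K := (⊤ : I.G.Subgraph)) hw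
    rw [hE.expandFaceOf_rim_orig h hx, collapse_triangle h hx]
    exact (hπ v x hx fun h' => hn (subgraph_adj_spoke h h').symm).symm

theorem IsSolution.expand_extends_corner [Finite V] (hE : I.IsSolution E)
    {π : E.Face → I.emb.Face} (hπ : ∀ v w, I.H.Adj v w → π (E.faceOf v w) = I.emb.faceOf v w)
    {a b : I.Vert} (hab : I.subgraph.Adj a b) :
    π (collapse E (expandFaceOf E a b)) = I.faceOf a b := by
  cases subgraphCorner hab with
  | orig_hub v h =>
    have hs := h.slot_spec.1
    rw [expandFaceOf_orig_hub, collapse_inl, hπ _ _ (I.emb_isRotation.adj hs).symm,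
      ← emb_facial_walk hs]
    rfl
  | orig_slot v h =>
    rw [faceOf_orig_toward h.slot_spec.1, toward_eq_port h.not_isWheel,
      expandFaceOf_orig_port h.not_isWheel h.slot_spec.1.adj_sub]
    exact hπ _ _ h.slot_spec.1
  | orig_link v w hw hv hs =>
    rw [faceOf_orig_toward hw, toward_eq_port hv, expandFaceOf_orig_port hv hw.adj_sub]
    exact hπ _ _ hw
  | orig_rim v w hv hw =>
    rw [faceOf_orig_toward hw, toward_wheel hv hw.adj_sub, expandFaceOf_orig_rim,
      collapse_triangle hv hw.adj_sub]
    exact hπ _ _ hw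
  | hub v h =>
    rw [expandFaceOf_hub_orig]
    exact hπ _ _ h.slot_spec.1
  | rim_orig v w h hw =>
    obtain ⟨x, hx, rfl⟩ := hE.isRotation.exists_rot_eq (K := (⊤ : I.G.Subgraph)) hw.adj_sub
    rw [hE.expandFaceOf_rim_orig h hx, collapse_triangle h hx, hE.facial_walk hx,
      hπ _ _ hw.symm]
    exact (if_pos rfl).symm
  | rim_port v w h hw =>
    rw [expandFaceOf_rim_port, collapse_inl, hπ _ _ hw, ← faceOf_port hw,
      port_wheel h hw.adj_sub]

theorem IsSolution.expand_extends [Finite V] (hE : I.IsSolution E) :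
    EmbeddingData.Extends (H := I.subgraph) (expand E) I.reduced.emb := by
  obtain ⟨π, hπ1, hπ2, hπ3, hπ4⟩ := hE.ext.2
  refine ⟨fun a b hab => hE.expand_extends_rot hab, fun f => π (collapse E f),
    fun a b hab hn => hE.expand_extends_side hπ1 hab hn,
    fun a b hab => hE.expand_extends_corner hπ2 hab, ?_, hπ4⟩
  intro a ha hi b hab
  have har := eq_root_of_isolated (D := I.subgraphContraction) ha hi
  have hiH := isolated_base (D := I.subgraphContraction) ha hi
  change a = .orig (base a) at har
  change ∀ x, ¬ I.H.Adj (base a) x at hiH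
  generalize base a = v at har hiH
  subst har
  have hw := not_isWheel_of_isolated hiH
  have hh : ¬ I.IsHub v := fun h => hiH _ h.exists_adj.choose_spec
  change π (collapse E (expandFaceOf E (.orig v) b)) = I.emb.faceOf v v
  rcases hab with hab | ⟨rfl, -, hiG⟩
  · rcases graph_adj_orig hab with ⟨h, -⟩ | ⟨_, h, -⟩ | ⟨h1, -, -, h4⟩
    · exact absurd h hh
    · exact absurd h hw
    · rw [h4, expandFaceOf_orig_port hw h1]
      exact hπ3 v ha hiH _ (Or.inl h1)
  · rw [expandFaceOf_orig_self hw]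
    refine hπ3 v ha hiH v (Or.inr ⟨rfl, trivial, fun x hx => ?_⟩)
    exact hiG _ (graph_adj_orig_port hw hx fun h => absurd h hh)

theorem hasExtension_of_hasPortExtension [Finite V] (h : I.HasPortExtension) :
    I.reduced.HasExtension := by
  obtain ⟨E, h1, h2, h3⟩ := h
  have hE : I.IsSolution E := ⟨h1, h2, h3⟩
  exact ⟨expand E, hE.expand_isPlanar, hE.expand_extends⟩

end PortInstance

/-- The modified triple is an instance (the embedding of the modified subgraph is planar), and it is
solvable if and only if the given instance with port constraints is. -/
theorem lemma1 {V : Type u} [Finite V] (I : PortInstance V) :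
    I.reduced.emb.IsPlanar ∧ (I.reduced.HasExtension ↔ I.HasPortExtension) :=
  ⟨I.reduced_isPlanar, PortInstance.hasPortExtension_of_hasExtension,
    PortInstance.hasExtension_of_hasPortExtension⟩
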